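/- Let $n\ge 1$, $d=2^n$, $\mathcal H=(\mathbb C^2)^{\otimes n}$. For a unit vector $|\psi\rangle\in\mathcal H$, a finite set $\mathcal P$ of Hermitian operators, $C>0$ and $k\in\{1,2\}$, consider $\Lambda(\psi)=C\sum_{P\in\mathcal P}\langle\psi|P|\psi\rangle^{2k}$. With $k=1$ except for $\Lambda_{\rm stab}$, where $k=2$, the eight witnesses are: - $\Lambda_{\rm ent}$: $C=\frac1n$, $\mathcal P=\{X_i,Y_i,Z_i\}_{i=1}^n$; - $\Lambda_{\rm ferm}$: $C=\frac1n$, $\mathcal P=\{i\gamma_j\gamma_k\}_{1\le j<k\le 2n}$, where $\gamma_{2j-1}=Z^{\otimes (j-1)}\otimes X\otimes 1^{\otimes (n-j)}$ and $\gamma_{2j}=Z^{\otimes (j-1)}\otimes Y\otimes 1^{\otimes (n-j)}$ are the Majorana operators; - $\Lambda_{\rm imag}$: $C=\frac1{2^n-1}$, $\mathcal P$ the Pauli strings $P\in\{1,X,Y,Z\}^{\otimes n}\setminus\{1\}$ with $P=P^T$; - $\Lambda_{\rm real}$: $C=\frac1{2^{n-1}}$, $\mathcal P$ the Pauli strings with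 $P=-P^T$; - $\Lambda_{\rm coh}$: $C=\frac1{s^2}$, $\mathcal P=\{S_x,S_y,S_z\}$ the spin-$s$ operators, $s=\frac{2^n-1}2$, with $\mathcal H$ identified with the spin-$s$ space so that $|s,s\rangle,|s,s-1\rangle,\dots,|s,-s\rangle$ is the computational basis in lexicographic order; - $\Lambda_{\rm stab}$: $C=\frac1{2^n-1}$, $k=2$, $\mathcal P=\{1,X,Y,Z\}^{\otimes n}\setminus\{1\}$; - $\Lambda_{S_n}$: $C=\frac1{2^n-1}$, $\mathcal P$ the set of distinct twirls $\frac1{n!}\sum_{\pi\in S_n}R(\pi)PR(\pi)^\dagger$ of the Pauli strings $P\neq 1$, where $R$ permutes the qubits, each rescaled by a positive factor so that $\mathrm{Tr}[Q^2]=2^n$; - $\Lambda_{\rm uent}$: $C=\frac1{n^2}$, $\mathcal P=\{\sum_iX_i,\sum_iY_i,\sum_iZ_i\}$. Let $\mathbb E_H$ be the expectation over $U|0\rangle^{\otimes n}$ with $U$ Haar distributed on $\mathrm U(2^n)$, and let $\mathbb E_{\rm imag}$, $\mathbb E_{\rm real}$ be the expectations over $U|0\rangle^{\otimes n}$ and $U|+_y\rangle^{\otimes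 n}$ with $U$ Haar distributed on $\mathrm O(2^n)$, where $|+_y\rangle=\frac1{\sqrt2}(|0\rangle+i|1\rangle)$. All these expectations exist, and for every $n\ge1$ (for even $n$ in the two entries marked $*$) they are as follows, where $Te_m=\frac16m(m+1)(m+2)$. The last two columns are the limits as $n\to\infty$ (over all $n$) of the ratios of the actual expectations. $$\begin{array}{c|ccc|cc} & \mathbb E_H & \mathbb E_{\rm imag} & \mathbb E_{\rm real} & \lim\frac{\mathbb E_{\rm imag}}{\mathbb E_H} & \lim\frac{\mathbb E_{\rm real}}{\mathbb E_H}\\\hline \Lambda_{\rm ent} & \frac3{d+1} & \frac4{d+2} & \frac{3d-2}{(d-1)(d+2)} & \frac43 & 1\\ \Lambda_{\rm ferm} & \frac{2n-1}{d+1} & \frac{2n}{d+2} & \frac{d(2n-1)-2}{(d-1)(d+2)} & 1 & 1\\ \Lambda_{\rm imag} & \frac{d+2}{2d+2} & 1 & \frac{d-2}{2(d-1)} & 2 & 1\\ \Lambda_{\rm real} & \frac{d-1}{d+1} & 0 & 1 & 0 & 1\\ \Lambda_{\rm coh} & \frac1{d-1} & \frac43\,\frac{d+1}{(d-1)(d+2)}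 & \frac{3d^2+d-2}{3(d-1)^2(d+2)} & \frac43 & 1\\ \Lambda_{\rm stab} & \frac3{3+d} & \frac6{6+d} & \frac{3(3d+d^2-2)}{(d-1)(d+1)(d+6)} & 2 & 1\\ \Lambda_{S_n} & \frac{Te_{n+1}-1}{d^2-1} & \frac{2\left(\frac16(\frac n2+1)(\frac n2+2)(2n+3)-1\right)}{(d-1)(d+2)}\,{}^{*} & \frac{d\,n(n(n+6)+11)-3n(n+4)}{6(d-1)^2(d+2)}\,{}^{*} & 1 & 1\\ \Lambda_{\rm uent} & \frac3{n(d+1)} & \frac4{n(d+2)} & \frac{3d-2}{n(d-1)(d+2)} & \frac43 & 1 \end{array}$$ -/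

import Mathlib

open MeasureTheory Filter
open scoped Topology Matrix

noncomputable section

namespace QRT

section HaarGroups

variable {ι 𝕜 : Type} [Fintype ι] [DecidableEq ι] [RCLike 𝕜]

instance instMeasurableSpaceUnitaryGroup : MeasurableSpace (Matrix.unitaryGroup ι 𝕜) :=
  borel _

instance instBorelSpaceUnitaryGroup : BorelSpace (Matrix.unitaryGroup ι 𝕜) :=
  ⟨rfl⟩

instance instCompactSpaceUnitaryGroup : CompactSpace (Matrix.unitaryGroup ι 𝕜) := by
  apply isCompact_iff_compactSpace.mp
  have hK : IsCompact (Set.univ.pi fun _ : ι => Set.univ.pi fun _ : ι =>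
      Metric.closedBall (0 : 𝕜) 1) :=
    isCompact_univ_pi fun _ => isCompact_univ_pi fun _ => isCompact_closedBall _ _
  refine IsCompact.of_isClosed_subset (X := Matrix ι ι 𝕜) hK
    (isClosed_unitary (R := Matrix ι ι 𝕜)) ?_
  intro U hU i _ j _
  simpa using entry_norm_bound_of_unitary hU i j

/-- Over `ℝ`, the group `Matrix.unitaryGroup` is the orthogonal group. -/
theorem mem_unitaryGroup_real_iff (A : Matrix ι ι ℝ) :
    A ∈ Matrix.unitaryGroup ι ℝ ↔ A * Aᵀ = 1 := by
  rw [Matrix.mem_unitaryGroup_iff]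
  have h : star A = Aᵀ := by
    ext i j
    simp [Matrix.star_apply]
  rw [h]

/-- The Haar measure on the compact group `U(ι)` (for `𝕜 = ℂ`) or `O(ι)` (for `𝕜 = ℝ`),
normalized to total mass one. -/
def haarProb (ι 𝕜 : Type) [Fintype ι] [DecidableEq ι] [RCLike 𝕜] :
    Measure (Matrix.unitaryGroup ι 𝕜) :=
  Measure.haarMeasure (⊤ : TopologicalSpace.PositiveCompacts (Matrix.unitaryGroup ι 𝕜))

instance instIsProbabilityMeasureHaarProb : IsProbabilityMeasure (haarProb ι 𝕜) :=
  ⟨by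
    have h := Measure.haarMeasure_self
      (K₀ := (⊤ : TopologicalSpace.PositiveCompacts (Matrix.unitaryGroup ι 𝕜)))
    simpa [haarProb] using h⟩

end HaarGroups

/-- Labels `|x₁ x₂ … xₙ⟩` of the computational basis of `(ℂ²)^{⊗ n}`. -/
abbrev Bits (n : ℕ) : Type := Fin n → Fin 2

/-- Vectors of the `n`-qubit Hilbert space `(ℂ²)^{⊗ n}`, in the computational basis. -/
abbrev Ket (n : ℕ) : Type := Bits n → ℂ

/-- Operators on the `n`-qubit Hilbert space, in the computational basis. -/
abbrev Op (n : ℕ) : Type := Matrix (Bits n) (Bits n) ℂ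

/-- The state `|0⟩^{⊗ n}`. -/
def ketZero (n : ℕ) : Ket n := Pi.single 0 1

/-- The state `|+_y⟩^{⊗ n}`, where `|+_y⟩ = (|0⟩ + i |1⟩) / √2`. -/
def ketPlusY (n : ℕ) : Ket n :=
  fun x => ∏ k, (![1, Complex.I] (x k) / (Real.sqrt 2 : ℂ))

/-- The single-qubit Pauli matrices `1, X, Y, Z`, labelled `0, 1, 2, 3`. -/
def pauli : Fin 4 → Matrix (Fin 2) (Fin 2) ℂ :=
  ![1, !![0, 1; 1, 0], !![0, -Complex.I; Complex.I, 0], !![1, 0; 0, -1]]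

/-- The Pauli string `σ₁ ⊗ σ₂ ⊗ … ⊗ σₙ`. -/
def pauliString {n : ℕ} (σ : Fin n → Fin 4) : Op n :=
  Matrix.of fun x y => ∏ k, pauli (σ k) (x k) (y k)

/-- The one-qubit Pauli matrix `pauli a` acting on qubit `k`, and the identity elsewhere. -/
def localPauli {n : ℕ} (k : Fin n) (a : Fin 4) : Op n :=
  pauliString (Pi.single k a)

/-- The expectation value `⟨ψ|P|ψ⟩`, a real number for Hermitian `P`. -/
def expVal {n : ℕ} (P : Op n) (ψ : Ket n) : ℝ := (star ψ ⬝ᵥ (P *ᵥ ψ)).re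

/-- The quantity `C ∑_{P ∈ Ps} ⟨ψ|P|ψ⟩^{2k}`. -/
def witness {n : ℕ} (C : ℝ) (Ps : Finset (Op n)) (k : ℕ) (ψ : Ket n) : ℝ :=
  C * ∑ P ∈ Ps, expVal P ψ ^ (2 * k)

/-! ### The sets of operators -/

open Classical in
/-- All `X_i, Y_i, Z_i`. -/
def entOps (n : ℕ) : Finset (Op n) :=
  Finset.univ.biUnion fun i : Fin n => {localPauli i 1, localPauli i 2, localPauli i 3}

/-- The Majorana operators, `γ₁ = X1…1, γ₂ = Y1…1, γ₃ = ZX1…1, γ₄ = ZY1…1, …`,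
with indices shifted to start from `0`. -/
def majorana {n : ℕ} (a : Fin (2 * n)) : Op n :=
  pauliString fun k =>
    if (k : ℕ) < (a : ℕ) / 2 then 3
    else if (k : ℕ) = (a : ℕ) / 2 then (if (a : ℕ) % 2 = 0 then 1 else 2)
    else 0

open Classical in
/-- All `i γ_j γ_k` with `j < k`. -/
def fermOps (n : ℕ) : Finset (Op n) :=
  (Finset.univ.filter fun p : Fin (2 * n) × Fin (2 * n) => p.1 < p.2).image
    fun p => Complex.I • (majorana p.1 * majorana p.2)

open Classical in
/-- All Pauli strings other than the identity. -/
def stabOps (n : ℕ) : Finset (Op n) :=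
  (Finset.univ.image fun σ : Fin n → Fin 4 => pauliString σ).filter fun P => P ≠ 1

open Classical in
/-- The symmetric Pauli strings other than the identity. -/
def symOps (n : ℕ) : Finset (Op n) :=
  (stabOps n).filter fun P => P = Pᵀ

open Classical in
/-- The antisymmetric Pauli strings. -/
def asymOps (n : ℕ) : Finset (Op n) :=
  (Finset.univ.image fun σ : Fin n → Fin 4 => pauliString σ).filter fun P => P = -Pᵀ

/-- The spin `s = (2ⁿ - 1) / 2`, for which `2 s + 1 = 2ⁿ`. -/
def spin (n : ℕ) : ℝ := (2 ^ n - 1) / 2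

/-- The magnetic number `m = s - ∑ₖ xₖ 2^{n-k}` of the basis vector `|x₁ x₂ … xₙ⟩`: the spin basis
`|s, s⟩, |s, s - 1⟩, …, |s, -s⟩` is the computational basis in lexicographic order, and
`|s, s⟩ = |0⟩^{⊗ n}`. -/
def magnetic {n : ℕ} (x : Bits n) : ℝ :=
  spin n - ∑ k : Fin n, ((x k : ℕ) : ℝ) * 2 ^ (n - 1 - (k : ℕ))

open Classical in
/-- The generator `S_x` of the irreducible spin-`s` representation of `SU(2)`. -/
def spinX (n : ℕ) : Op n := Matrix.of fun x y =>
  (1 / 2 : ℂ) * ((if magnetic x = magnetic y + 1 then 1 else 0)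
      + (if magnetic x + 1 = magnetic y then 1 else 0))
    * (Real.sqrt (spin n * (spin n + 1) - magnetic x * magnetic y) : ℂ)

open Classical in
/-- The generator `S_y` of the irreducible spin-`s` representation of `SU(2)`. -/
def spinY (n : ℕ) : Op n := Matrix.of fun x y =>
  (1 / (2 * Complex.I) : ℂ) * ((if magnetic x = magnetic y + 1 then 1 else 0)
      - (if magnetic x + 1 = magnetic y then 1 else 0))
    * (Real.sqrt (spin n * (spin n + 1) - magnetic x * magnetic y) : ℂ)

/-- The generator `S_z` of the irreducible spin-`s` representation of `SU(2)`. -/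
def spinZ (n : ℕ) : Op n := Matrix.diagonal fun x => (magnetic x : ℂ)

open Classical in
/-- The three components of the spin operator. -/
def cohOps (n : ℕ) : Finset (Op n) := {spinX n, spinY n, spinZ n}

/-- The qubit-permuting representation,
`R(π) |i₁ … iₙ⟩ = |i_{π⁻¹(1)} … i_{π⁻¹(n)}⟩`. -/
def qubitPerm {n : ℕ} (π : Equiv.Perm (Fin n)) : Op n :=
  Matrix.of fun x y => if x = y ∘ ⇑π⁻¹ then 1 else 0

/-- The twirl `(1 / n!) ∑_π R(π) P R(π)†` over the symmetric group. -/
def twirl {n : ℕ} (P : Op n) : Op n :=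
  ((n.factorial : ℂ)⁻¹) • ∑ π : Equiv.Perm (Fin n), qubitPerm π * P * (qubitPerm π)ᴴ

/-- The positive multiple `Q` of a nonzero Hermitian `P` with `Tr[Q²] = 2ⁿ`. -/
def normalizeOp {n : ℕ} (P : Op n) : Op n :=
  (Real.sqrt (2 ^ n / ((P * P).trace).re) : ℂ) • P

open Classical in
/-- The distinct normalized twirls of the Pauli strings other than the identity. -/
def snOps (n : ℕ) : Finset (Op n) :=
  (stabOps n).image fun P => normalizeOp (twirl P)

open Classical in
/-- The three operators `∑ᵢ X_i, ∑ᵢ Y_i, ∑ᵢ Z_i`. -/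
def uentOps (n : ℕ) : Finset (Op n) :=
  {∑ i : Fin n, localPauli i 1, ∑ i : Fin n, localPauli i 2, ∑ i : Fin n, localPauli i 3}

/-! ### The eight witnesses -/

/-- Witness of multipartite entanglement. -/
def entW (n : ℕ) : Ket n → ℝ := witness (1 / n) (entOps n) 1

/-- Witness of fermionic non-Gaussianity. -/
def fermW (n : ℕ) : Ket n → ℝ := witness (1 / n) (fermOps n) 1

/-- Witness of imaginarity. -/
def imagW (n : ℕ) : Ket n → ℝ := witness (1 / (2 ^ n - 1)) (symOps n) 1

/-- Witness of realness. -/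
def realW (n : ℕ) : Ket n → ℝ := witness (1 / 2 ^ (n - 1)) (asymOps n) 1

/-- Witness of spin coherence. -/
def cohW (n : ℕ) : Ket n → ℝ := witness (1 / spin n ^ 2) (cohOps n) 1

/-- Witness of Clifford non-stabilizerness. -/
def stabW (n : ℕ) : Ket n → ℝ := witness (1 / (2 ^ n - 1)) (stabOps n) 2

/-- Witness of `Sₙ`-equivariance. -/
def snW (n : ℕ) : Ket n → ℝ := witness (1 / (2 ^ n - 1)) (snOps n) 1

/-- Witness of non-uniform entanglement. -/
def uentW (n : ℕ) : Ket n → ℝ := witness (1 / (n : ℝ) ^ 2) (uentOps n) 1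

/-! ### The three ensembles -/

/-- `U |0⟩^{⊗ n}` for `U` in `U(2ⁿ)`. -/
def haarKet {n : ℕ} (U : Matrix.unitaryGroup (Bits n) ℂ) : Ket n :=
  (U : Op n) *ᵥ ketZero n

/-- `U |0⟩^{⊗ n}` for `U` in `O(2ⁿ)`. -/
def imagKet {n : ℕ} (U : Matrix.unitaryGroup (Bits n) ℝ) : Ket n :=
  (U : Matrix (Bits n) (Bits n) ℝ).map Complex.ofReal *ᵥ ketZero n

/-- `U |+_y⟩^{⊗ n}` for `U` in `O(2ⁿ)`. -/
def realKet {n : ℕ} (U : Matrix.unitaryGroup (Bits n) ℝ) : Ket n :=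
  (U : Matrix (Bits n) (Bits n) ℝ).map Complex.ofReal *ᵥ ketPlusY n

/-- The expectation of `Λ` over Haar random `n`-qubit states. -/
def expHaar {n : ℕ} (Λ : Ket n → ℝ) : ℝ := ∫ U, Λ (haarKet U) ∂haarProb (Bits n) ℂ

/-- The expectation of `Λ` over real states `U |0⟩^{⊗ n}`, with `U` Haar random in `O(2ⁿ)`. -/
def expImag {n : ℕ} (Λ : Ket n → ℝ) : ℝ := ∫ U, Λ (imagKet U) ∂haarProb (Bits n) ℝ

/-- The expectation of `Λ` over states `U |+_y⟩^{⊗ n}`, with `U` Haar random in `O(2ⁿ)`. -/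
def expReal {n : ℕ} (Λ : Ket n → ℝ) : ℝ := ∫ U, Λ (realKet U) ∂haarProb (Bits n) ℝ

/-- The tetrahedral numbers `Te_m = m (m + 1) (m + 2) / 6`. -/
def tetrahedral (m : ℕ) : ℝ := m * (m + 1) * (m + 2) / 6

end QRT

end

/-!
All three ensembles are orbits `ψ = U v` of a compact group `G`, the unitary group or the orthogonal
group, under normalized Haar measure. By left invariance the integral of a function over `G` does
not change under translation along a one-parameter subgroup, so that the integral of its derivative
vanishes (`integral_flow_deriv_eq_zero`). This is applied to the functions
`ψ̄_j (P ψ)_i (ψ† P ψ) ^ m`, differentiated along the generator with index `(i, j)` and summed over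
`i, j`. For the unitary group the generators are the elementary matrices `E_ij`, which are complex
combinations of skew-adjoint ones; for the orthogonal group they are `E_ij - E_ji`. The sums
contract to quadratic forms in `ψ` and give linear recursions for the moments of `ψ† P ψ`, without
Weingarten calculus (`mean_unitary_recursion`, `mean_real_symm_recursion`,
`mean_isotropic_antisymm_recursion`, `mean_isotropic_symm_recursion`).

The orthogonal group also preserves `ψᵀ ψ`, which is `1` for `v = |0⟩^{⊗ n}` and `0` for
`v = |+_y⟩^{⊗ n}`. In the first case `ψ` is real, and `ψ† P ψ = 0` for antisymmetric Hermitian `P`.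
In the second case the recursion for symmetric `P` contains `|ψᵀ P ψ|²`, which is eliminated by a
second integration by parts (`mean_isotropic_formT`, `mean_isotropic_formT_mul_sq`). With `d = 2ⁿ`,
a traceless Hermitian `P` with `Tr[P²] = d q` has the second moments

* `q / (d + 1)` over Haar random states,
* `2 q / (d + 2)` or `0` over real states, for symmetric or antisymmetric `P`,
* `(d - 2) q / ((d - 1) (d + 2))` or `q / (d - 1)` over the orthogonal orbit of `|+_y⟩^{⊗ n}`;

the fourth moments, needed for `P² = 1` only, follow from the same recursions.

Every operator which occurs in the witnesses is symmetric or antisymmetric, so each expectation is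
determined by `q` and by the numbers of symmetric and of antisymmetric operators.

* A Pauli string is symmetric if its number of factors `Y` is even. The difference of the two
  numbers is the sum of all signs, which factorizes over the qubits (`sum_stringSign`).
* For `i γ_a γ_b` the Clifford relations and the parity of the indices suffice
  (`card_increasing_pairs_parity`).
* Two of the three spin operators are symmetric, and `Tr[S²]` is a sum over the magnetic numbers.
* Two Pauli strings have the same twirl if and only if they agree up to a permutation of the qubits,
  that is, if each Pauli matrix occurs equally often in both (`twirlOp_eq_iff`, `pauliType_eq_iff`).
  The twirls are thus counted by the compositions of `n` into four parts, zero parts allowed, with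
  the parity of the part of `Y` (`card_types`).

For the ratios, each closed form is a function of `2⁻ⁿ` and at most one further null sequence,
continuous at the origin. For odd `n` the twirls are not given a closed form; the balance
`typeExcess n` of symmetric and antisymmetric types grows at most quadratically, and their number
cubically.
-/

noncomputable section

namespace QRT

/-! ### Haar invariance and one-parameter subgroups -/

section Invariance

variable {ι 𝕜 : Type} [Fintype ι] [DecidableEq ι] [RCLike 𝕜]

instance instIsMulLeftInvariantHaarProb : (haarProb ι 𝕜).IsMulLeftInvariant := by
  unfold haarProb; infer_instance

theorem integrable_of_continuous {E : Type*} [NormedAddCommGroup E] [SecondCountableTopology E]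
    {F : Matrix.unitaryGroup ι 𝕜 → E} (hF : Continuous F) : Integrable F (haarProb ι 𝕜) := by
  obtain ⟨C, hC⟩ := isCompact_univ.exists_bound_of_continuousOn hF.continuousOn
  let := borel E
  have : BorelSpace E := ⟨rfl⟩
  exact Integrable.of_bound hF.measurable.aestronglyMeasurable C
    (Eventually.of_forall fun U => hC U trivial)

/-- The Haar integral of a derivative along left translations by a one-parameter subgroup
vanishes. -/
theorem integral_flow_deriv_eq_zero (V : ℝ → Matrix.unitaryGroup ι 𝕜)
    (hV : ∀ s t, V (s + t) = V s * V t) {F D : Matrix.unitaryGroup ι 𝕜 → ℂ}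
    (hF : Continuous F) (hD : Continuous D)
    (h : ∀ U, HasDerivAt (fun t => F (V t * U)) (D U) 0) :
    ∫ U, D U ∂haarProb ι 𝕜 = 0 := by
  have hV0 : V 0 = 1 := by
    have := hV 0 0
    rw [add_zero] at this
    exact (mul_eq_left.mp this.symm)
  -- the group law moves the derivative at `0` to every `s`
  have hder : ∀ U s, HasDerivAt (fun t => F (V t * U)) (D (V s * U)) s := by
    intro U s
    have h1 := h (V s * U)
    rw [show (0 : ℝ) = s - s by ring] at h1
    have h2 := h1.comp_sub_const s s
    refine h2.congr_of_eventuallyEq (Eventually.of_forall fun t => ?_)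
    simp only [← mul_assoc, ← hV]
    rw [sub_add_cancel]
  obtain ⟨C, hC⟩ := isCompact_univ.exists_bound_of_continuousOn hD.continuousOn
  have key := (hasDerivAt_integral_of_dominated_loc_of_deriv_le (μ := haarProb ι 𝕜)
    (F := fun t U => F (V t * U)) (F' := fun t U => D (V t * U)) (x₀ := (0 : ℝ))
    (s := Set.univ) (bound := fun _ => C) univ_mem
    (Eventually.of_forall fun t =>
      (integrable_of_continuous (hF.comp (continuous_const_mul (V t)))).aestronglyMeasurable)
    (integrable_of_continuous (hF.comp (continuous_const_mul (V 0))))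
    (integrable_of_continuous (hD.comp (continuous_const_mul (V 0)))).aestronglyMeasurable
    (Eventually.of_forall fun U t _ => hC _ trivial) (integrable_const C)
    (Eventually.of_forall fun U t _ => hder U t)).2
  -- by left invariance the differentiated integral does not depend on `t`
  simp only [integral_mul_left_eq_self, hV0, one_mul] at key
  exact key.unique (hasDerivAt_const _ _)

open NormedSpace in
/-- The one-parameter group `t ↦ exp (t X)` generated by a skew-adjoint matrix `X`. -/
def expFlow (X : Matrix ι ι 𝕜) (hX : Xᴴ = -X) (t : ℝ) : Matrix.unitaryGroup ι 𝕜 :=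
  ⟨exp (t • X), by
    rw [Matrix.mem_unitaryGroup_iff', Matrix.star_eq_conjTranspose, ← Matrix.exp_conjTranspose,
      Matrix.conjTranspose_smul, hX, ← Matrix.exp_add_of_commute]
    · simp
    · simp⟩

theorem expFlow_add (X : Matrix ι ι 𝕜) (hX : Xᴴ = -X) (s t : ℝ) :
    expFlow X hX (s + t) = expFlow X hX s * expFlow X hX t := by
  apply Subtype.ext
  simp only [expFlow, Submonoid.coe_mul, add_smul]
  exact Matrix.exp_add_of_commute _ _ (((Commute.refl X).smul_left s).smul_right t)

open NormedSpace in
theorem hasDerivAt_expFlow (X : Matrix ι ι 𝕜) (hX : Xᴴ = -X) (x y : ι) :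
    HasDerivAt (fun t => (expFlow X hX t : Matrix ι ι 𝕜) x y) (X x y) 0 := by
  let : NormedRing (Matrix ι ι 𝕜) := Matrix.linftyOpNormedRing
  let : NormedAlgebra ℝ (Matrix ι ι 𝕜) := Matrix.linftyOpNormedAlgebra
  have h := hasDerivAt_exp_smul_const (𝕂 := ℝ) X (0 : ℝ)
  simp only [zero_smul, exp_zero, one_mul] at h
  exact (hasDerivAt_pi.1 ((hasDerivAt_pi.1 h) x)) y

/-- The state `ρ(U) v`, for a matrix `U` over `ℝ` or `ℂ` and `ρ` the inclusion into `ℂ`. -/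
def orbitVec (ρ : 𝕜 →⋆ₐ[ℝ] ℂ) (v : ι → ℂ) (U : Matrix.unitaryGroup ι 𝕜) : ι → ℂ :=
  (U : Matrix ι ι 𝕜).map ρ *ᵥ v

theorem continuous_starAlgHom (ρ : 𝕜 →⋆ₐ[ℝ] ℂ) : Continuous ρ :=
  ρ.toAlgHom.toLinearMap.continuous_of_finiteDimensional

theorem continuous_orbitVec (ρ : 𝕜 →⋆ₐ[ℝ] ℂ) (v : ι → ℂ) : Continuous (orbitVec ρ v) := by
  unfold orbitVec
  exact (continuous_subtype_val.matrix_map (continuous_starAlgHom ρ)).matrix_mulVec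
    continuous_const

theorem orbitVec_mul (ρ : 𝕜 →⋆ₐ[ℝ] ℂ) (v : ι → ℂ) (V U : Matrix.unitaryGroup ι 𝕜) :
    orbitVec ρ v (V * U) = (V : Matrix ι ι 𝕜).map ρ *ᵥ orbitVec ρ v U := by
  unfold orbitVec
  rw [Submonoid.coe_mul, Matrix.mulVec_mulVec, ← Matrix.map_mul]

theorem hasDerivAt_orbitVec (ρ : 𝕜 →⋆ₐ[ℝ] ℂ) (v : ι → ℂ) (X : Matrix ι ι 𝕜) (hX : Xᴴ = -X)
    (U : Matrix.unitaryGroup ι 𝕜) (x : ι) :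
    HasDerivAt (fun t => orbitVec ρ v (expFlow X hX t * U) x)
      ((X.map ρ *ᵥ orbitVec ρ v U) x) 0 := by
  simp only [orbitVec_mul, Matrix.mulVec, dotProduct, Matrix.map_apply]
  refine HasDerivAt.fun_sum fun y _ => HasDerivAt.mul_const ?_ _
  exact (ρ.toAlgHom.toLinearMap.toContinuousLinearMap.hasFDerivAt.comp_hasDerivAt (0 : ℝ)
    (hasDerivAt_expFlow X hX x y))

theorem expFlow_zero_mul (X : Matrix ι ι 𝕜) (hX : Xᴴ = -X) (U : Matrix.unitaryGroup ι 𝕜) :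
    expFlow X hX 0 * U = U := by
  have : expFlow X hX 0 = 1 := Subtype.ext (by simp [expFlow])
  rw [this, one_mul]

theorem star_orbitVec_dotProduct (ρ : 𝕜 →⋆ₐ[ℝ] ℂ) (v : ι → ℂ) (U : Matrix.unitaryGroup ι 𝕜) :
    star (orbitVec ρ v U) ⬝ᵥ orbitVec ρ v U = star v ⬝ᵥ v := by
  have h : ((U : Matrix ι ι 𝕜).map ρ)ᴴ * (U : Matrix ι ι 𝕜).map ρ = 1 := by
    rw [← Matrix.conjTranspose_map _ (fun a => map_star ρ a), ← Matrix.map_mul,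
      ← Matrix.star_eq_conjTranspose, Matrix.mem_unitaryGroup_iff'.1 U.2]
    simp
  rw [orbitVec, Matrix.star_mulVec, ← Matrix.dotProduct_mulVec, Matrix.mulVec_mulVec, h,
    Matrix.one_mulVec]

/-- Real orthogonal matrices preserve the bilinear form `vᵀ v`. -/
theorem orbitVec_dotProduct_real (ρ : ℝ →⋆ₐ[ℝ] ℂ) (v : ι → ℂ) (U : Matrix.unitaryGroup ι ℝ) :
    orbitVec ρ v U ⬝ᵥ orbitVec ρ v U = v ⬝ᵥ v := by
  have h : ((U : Matrix ι ι ℝ).map ρ)ᵀ * (U : Matrix ι ι ℝ).map ρ = 1 := by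
    have hU := Matrix.mem_unitaryGroup_iff'.1 U.2
    rw [Matrix.star_eq_conjTranspose, Matrix.conjTranspose_eq_transpose_of_trivial] at hU
    rw [← Matrix.transpose_map, ← Matrix.map_mul, hU]
    simp
  rw [orbitVec]
  conv_lhs => enter [1]; rw [← Matrix.vecMul_transpose]
  rw [← Matrix.dotProduct_mulVec, Matrix.mulVec_mulVec, h, Matrix.one_mulVec]

end Invariance

/-! ### Derivatives of quadratic forms, summed over the generators of the group -/

section Contractions

variable {ι : Type} [Fintype ι]

theorem hasDerivAt_dotProduct {a b : ℝ → ι → ℂ} {a' b' : ι → ℂ} {t : ℝ}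
    (ha : ∀ x, HasDerivAt (fun s => a s x) (a' x) t)
    (hb : ∀ x, HasDerivAt (fun s => b s x) (b' x) t) :
    HasDerivAt (fun s => a s ⬝ᵥ b s) (a' ⬝ᵥ b t + a t ⬝ᵥ b') t := by
  simp only [dotProduct, ← Finset.sum_add_distrib]
  exact HasDerivAt.fun_sum fun x _ => (ha x).mul (hb x)

theorem hasDerivAt_mulVec {b : ℝ → ι → ℂ} {b' : ι → ℂ} {t : ℝ} (P : Matrix ι ι ℂ)
    (hb : ∀ x, HasDerivAt (fun s => b s x) (b' x) t) (i : ι) :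
    HasDerivAt (fun s => (P *ᵥ b s) i) ((P *ᵥ b') i) t := by
  simp only [Matrix.mulVec, dotProduct]
  exact HasDerivAt.fun_sum fun x _ => (hb x).const_mul _

theorem sum_sum_exchange (p q u w : ι → ℂ) :
    ∑ i, ∑ j, p j * q i * (u j * w i - u i * w j) = (p ⬝ᵥ u) * (q ⬝ᵥ w) - (q ⬝ᵥ u) * (p ⬝ᵥ w) := by
  have h : ∀ a b : ι → ℂ, (∑ j, a j) * (∑ i, b i) = ∑ i, ∑ j, a j * b i := fun a b => by
    rw [Finset.sum_comm, Finset.sum_mul_sum]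
  have h' : ∀ a b : ι → ℂ, (∑ i, a i) * (∑ j, b j) = ∑ i, ∑ j, a i * b j := fun a b => by
    rw [Finset.sum_mul_sum]
  simp only [dotProduct]
  rw [h, h', ← Finset.sum_sub_distrib]
  refine Finset.sum_congr rfl fun i _ => ?_
  rw [← Finset.sum_sub_distrib]
  exact Finset.sum_congr rfl fun j _ => by ring

theorem sum_sum_mul_mul (p q u w : ι → ℂ) :
    ∑ i, ∑ j, p j * q i * (u j * w i) = (p ⬝ᵥ u) * (q ⬝ᵥ w) := by
  simp only [dotProduct]
  rw [Finset.sum_mul_sum, Finset.sum_comm]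
  exact Finset.sum_congr rfl fun j _ => Finset.sum_congr rfl fun i _ => by ring

theorem sum_sum_trace (P : Matrix ι ι ℂ) (p u : ι → ℂ) :
    ∑ i, ∑ j, p j * (P i i * u j) = P.trace * (p ⬝ᵥ u) := by
  simp only [dotProduct, Matrix.trace, Matrix.diag_apply]
  rw [Finset.sum_mul_sum]
  exact Finset.sum_congr rfl fun j _ => Finset.sum_congr rfl fun i _ => by ring

theorem sum_sum_add (f g : ι → ι → ℂ) :
    ∑ i, ∑ j, (f i j + g i j) = ∑ i, ∑ j, f i j + ∑ i, ∑ j, g i j := by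
  simp only [Finset.sum_add_distrib]

theorem sum_sum_mul_const (f : ι → ι → ℂ) (c : ℂ) :
    ∑ i, ∑ j, f i j * c = (∑ i, ∑ j, f i j) * c := by
  simp only [Finset.sum_mul]

theorem sum_sum_const_mul (f : ι → ι → ℂ) (c : ℂ) :
    ∑ i, ∑ j, c * f i j = c * ∑ i, ∑ j, f i j := by
  simp only [Finset.mul_sum]

/-- The derivative of `φ_j (P ψ)_i (φ ⬝ P ψ) ^ m` in the direction `(φ', ψ')`, where `φ` and `ψ` are
independent vectors. It is used with `φ = star ψ`. -/
def derivForm (P : Matrix ι ι ℂ) (m : ℕ) (i j : ι) (φ ψ φ' ψ' : ι → ℂ) : ℂ :=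
  (φ' j * (P *ᵥ ψ) i + φ j * (P *ᵥ ψ') i) * (φ ⬝ᵥ P *ᵥ ψ) ^ m +
    φ j * (P *ᵥ ψ) i * (m * (φ ⬝ᵥ P *ᵥ ψ) ^ (m - 1) * (φ' ⬝ᵥ P *ᵥ ψ + φ ⬝ᵥ P *ᵥ ψ'))

/-- The derivative of `ψ_j (P ψ)_i (φ ⬝ P φ) (φ ⬝ P ψ) ^ m` in the direction `(φ', ψ')`. As for
`derivForm`, it is used with `φ = star ψ`. -/
def derivFormConj (P : Matrix ι ι ℂ) (m : ℕ) (i j : ι) (φ ψ φ' ψ' : ι → ℂ) : ℂ :=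
  (ψ' j * (P *ᵥ ψ) i + ψ j * (P *ᵥ ψ') i) * ((φ ⬝ᵥ P *ᵥ φ) * (φ ⬝ᵥ P *ᵥ ψ) ^ m) +
    ψ j * (P *ᵥ ψ) i * ((φ' ⬝ᵥ P *ᵥ φ + φ ⬝ᵥ P *ᵥ φ') * (φ ⬝ᵥ P *ᵥ ψ) ^ m +
      (φ ⬝ᵥ P *ᵥ φ) *
        (m * (φ ⬝ᵥ P *ᵥ ψ) ^ (m - 1) * (φ' ⬝ᵥ P *ᵥ ψ + φ ⬝ᵥ P *ᵥ ψ')))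

/-- `derivForm` is complex linear in the direction, also in directions which do not preserve the
relation `φ = star ψ`. -/
theorem derivForm_add_smul (P : Matrix ι ι ℂ) (m : ℕ) (i j : ι)
    (φ ψ φ₁ ψ₁ φ₂ ψ₂ : ι → ℂ) (a b : ℂ) :
    derivForm P m i j φ ψ (a • φ₁ + b • φ₂) (a • ψ₁ + b • ψ₂) =
      a * derivForm P m i j φ ψ φ₁ ψ₁ + b * derivForm P m i j φ ψ φ₂ ψ₂ := by
  simp only [derivForm, Matrix.mulVec_add, Matrix.mulVec_smul, add_dotProduct, smul_dotProduct,
    dotProduct_add, dotProduct_smul, Pi.add_apply, Pi.smul_apply, smul_eq_mul]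
  ring

variable {P : Matrix ι ι ℂ}

theorem dotProduct_mulVec_symm (hP : Pᵀ = P) (a b : ι → ℂ) :
    a ⬝ᵥ P *ᵥ b = b ⬝ᵥ P *ᵥ a := by
  rw [Matrix.dotProduct_mulVec, dotProduct_comm, ← Matrix.mulVec_transpose, hP]

theorem dotProduct_mulVec_antisymm (hP : Pᵀ = -P) (a b : ι → ℂ) :
    a ⬝ᵥ P *ᵥ b = -(b ⬝ᵥ P *ᵥ a) := by
  rw [Matrix.dotProduct_mulVec, dotProduct_comm, ← Matrix.mulVec_transpose, hP,
    Matrix.neg_mulVec, dotProduct_neg]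

theorem dotProduct_mulVec_self_antisymm (hP : Pᵀ = -P) (a : ι → ℂ) : a ⬝ᵥ P *ᵥ a = 0 :=
  self_eq_neg.1 (dotProduct_mulVec_antisymm hP a a)

end Contractions

section RotationGenerators

variable {ι 𝕜 : Type} [DecidableEq ι] [RCLike 𝕜]

/-- The generator `E_ij - E_ji` of the rotations in the coordinate plane `(i, j)`. -/
def rotGen (𝕜 : Type) [RCLike 𝕜] (i j : ι) : Matrix ι ι 𝕜 :=
  Matrix.single i j 1 - Matrix.single j i 1

theorem rotGen_conjTranspose (i j : ι) : (rotGen 𝕜 i j)ᴴ = -rotGen 𝕜 i j := by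
  simp [rotGen, Matrix.conjTranspose_single]

theorem rotGen_map (ρ : 𝕜 →⋆ₐ[ℝ] ℂ) (i j : ι) : (rotGen 𝕜 i j).map ρ = rotGen ℂ i j := by
  ext x y
  simp [rotGen, Matrix.single_apply, apply_ite ρ]

theorem rotGen_map_star (i j : ι) : (rotGen ℂ i j).map star = rotGen ℂ i j := by
  ext x y
  simp only [rotGen, Matrix.single_apply, Matrix.map_apply, Matrix.sub_apply, star_sub]
  split_ifs <;> simp

end RotationGenerators

section IntegrationByParts

variable {ι 𝕜 : Type} [Fintype ι] [DecidableEq ι] [RCLike 𝕜]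

variable (ρ : 𝕜 →⋆ₐ[ℝ] ℂ) (v : ι → ℂ)

theorem continuous_derivForm (P : Matrix ι ι ℂ) (m : ℕ) (i j : ι) (A B : Matrix ι ι ℂ) :
    Continuous fun U => derivForm P m i j (star (orbitVec ρ v U)) (orbitVec ρ v U)
      (A *ᵥ star (orbitVec ρ v U)) (B *ᵥ orbitVec ρ v U) := by
  have h := continuous_orbitVec ρ v
  unfold derivForm Matrix.mulVec dotProduct
  simp only [Pi.star_apply]
  fun_prop

theorem continuous_derivFormConj (P : Matrix ι ι ℂ) (m : ℕ) (i j : ι) (A B : Matrix ι ι ℂ) :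
    Continuous fun U => derivFormConj P m i j (star (orbitVec ρ v U)) (orbitVec ρ v U)
      (A *ᵥ star (orbitVec ρ v U)) (B *ᵥ orbitVec ρ v U) := by
  have h := continuous_orbitVec ρ v
  unfold derivFormConj Matrix.mulVec dotProduct
  simp only [Pi.star_apply]
  fun_prop

theorem hasDerivAt_star_orbitVec (X : Matrix ι ι 𝕜) (hX : Xᴴ = -X)
    (U : Matrix.unitaryGroup ι 𝕜) (x : ι) :
    HasDerivAt (fun t => star (orbitVec ρ v (expFlow X hX t * U)) x)
      (((X.map ρ).map star *ᵥ star (orbitVec ρ v U)) x) 0 := by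
  have h := (hasDerivAt_orbitVec ρ v X hX U x).star
  simp only [Matrix.mulVec, dotProduct, star_sum, star_mul'] at h
  simpa [Matrix.mulVec, dotProduct] using h

/-- Integration by parts on the group: the derivative of `φ_j (P ψ)_i (φ ⬝ P ψ) ^ m`, with `φ` the
conjugate of `ψ`, along the left translations generated by `X` has Haar integral zero. -/
theorem integral_derivForm (P : Matrix ι ι ℂ) (m : ℕ) (i j : ι) (X : Matrix ι ι 𝕜)
    (hX : Xᴴ = -X) :
    ∫ U, derivForm P m i j (star (orbitVec ρ v U)) (orbitVec ρ v U)
      ((X.map ρ).map star *ᵥ star (orbitVec ρ v U)) (X.map ρ *ᵥ orbitVec ρ v U)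
      ∂haarProb ι 𝕜 = 0 := by
  refine integral_flow_deriv_eq_zero (expFlow X hX) (expFlow_add X hX)
    (F := fun U => star (orbitVec ρ v U) j * (P *ᵥ orbitVec ρ v U) i *
      (star (orbitVec ρ v U) ⬝ᵥ P *ᵥ orbitVec ρ v U) ^ m) ?_
    (continuous_derivForm ρ v P m i j _ _) fun U => ?_
  · have h := continuous_orbitVec ρ v
    unfold Matrix.mulVec dotProduct
    simp only [Pi.star_apply]
    fun_prop
  · have h1 := hasDerivAt_orbitVec ρ v X hX U
    have h2 := hasDerivAt_star_orbitVec ρ v X hX U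
    have h3 := ((h2 j).fun_mul (hasDerivAt_mulVec P h1 i)).fun_mul
      ((hasDerivAt_dotProduct h2 (hasDerivAt_mulVec P h1)).fun_pow m)
    simp only [expFlow_zero_mul] at h3
    exact h3

theorem integral_derivFormConj (P : Matrix ι ι ℂ) (m : ℕ) (i j : ι) (X : Matrix ι ι 𝕜)
    (hX : Xᴴ = -X) :
    ∫ U, derivFormConj P m i j (star (orbitVec ρ v U)) (orbitVec ρ v U)
      ((X.map ρ).map star *ᵥ star (orbitVec ρ v U)) (X.map ρ *ᵥ orbitVec ρ v U)
      ∂haarProb ι 𝕜 = 0 := by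
  refine integral_flow_deriv_eq_zero (expFlow X hX) (expFlow_add X hX)
    (F := fun U => orbitVec ρ v U j * (P *ᵥ orbitVec ρ v U) i *
      ((star (orbitVec ρ v U) ⬝ᵥ P *ᵥ star (orbitVec ρ v U)) *
        (star (orbitVec ρ v U) ⬝ᵥ P *ᵥ orbitVec ρ v U) ^ m)) ?_
    (continuous_derivFormConj ρ v P m i j _ _) fun U => ?_
  · have h := continuous_orbitVec ρ v
    unfold Matrix.mulVec dotProduct
    simp only [Pi.star_apply]
    fun_prop
  · have h1 := hasDerivAt_orbitVec ρ v X hX U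
    have h2 := hasDerivAt_star_orbitVec ρ v X hX U
    have h3 := ((h1 j).fun_mul (hasDerivAt_mulVec P h1 i)).fun_mul
      ((hasDerivAt_dotProduct h2 (hasDerivAt_mulVec P h2)).fun_mul
      ((hasDerivAt_dotProduct h2 (hasDerivAt_mulVec P h1)).fun_pow m))
    simp only [expFlow_zero_mul] at h3
    exact h3

/-- The velocity of `w` under the rotation in the coordinate plane `(i, j)`. -/
def rotVec (i j : ι) (w : ι → ℂ) : ι → ℂ := Pi.single i (w j) - Pi.single j (w i)

theorem dotProduct_rotVec (i j : ι) (a w : ι → ℂ) :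
    a ⬝ᵥ rotVec i j w = w j * a i - w i * a j := by
  simp [rotVec, dotProduct_sub, mul_comm]

/-- The summed derivatives of the prefactor `p_j (P w)_i` in `derivForm` and `derivFormConj`. -/
theorem sum_sum_rotVec (P : Matrix ι ι ℂ) (p w : ι → ℂ) :
    ∑ i, ∑ j, (rotVec i j p j * (P *ᵥ w) i + p j * (P *ᵥ rotVec i j w) i) =
      (1 - Fintype.card ι) * (p ⬝ᵥ P *ᵥ w) + P.trace * (p ⬝ᵥ w) - w ⬝ᵥ P *ᵥ p := by
  have h1 : ∑ i, ∑ j, rotVec i j p j * (P *ᵥ w) i =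
      (1 - Fintype.card ι) * (p ⬝ᵥ P *ᵥ w) := by
    have : ∀ i, ∑ j, rotVec i j p j = (1 - Fintype.card ι) * p i := by
      intro i
      simp [rotVec, Pi.single_apply, Finset.sum_sub_distrib, sub_mul]
    simp only [← Finset.sum_mul, this, dotProduct, Finset.mul_sum, mul_assoc]
  have h2 : ∑ i, ∑ j, p j * (P *ᵥ rotVec i j w) i =
      P.trace * (p ⬝ᵥ w) - w ⬝ᵥ P *ᵥ p := by
    have : ∀ i j, p j * (P *ᵥ rotVec i j w) i = p j * (P i i * w j) - w i * (P i j * p j) := by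
      intro i j
      rw [Matrix.mulVec, dotProduct_rotVec]
      ring
    simp only [this, Finset.sum_sub_distrib, sum_sum_trace]
    simp only [Matrix.mulVec, dotProduct, Finset.mul_sum]
  simp only [Finset.sum_add_distrib, h1, h2]
  ring

theorem rotGen_mulVec (i j : ι) (w : ι → ℂ) : rotGen ℂ i j *ᵥ w = rotVec i j w := by
  simp [rotGen, Matrix.sub_mulVec, rotVec, Matrix.single_mulVec, Pi.single]

/-- The sum over the generators of the rotations; all index sums contract to quadratic forms in `φ`
and `ψ`. -/
theorem sum_derivForm_rotVec (P : Matrix ι ι ℂ) (m : ℕ) (φ ψ : ι → ℂ) :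
    ∑ i, ∑ j, derivForm P m i j φ ψ (rotVec i j φ) (rotVec i j ψ) =
      ((1 - Fintype.card ι) * (φ ⬝ᵥ P *ᵥ ψ) + P.trace * (φ ⬝ᵥ ψ) - ψ ⬝ᵥ P *ᵥ φ) *
          (φ ⬝ᵥ P *ᵥ ψ) ^ m +
        m * (φ ⬝ᵥ P *ᵥ ψ) ^ (m - 1) *
          ((φ ⬝ᵥ φ) * (P *ᵥ ψ ⬝ᵥ P *ᵥ ψ) - (φ ⬝ᵥ P *ᵥ ψ) ^ 2 +
            ((φ ⬝ᵥ ψ) * (φ ⬝ᵥ (P * P) *ᵥ ψ) - (ψ ⬝ᵥ P *ᵥ ψ) * (φ ⬝ᵥ P *ᵥ φ))) := by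
  have hs : ∀ i j, rotVec i j φ ⬝ᵥ P *ᵥ ψ + φ ⬝ᵥ P *ᵥ rotVec i j ψ =
      (φ j * (P *ᵥ ψ) i - φ i * (P *ᵥ ψ) j) + (ψ j * (φ ᵥ* P) i - ψ i * (φ ᵥ* P) j) := by
    intro i j
    rw [dotProduct_comm, dotProduct_rotVec, Matrix.dotProduct_mulVec, dotProduct_rotVec]
  have key : ∀ i j, derivForm P m i j φ ψ (rotVec i j φ) (rotVec i j ψ) =
      (rotVec i j φ j * (P *ᵥ ψ) i + φ j * (P *ᵥ rotVec i j ψ) i) * (φ ⬝ᵥ P *ᵥ ψ) ^ m +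
      m * (φ ⬝ᵥ P *ᵥ ψ) ^ (m - 1) *
        (φ j * (P *ᵥ ψ) i * (φ j * (P *ᵥ ψ) i - φ i * (P *ᵥ ψ) j) +
          φ j * (P *ᵥ ψ) i * (ψ j * (φ ᵥ* P) i - ψ i * (φ ᵥ* P) j)) := by
    intro i j
    rw [derivForm, hs]
    ring
  simp only [key]
  rw [sum_sum_add, sum_sum_mul_const, sum_sum_const_mul, sum_sum_rotVec, sum_sum_add,
    sum_sum_exchange, sum_sum_exchange]
  have e1 : P *ᵥ ψ ⬝ᵥ φ = φ ⬝ᵥ P *ᵥ ψ := dotProduct_comm _ _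
  have e2 : P *ᵥ ψ ⬝ᵥ φ ᵥ* P = φ ⬝ᵥ (P * P) *ᵥ ψ := by
    rw [dotProduct_comm, ← Matrix.dotProduct_mulVec, Matrix.mulVec_mulVec]
  have e3 : P *ᵥ ψ ⬝ᵥ ψ = ψ ⬝ᵥ P *ᵥ ψ := dotProduct_comm _ _
  have e4 : φ ⬝ᵥ φ ᵥ* P = φ ⬝ᵥ P *ᵥ φ := by
    rw [dotProduct_comm, ← Matrix.dotProduct_mulVec]
  rw [e1, e2, e3, e4]
  ring

theorem sum_derivFormConj_rotVec (P : Matrix ι ι ℂ) (hP : Pᵀ = P) (m : ℕ) (φ ψ : ι → ℂ) :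
    ∑ i, ∑ j, derivFormConj P m i j φ ψ (rotVec i j φ) (rotVec i j ψ) =
      ((1 - Fintype.card ι) * (ψ ⬝ᵥ P *ᵥ ψ) + P.trace * (ψ ⬝ᵥ ψ) - ψ ⬝ᵥ P *ᵥ ψ) *
          ((φ ⬝ᵥ P *ᵥ φ) * (φ ⬝ᵥ P *ᵥ ψ) ^ m) +
        2 * (φ ⬝ᵥ P *ᵥ ψ) ^ m *
          ((φ ⬝ᵥ ψ) * (φ ⬝ᵥ (P * P) *ᵥ ψ) - (φ ⬝ᵥ P *ᵥ ψ) ^ 2) +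
        (φ ⬝ᵥ P *ᵥ φ) * (m * (φ ⬝ᵥ P *ᵥ ψ) ^ (m - 1)) *
          ((φ ⬝ᵥ ψ) * (P *ᵥ ψ ⬝ᵥ P *ᵥ ψ) + (ψ ⬝ᵥ ψ) * (φ ⬝ᵥ (P * P) *ᵥ ψ) -
            2 * ((φ ⬝ᵥ P *ᵥ ψ) * (ψ ⬝ᵥ P *ᵥ ψ))) := by
  have hsym := dotProduct_mulVec_symm hP
  have hs : ∀ i j, rotVec i j φ ⬝ᵥ P *ᵥ ψ + φ ⬝ᵥ P *ᵥ rotVec i j ψ =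
      (φ j * (P *ᵥ ψ) i - φ i * (P *ᵥ ψ) j) + (ψ j * (P *ᵥ φ) i - ψ i * (P *ᵥ φ) j) := by
    intro i j
    rw [hsym φ, dotProduct_comm, dotProduct_rotVec, dotProduct_comm, dotProduct_rotVec]
  have ht : ∀ i j, rotVec i j φ ⬝ᵥ P *ᵥ φ + φ ⬝ᵥ P *ᵥ rotVec i j φ =
      2 * (φ j * (P *ᵥ φ) i - φ i * (P *ᵥ φ) j) := by
    intro i j
    rw [hsym φ, dotProduct_comm, dotProduct_rotVec]
    ring
  have key : ∀ i j, derivFormConj P m i j φ ψ (rotVec i j φ) (rotVec i j ψ) =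
      (rotVec i j ψ j * (P *ᵥ ψ) i + ψ j * (P *ᵥ rotVec i j ψ) i) *
        ((φ ⬝ᵥ P *ᵥ φ) * (φ ⬝ᵥ P *ᵥ ψ) ^ m) +
      2 * (φ ⬝ᵥ P *ᵥ ψ) ^ m *
        (ψ j * (P *ᵥ ψ) i * (φ j * (P *ᵥ φ) i - φ i * (P *ᵥ φ) j)) +
      (φ ⬝ᵥ P *ᵥ φ) * (m * (φ ⬝ᵥ P *ᵥ ψ) ^ (m - 1)) *
        (ψ j * (P *ᵥ ψ) i * (φ j * (P *ᵥ ψ) i - φ i * (P *ᵥ ψ) j) +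
          ψ j * (P *ᵥ ψ) i * (ψ j * (P *ᵥ φ) i - ψ i * (P *ᵥ φ) j)) := by
    intro i j
    rw [derivFormConj, hs, ht]
    ring
  simp only [key]
  rw [sum_sum_add, sum_sum_add, sum_sum_mul_const, sum_sum_const_mul, sum_sum_const_mul,
    sum_sum_rotVec, sum_sum_add, sum_sum_exchange, sum_sum_exchange, sum_sum_exchange]
  have e1 : P *ᵥ ψ ⬝ᵥ φ = φ ⬝ᵥ P *ᵥ ψ := dotProduct_comm _ _
  have e2 : P *ᵥ ψ ⬝ᵥ P *ᵥ φ = φ ⬝ᵥ (P * P) *ᵥ ψ := by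
    rw [← Matrix.mulVec_mulVec, hsym φ]
  have e3 : P *ᵥ ψ ⬝ᵥ ψ = ψ ⬝ᵥ P *ᵥ ψ := dotProduct_comm _ _
  rw [e1, e2, e3, hsym ψ φ, dotProduct_comm ψ φ]
  ring

/-- The sum over `i, j` in the direction of the complexified generator `E_ij`, which sends
`ψ` to `ψ_j e_i` and `φ` to `-φ_i e_j`. -/
theorem sum_derivForm_single (P : Matrix ι ι ℂ) (m : ℕ) (φ ψ : ι → ℂ) :
    ∑ i, ∑ j, derivForm P m i j φ ψ (-Pi.single j (φ i)) (Pi.single i (ψ j)) =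
      (P.trace * (φ ⬝ᵥ ψ) - Fintype.card ι * (φ ⬝ᵥ P *ᵥ ψ)) * (φ ⬝ᵥ P *ᵥ ψ) ^ m +
        m * (φ ⬝ᵥ P *ᵥ ψ) ^ (m - 1) *
          ((φ ⬝ᵥ ψ) * (φ ⬝ᵥ (P * P) *ᵥ ψ) - (φ ⬝ᵥ P *ᵥ ψ) ^ 2) := by
  have key : ∀ i j, derivForm P m i j φ ψ (-Pi.single j (φ i)) (Pi.single i (ψ j)) =
      (φ j * (P i i * ψ j) + -(φ i * (P *ᵥ ψ) i)) * (φ ⬝ᵥ P *ᵥ ψ) ^ m +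
      m * (φ ⬝ᵥ P *ᵥ ψ) ^ (m - 1) *
        (φ j * (P *ᵥ ψ) i * (ψ j * (φ ᵥ* P) i) +
          φ j * (P *ᵥ ψ) i * ((P *ᵥ ψ) j * (-φ) i)) := by
    intro i j
    have e1 : -Pi.single j (φ i) ⬝ᵥ P *ᵥ ψ = - ((P *ᵥ ψ) j * φ i) := by
      simp [mul_comm]
    have e2 : φ ⬝ᵥ P *ᵥ Pi.single i (ψ j) = ψ j * (φ ᵥ* P) i := by
      rw [Matrix.dotProduct_mulVec, dotProduct_single, mul_comm]
    have e3 : (P *ᵥ Pi.single i (ψ j)) i = P i i * ψ j := by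
      rw [Matrix.mulVec, dotProduct_single]
    rw [derivForm, e1, e2, e3]
    simp only [Pi.neg_apply, Pi.single_eq_same]
    ring
  simp only [key]
  rw [sum_sum_add, sum_sum_mul_const, sum_sum_const_mul, sum_sum_add, sum_sum_add,
    sum_sum_mul_mul, sum_sum_mul_mul, sum_sum_trace]
  have e2 : P *ᵥ ψ ⬝ᵥ φ ᵥ* P = φ ⬝ᵥ (P * P) *ᵥ ψ := by
    rw [dotProduct_comm, ← Matrix.dotProduct_mulVec, Matrix.mulVec_mulVec]
  have e3 : ∑ i, ∑ _j : ι, -(φ i * (P *ᵥ ψ) i) = -(Fintype.card ι * (φ ⬝ᵥ P *ᵥ ψ)) := by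
    simp [dotProduct, Finset.mul_sum]
  rw [e2, e3, dotProduct_neg, dotProduct_comm (P *ᵥ ψ) φ]
  ring

end IntegrationByParts

/-! ### Moments of a quadratic form over unitary and orthogonal orbits -/

section Moments

variable {ι 𝕜 : Type} [Fintype ι] [DecidableEq ι] [RCLike 𝕜]

theorem integral_sum_derivForm_rotVec (ρ : ℝ →⋆ₐ[ℝ] ℂ) (v : ι → ℂ) (P : Matrix ι ι ℂ) (m : ℕ) :
    ∫ U, ∑ i, ∑ j, derivForm P m i j (star (orbitVec ρ v U)) (orbitVec ρ v U)
      (rotVec i j (star (orbitVec ρ v U))) (rotVec i j (orbitVec ρ v U)) ∂haarProb ι ℝ = 0 := by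
  have h0 := fun i j => integral_derivForm ρ v P m i j _ (rotGen_conjTranspose (𝕜 := ℝ) i j)
  have hc := fun i j => continuous_derivForm ρ v P m i j (rotGen ℂ i j) (rotGen ℂ i j)
  simp only [rotGen_map, rotGen_map_star, rotGen_mulVec] at h0 hc
  rw [integral_finsetSum _ fun i _ =>
    integrable_of_continuous (continuous_finsetSum _ fun j _ => hc i j)]
  refine Finset.sum_eq_zero fun i _ => ?_
  rw [integral_finsetSum _ fun j _ => integrable_of_continuous (hc i j)]
  exact Finset.sum_eq_zero fun j _ => h0 i j

theorem integral_sum_derivFormConj_rotVec (ρ : ℝ →⋆ₐ[ℝ] ℂ) (v : ι → ℂ) (P : Matrix ι ι ℂ)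
    (m : ℕ) :
    ∫ U, ∑ i, ∑ j, derivFormConj P m i j (star (orbitVec ρ v U)) (orbitVec ρ v U)
      (rotVec i j (star (orbitVec ρ v U))) (rotVec i j (orbitVec ρ v U)) ∂haarProb ι ℝ = 0 := by
  have h0 := fun i j => integral_derivFormConj ρ v P m i j _ (rotGen_conjTranspose (𝕜 := ℝ) i j)
  have hc := fun i j => continuous_derivFormConj ρ v P m i j (rotGen ℂ i j) (rotGen ℂ i j)
  simp only [rotGen_map, rotGen_map_star, rotGen_mulVec] at h0 hc
  rw [integral_finsetSum _ fun i _ =>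
    integrable_of_continuous (continuous_finsetSum _ fun j _ => hc i j)]
  refine Finset.sum_eq_zero fun i _ => ?_
  rw [integral_finsetSum _ fun j _ => integrable_of_continuous (hc i j)]
  exact Finset.sum_eq_zero fun j _ => h0 i j

/-- The elementary matrices `E_ij` are not skew-adjoint, but span the complexified Lie algebra of
the unitary group, and `derivForm` is complex linear in the direction. -/
theorem integral_sum_derivForm_single (v : ι → ℂ) (P : Matrix ι ι ℂ) (m : ℕ) :
    ∫ U, ∑ i, ∑ j, derivForm P m i j (star (orbitVec (StarAlgHom.id ℝ ℂ) v U))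
      (orbitVec (StarAlgHom.id ℝ ℂ) v U)
      (-Pi.single j (star (orbitVec (StarAlgHom.id ℝ ℂ) v U) i))
      (Pi.single i (orbitVec (StarAlgHom.id ℝ ℂ) v U j)) ∂haarProb ι ℂ = 0 := by
  set ρ := StarAlgHom.id ℝ ℂ with hρdef
  -- `2 E_ij = X - i Y` for the skew-adjoint `X = E_ij - E_ji` and `Y = i (E_ij + E_ji)`
  let X : ι → ι → Matrix ι ι ℂ := rotGen ℂ
  let Y : ι → ι → Matrix ι ι ℂ := fun i j =>
    Matrix.single i j Complex.I + Matrix.single j i Complex.I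
  have hX : ∀ i j, (X i j)ᴴ = -X i j := rotGen_conjTranspose
  have hY : ∀ i j, (Y i j)ᴴ = -Y i j := by
    intro i j
    ext x y
    simp only [Y, Matrix.conjTranspose_add, Matrix.conjTranspose_single, Matrix.add_apply,
      Matrix.neg_apply, Matrix.single_apply]
    split_ifs <;> simp
  have hρ : ∀ A : Matrix ι ι ℂ, A.map ρ = A := fun A => by ext; simp [hρdef]
  have h1 := fun i j => integral_derivForm ρ v P m i j _ (hX i j)
  have h2 := fun i j => integral_derivForm ρ v P m i j _ (hY i j)
  have hc := fun i j (A : Matrix ι ι ℂ) => continuous_derivForm ρ v P m i j (A.map star) A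
  simp only [hρ] at h1 h2
  have key : ∀ i j U, derivForm P m i j (star (orbitVec ρ v U)) (orbitVec ρ v U)
      (-Pi.single j (star (orbitVec ρ v U) i)) (Pi.single i (orbitVec ρ v U j)) =
      (1 / 2) * derivForm P m i j (star (orbitVec ρ v U)) (orbitVec ρ v U)
        ((X i j).map star *ᵥ star (orbitVec ρ v U)) (X i j *ᵥ orbitVec ρ v U) +
      (-Complex.I / 2) * derivForm P m i j (star (orbitVec ρ v U)) (orbitVec ρ v U)
        ((Y i j).map star *ᵥ star (orbitVec ρ v U)) (Y i j *ᵥ orbitVec ρ v U) := by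
    intro i j U
    rw [← derivForm_add_smul]
    congr 1
    · ext x
      have e1 : (X i j).map star = Matrix.single i j 1 - Matrix.single j i 1 :=
        rotGen_map_star i j
      have e2 : (Y i j).map star =
          Matrix.single i j (-Complex.I) + Matrix.single j i (-Complex.I) := by
        ext x y
        simp only [Y, Matrix.single_apply, Matrix.map_apply, Matrix.add_apply, star_add]
        split_ifs <;> simp
      rw [e1, e2, Matrix.sub_mulVec, Matrix.add_mulVec]
      simp only [Matrix.single_mulVec, Pi.neg_apply, Pi.add_apply, Pi.sub_apply, Pi.smul_apply,
        smul_eq_mul, Function.update_apply, Pi.single_apply, Pi.zero_apply]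
      split_ifs <;> ring_nf <;> simp [Complex.I_sq] <;> ring
    · ext x
      simp only [X, Y, rotGen, Matrix.sub_mulVec, Matrix.add_mulVec, Matrix.single_mulVec,
        Pi.add_apply, Pi.sub_apply, Pi.smul_apply, smul_eq_mul, Function.update_apply,
        Pi.single_apply, Pi.zero_apply]
      split_ifs <;> ring_nf <;> simp [Complex.I_sq] <;> ring
  have hi := fun i j (A : Matrix ι ι ℂ) => integrable_of_continuous (hc i j A)
  have hadd := fun i j => ((hi i j (X i j)).const_mul (1 / 2)).add
    ((hi i j (Y i j)).const_mul (-Complex.I / 2))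
  simp only [Pi.add_def] at hadd
  simp only [key]
  rw [integral_finsetSum _ fun i _ => integrable_finsetSum _ fun j _ => hadd i j]
  refine Finset.sum_eq_zero fun i _ => ?_
  rw [integral_finsetSum _ fun j _ => hadd i j]
  refine Finset.sum_eq_zero fun j _ => ?_
  rw [integral_add ((hi i j (X i j)).const_mul _) ((hi i j (Y i j)).const_mul _),
    integral_const_mul, integral_const_mul, h1, h2]
  simp

/-- The Haar average of continuous functions, as a linear functional. -/
def mean (ι 𝕜 : Type) [Fintype ι] [DecidableEq ι] [RCLike 𝕜] :
    C(Matrix.unitaryGroup ι 𝕜, ℂ) →ₗ[ℂ] ℂ where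
  toFun f := ∫ U, f U ∂haarProb ι 𝕜
  map_add' f g := integral_add (integrable_of_continuous f.continuous)
    (integrable_of_continuous g.continuous)
  map_smul' c _ := integral_const_mul c _

theorem mean_apply (f : C(Matrix.unitaryGroup ι 𝕜, ℂ)) :
    mean ι 𝕜 f = ∫ U, f U ∂haarProb ι 𝕜 := rfl

theorem mean_one : mean ι 𝕜 1 = 1 := by
  simp [mean_apply]

/-- The function `ψ† P ψ` of the state `ψ = ρ(U) v`. -/
def formS (ρ : 𝕜 →⋆ₐ[ℝ] ℂ) (v : ι → ℂ) (P : Matrix ι ι ℂ) :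
    C(Matrix.unitaryGroup ι 𝕜, ℂ) where
  toFun U := star (orbitVec ρ v U) ⬝ᵥ P *ᵥ orbitVec ρ v U
  continuous_toFun := by
    have h := continuous_orbitVec ρ v
    unfold Matrix.mulVec dotProduct
    simp only [Pi.star_apply]
    fun_prop

/-- The function `(ψᵀ P ψ) (ψ† P ψ̄)` of the state `ψ = ρ(U) v`, which is `|ψᵀ P ψ|²` if `P` is
real. -/
def formT (ρ : 𝕜 →⋆ₐ[ℝ] ℂ) (v : ι → ℂ) (P : Matrix ι ι ℂ) :
    C(Matrix.unitaryGroup ι 𝕜, ℂ) where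
  toFun U := (orbitVec ρ v U ⬝ᵥ P *ᵥ orbitVec ρ v U) *
    (star (orbitVec ρ v U) ⬝ᵥ P *ᵥ star (orbitVec ρ v U))
  continuous_toFun := by
    have h := continuous_orbitVec ρ v
    unfold Matrix.mulVec dotProduct
    simp only [Pi.star_apply]
    fun_prop

theorem formS_apply (ρ : 𝕜 →⋆ₐ[ℝ] ℂ) (v : ι → ℂ) (P : Matrix ι ι ℂ)
    (U : Matrix.unitaryGroup ι 𝕜) :
    formS ρ v P U = star (orbitVec ρ v U) ⬝ᵥ P *ᵥ orbitVec ρ v U := rfl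

theorem formT_apply (ρ : 𝕜 →⋆ₐ[ℝ] ℂ) (v : ι → ℂ) (P : Matrix ι ι ℂ)
    (U : Matrix.unitaryGroup ι 𝕜) :
    formT ρ v P U = (orbitVec ρ v U ⬝ᵥ P *ᵥ orbitVec ρ v U) *
      (star (orbitVec ρ v U) ⬝ᵥ P *ᵥ star (orbitVec ρ v U)) := rfl

theorem formS_one (ρ : 𝕜 →⋆ₐ[ℝ] ℂ) {v : ι → ℂ} (hv : star v ⬝ᵥ v = 1) :
    formS ρ v 1 = 1 := by
  ext U
  simp [formS_apply, star_orbitVec_dotProduct, hv]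

/-! #### Unitary orbits -/

/-- Integration by parts over the unitary group expresses the moment of order `m + 1` of `ψ† P ψ` by
lower ones. -/
theorem mean_unitary_recursion {v : ι → ℂ} (hv : star v ⬝ᵥ v = 1) (P : Matrix ι ι ℂ) (m : ℕ) :
    mean ι ℂ ((P.trace • 1 - (Fintype.card ι : ℂ) • formS (StarAlgHom.id ℝ ℂ) v P) *
        formS (StarAlgHom.id ℝ ℂ) v P ^ m +
      (m : ℂ) • (formS (StarAlgHom.id ℝ ℂ) v P ^ (m - 1) *
        (formS (StarAlgHom.id ℝ ℂ) v (P * P) - formS (StarAlgHom.id ℝ ℂ) v P ^ 2))) = 0 := by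
  rw [mean_apply, ← integral_sum_derivForm_single v P m]
  refine integral_congr_ae (Eventually.of_forall fun U => ?_)
  beta_reduce
  rw [sum_derivForm_single, star_orbitVec_dotProduct, hv]
  simp [formS_apply]
  ring

theorem mean_unitary_first [Nonempty ι] {v : ι → ℂ} (hv : star v ⬝ᵥ v = 1) (P : Matrix ι ι ℂ) :
    mean ι ℂ (formS (StarAlgHom.id ℝ ℂ) v P) = P.trace / Fintype.card ι := by
  have h := mean_unitary_recursion hv P 0
  have hd : (Fintype.card ι : ℂ) ≠ 0 := Nat.cast_ne_zero.2 Fintype.card_ne_zero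
  simp only [pow_zero, mul_one, Nat.cast_zero, zero_smul, add_zero, map_sub, map_smul, mean_one,
    smul_eq_mul] at h
  rw [eq_div_iff hd]
  linear_combination -h

theorem mean_unitary_second [Nonempty ι] {v : ι → ℂ} (hv : star v ⬝ᵥ v = 1) {P : Matrix ι ι ℂ}
    (hP : P.trace = 0) {q : ℂ} (hq : (P * P).trace = Fintype.card ι * q) :
    mean ι ℂ (formS (StarAlgHom.id ℝ ℂ) v P ^ 2) = q / (Fintype.card ι + 1) := by
  have h := mean_unitary_recursion hv P 1
  have h1 := mean_unitary_first hv (P * P)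
  have hd : (Fintype.card ι : ℂ) ≠ 0 := Nat.cast_ne_zero.2 Fintype.card_ne_zero
  have hd1 : (Fintype.card ι : ℂ) + 1 ≠ 0 := Nat.cast_add_one_ne_zero _
  rw [hq, mul_div_cancel_left₀ _ hd] at h1
  -- `mean` is only linear, so the integrand is expanded in powers of `ψ† P ψ`; the identity holds
  -- in every commutative `ℂ`-algebra
  have e : ∀ {A : Type} [CommRing A] [Algebra ℂ A] (f g : A),
      ((0 : ℂ) • 1 - (Fintype.card ι : ℂ) • f) * f ^ 1 +
        ((1 : ℕ) : ℂ) • (f ^ (1 - 1) * (g - f ^ 2)) = g - ((Fintype.card ι : ℂ) + 1) • f ^ 2 := by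
    intro A _ _ f g
    simp only [Algebra.smul_def, map_add, map_one, map_zero, Nat.cast_one, tsub_self]
    ring
  rw [hP, e, map_sub, map_smul, h1, smul_eq_mul] at h
  rw [eq_div_iff hd1]
  linear_combination -h

theorem mean_unitary_fourth [Nonempty ι] {v : ι → ℂ} (hv : star v ⬝ᵥ v = 1) {P : Matrix ι ι ℂ}
    (hP : P.trace = 0) (hq : P * P = 1) :
    mean ι ℂ (formS (StarAlgHom.id ℝ ℂ) v P ^ 4) =
      3 / ((Fintype.card ι + 1) * (Fintype.card ι + 3)) := by
  have h := mean_unitary_recursion hv P 3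
  have h1 := mean_unitary_second hv hP (q := 1) (by simp [hq])
  have hd1 : (Fintype.card ι : ℂ) + 1 ≠ 0 := Nat.cast_add_one_ne_zero _
  have hd3 : (Fintype.card ι : ℂ) + 3 ≠ 0 := by exact_mod_cast (by omega : Fintype.card ι + 3 ≠ 0)
  have e : ∀ {A : Type} [CommRing A] [Algebra ℂ A] (f : A),
      ((0 : ℂ) • 1 - (Fintype.card ι : ℂ) • f) * f ^ 3 +
        ((3 : ℕ) : ℂ) • (f ^ (3 - 1) * (1 - f ^ 2)) =
      (3 : ℂ) • f ^ 2 - ((Fintype.card ι : ℂ) + 3) • f ^ 4 := by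
    intro A _ _ f
    simp only [Algebra.smul_def, map_add, map_zero, map_ofNat, Nat.cast_ofNat, Nat.add_one_sub_one]
    ring
  rw [hP, hq, formS_one _ hv, e, map_sub, map_smul, map_smul, h1, smul_eq_mul, smul_eq_mul] at h
  rw [eq_div_iff (mul_ne_zero hd1 hd3)]
  field_simp at h
  linear_combination -h

/-! #### Orthogonal orbits -/

variable (ρ : ℝ →⋆ₐ[ℝ] ℂ) {v : ι → ℂ} {P : Matrix ι ι ℂ}

theorem star_orbitVec_dotProduct_star (v : ι → ℂ) (U : Matrix.unitaryGroup ι ℝ) :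
    star (orbitVec ρ v U) ⬝ᵥ star (orbitVec ρ v U) = star (v ⬝ᵥ v) := by
  rw [← orbitVec_dotProduct_real ρ v U, Matrix.star_dotProduct_star]

/-- The recursion for a state `ψ` with `ψᵀ ψ = 0`. -/
theorem mean_isotropic_symm_recursion (hv : star v ⬝ᵥ v = 1) (hc : v ⬝ᵥ v = 0)
    (hP : Pᵀ = P) (m : ℕ) :
    mean ι ℝ ((P.trace • 1 - (Fintype.card ι : ℂ) • formS ρ v P) * formS ρ v P ^ m +
      (m : ℂ) • (formS ρ v P ^ (m - 1) *
        (formS ρ v (P * P) - formS ρ v P ^ 2 - formT ρ v P))) = 0 := by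
  rw [mean_apply, ← integral_sum_derivForm_rotVec ρ v P m]
  refine integral_congr_ae (Eventually.of_forall fun U => ?_)
  beta_reduce
  rw [sum_derivForm_rotVec, star_orbitVec_dotProduct, star_orbitVec_dotProduct_star, hv, hc,
    dotProduct_mulVec_symm hP (orbitVec ρ v U) (star (orbitVec ρ v U))]
  simp [formS_apply, formT_apply]
  ring

/-- For antisymmetric `P` the form `ψᵀ P ψ` vanishes, and the recursion closes. -/
theorem mean_isotropic_antisymm_recursion (hv : star v ⬝ᵥ v = 1) (hc : v ⬝ᵥ v = 0)
    (hP : Pᵀ = -P) (m : ℕ) :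
    mean ι ℝ ((2 - Fintype.card ι : ℂ) • formS ρ v P ^ (m + 1) +
      (m : ℂ) • (formS ρ v P ^ (m - 1) * (formS ρ v (P * P) - formS ρ v P ^ 2))) = 0 := by
  rw [mean_apply, ← integral_sum_derivForm_rotVec ρ v P m]
  refine integral_congr_ae (Eventually.of_forall fun U => ?_)
  have htr : P.trace = 0 := by
    have := Matrix.trace_transpose P
    rw [hP, Matrix.trace_neg] at this
    exact self_eq_neg.1 this.symm
  beta_reduce
  rw [sum_derivForm_rotVec, star_orbitVec_dotProduct, star_orbitVec_dotProduct_star, hv, hc,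
    dotProduct_mulVec_antisymm hP (orbitVec ρ v U) (star (orbitVec ρ v U)), htr,
    dotProduct_mulVec_self_antisymm hP]
  simp [formS_apply]
  ring

/-- The term `|ψᵀ P ψ|²` in the recursion for symmetric `P` is eliminated by a second integration by
parts, that of `ψ_j (P ψ)_i (ψ† P ψ̄)`. -/
theorem mean_isotropic_formT (hv : star v ⬝ᵥ v = 1) (hc : v ⬝ᵥ v = 0) (hP : Pᵀ = P) :
    mean ι ℝ ((2 : ℂ) • (formS ρ v (P * P) - formS ρ v P ^ 2) -
      (Fintype.card ι : ℂ) • formT ρ v P) = 0 := by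
  rw [mean_apply, ← integral_sum_derivFormConj_rotVec ρ v P 0]
  refine integral_congr_ae (Eventually.of_forall fun U => ?_)
  beta_reduce
  rw [sum_derivFormConj_rotVec _ hP, star_orbitVec_dotProduct, orbitVec_dotProduct_real, hv, hc]
  simp [formS_apply, formT_apply]
  ring

/-- The analogue of `mean_isotropic_formT` for the fourth moment. -/
theorem mean_isotropic_formT_mul_sq (hv : star v ⬝ᵥ v = 1) (hc : v ⬝ᵥ v = 0) (hP : Pᵀ = P)
    (hq : P * P = 1) :
    mean ι ℝ ((2 : ℂ) • (formS ρ v P ^ 2 - formS ρ v P ^ 4) -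
      (Fintype.card ι + 4 : ℂ) • (formT ρ v P * formS ρ v P ^ 2)) = 0 := by
  rw [mean_apply, ← integral_sum_derivFormConj_rotVec ρ v P 2]
  refine integral_congr_ae (Eventually.of_forall fun U => ?_)
  have h1 : P *ᵥ orbitVec ρ v U ⬝ᵥ P *ᵥ orbitVec ρ v U = 0 := by
    rw [dotProduct_mulVec_symm hP, Matrix.mulVec_mulVec, hq, Matrix.one_mulVec,
      orbitVec_dotProduct_real, hc]
  beta_reduce
  rw [sum_derivFormConj_rotVec _ hP, star_orbitVec_dotProduct, orbitVec_dotProduct_real, hv, hc,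
    h1, hq, Matrix.one_mulVec, star_orbitVec_dotProduct, hv]
  simp [formS_apply, formT_apply]
  ring

theorem star_orbitVec_of_real (hv : star v = v) (U : Matrix.unitaryGroup ι ℝ) :
    star (orbitVec ρ v U) = orbitVec ρ v U := by
  ext x
  have h : ∀ r : ℝ, star (ρ r) = ρ r := fun r => by rw [← map_star]; simp
  simp only [orbitVec, Pi.star_apply, Matrix.mulVec, dotProduct, star_sum, star_mul',
    Matrix.map_apply, h]
  exact Finset.sum_congr rfl fun y _ => by rw [← Pi.star_apply, hv]

/-- The recursion for a real state `ψ`. -/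
theorem mean_real_symm_recursion (hv : star v ⬝ᵥ v = 1) (hr : star v = v)
    (hP : Pᵀ = P) (m : ℕ) :
    mean ι ℝ ((P.trace • 1 - (Fintype.card ι : ℂ) • formS ρ v P) * formS ρ v P ^ m +
      (m : ℂ) • (formS ρ v P ^ (m - 1) *
        ((2 : ℂ) • formS ρ v (P * P) - (2 : ℂ) • formS ρ v P ^ 2))) = 0 := by
  rw [mean_apply, ← integral_sum_derivForm_rotVec ρ v P m]
  refine integral_congr_ae (Eventually.of_forall fun U => ?_)
  have hc : v ⬝ᵥ v = 1 := by rw [← hv, hr]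
  beta_reduce
  rw [sum_derivForm_rotVec, star_orbitVec_of_real ρ hr, orbitVec_dotProduct_real, hc,
    dotProduct_mulVec_symm hP (P *ᵥ orbitVec ρ v U) (orbitVec ρ v U), Matrix.mulVec_mulVec]
  simp [formS_apply, star_orbitVec_of_real ρ hr]
  ring

/-- Antisymmetric observables have expectation zero in real states. -/
theorem formS_real_antisymm (hr : star v = v) (hP : Pᵀ = -P) : formS ρ v P = 0 := by
  ext U
  rw [formS_apply, star_orbitVec_of_real ρ hr, dotProduct_mulVec_self_antisymm hP]
  rfl

theorem mean_real_second [Nonempty ι] (hv : star v ⬝ᵥ v = 1) (hr : star v = v)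
    (hP : Pᵀ = P) (htr : P.trace = 0) {q : ℂ} (hq : (P * P).trace = Fintype.card ι * q) :
    mean ι ℝ (formS ρ v P ^ 2) = 2 * q / (Fintype.card ι + 2) := by
  have hd : (Fintype.card ι : ℂ) ≠ 0 := Nat.cast_ne_zero.2 Fintype.card_ne_zero
  have hd2 : (Fintype.card ι : ℂ) + 2 ≠ 0 := by exact_mod_cast (by omega : Fintype.card ι + 2 ≠ 0)
  have h0 := mean_real_symm_recursion ρ hv hr (P := P * P) (by rw [Matrix.transpose_mul, hP]) 0
  have h1 := mean_real_symm_recursion ρ hv hr hP 1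
  have e0 : ∀ {A : Type} [CommRing A] [Algebra ℂ A] (f g : A) (t : ℂ),
      (t • 1 - (Fintype.card ι : ℂ) • f) * f ^ 0 +
        ((0 : ℕ) : ℂ) • (f ^ (0 - 1) * ((2 : ℂ) • g - (2 : ℂ) • f ^ 2)) =
        t • 1 - (Fintype.card ι : ℂ) • f := by
    intro A _ _ f g t
    simp
  have e1 : ∀ {A : Type} [CommRing A] [Algebra ℂ A] (f g : A),
      ((0 : ℂ) • 1 - (Fintype.card ι : ℂ) • f) * f ^ 1 +
        ((1 : ℕ) : ℂ) • (f ^ (1 - 1) * ((2 : ℂ) • g - (2 : ℂ) • f ^ 2)) =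
        (2 : ℂ) • g - ((Fintype.card ι : ℂ) + 2) • f ^ 2 := by
    intro A _ _ f g
    simp only [Algebra.smul_def, map_add, map_one, map_zero, map_ofNat, Nat.cast_one, tsub_self]
    ring
  rw [e0, map_sub, map_smul, map_smul, mean_one, hq, smul_eq_mul, smul_eq_mul] at h0
  rw [htr, e1, map_sub, map_smul, map_smul, smul_eq_mul, smul_eq_mul] at h1
  have h2 : q = mean ι ℝ (formS ρ v (P * P)) := mul_left_cancel₀ hd (by linear_combination h0)
  rw [eq_div_iff hd2, h2]
  linear_combination -h1

theorem mean_real_fourth [Nonempty ι] (hv : star v ⬝ᵥ v = 1) (hr : star v = v)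
    (hP : Pᵀ = P) (htr : P.trace = 0) (hq : P * P = 1) :
    mean ι ℝ (formS ρ v P ^ 4) = 12 / ((Fintype.card ι + 2) * (Fintype.card ι + 6)) := by
  have hd2 : (Fintype.card ι : ℂ) + 2 ≠ 0 := by exact_mod_cast (by omega : Fintype.card ι + 2 ≠ 0)
  have hd6 : (Fintype.card ι : ℂ) + 6 ≠ 0 := by exact_mod_cast (by omega : Fintype.card ι + 6 ≠ 0)
  have h := mean_real_symm_recursion ρ hv hr hP 3
  have h2 := mean_real_second ρ hv hr hP htr (q := 1) (by simp [hq])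
  have e : ∀ {A : Type} [CommRing A] [Algebra ℂ A] (f : A),
      ((0 : ℂ) • 1 - (Fintype.card ι : ℂ) • f) * f ^ 3 +
        ((3 : ℕ) : ℂ) • (f ^ (3 - 1) * ((2 : ℂ) • 1 - (2 : ℂ) • f ^ 2)) =
        (6 : ℂ) • f ^ 2 - ((Fintype.card ι : ℂ) + 6) • f ^ 4 := by
    intro A _ _ f
    simp only [Algebra.smul_def, map_add, map_zero, map_ofNat, Nat.cast_ofNat, Nat.add_one_sub_one]
    ring
  rw [htr, hq, formS_one _ hv, e, map_sub, map_smul, map_smul, h2, smul_eq_mul, smul_eq_mul] at h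
  rw [eq_div_iff (mul_ne_zero hd2 hd6)]
  field_simp at h
  linear_combination -h

theorem mean_isotropic_first [Nonempty ι] (hv : star v ⬝ᵥ v = 1) (hc : v ⬝ᵥ v = 0)
    (hP : Pᵀ = P) {q : ℂ} (hq : P.trace = Fintype.card ι * q) :
    mean ι ℝ (formS ρ v P) = q := by
  have hd : (Fintype.card ι : ℂ) ≠ 0 := Nat.cast_ne_zero.2 Fintype.card_ne_zero
  have h0 := mean_isotropic_symm_recursion ρ hv hc hP 0
  simp only [pow_zero, mul_one, Nat.cast_zero, zero_smul, add_zero, map_sub, map_smul, mean_one,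
    smul_eq_mul, hq] at h0
  exact mul_left_cancel₀ hd (by linear_combination -h0)

theorem mean_isotropic_antisymm_second [Nonempty ι] (hv : star v ⬝ᵥ v = 1) (hc : v ⬝ᵥ v = 0)
    (hP : Pᵀ = -P) {q : ℂ} (hq : (P * P).trace = Fintype.card ι * q)
    (hd : (Fintype.card ι : ℂ) - 1 ≠ 0) :
    mean ι ℝ (formS ρ v P ^ 2) = q / (Fintype.card ι - 1) := by
  have h0 := mean_isotropic_first ρ hv hc (P := P * P) (by rw [Matrix.transpose_mul, hP]; simp) hq
  have h1 := mean_isotropic_antisymm_recursion ρ hv hc hP 1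
  have e1 : ∀ {A : Type} [CommRing A] [Algebra ℂ A] (f g : A),
      (2 - Fintype.card ι : ℂ) • f ^ (1 + 1) + ((1 : ℕ) : ℂ) • (f ^ (1 - 1) * (g - f ^ 2)) =
        g - ((Fintype.card ι : ℂ) - 1) • f ^ 2 := by
    intro A _ _ f g
    simp only [Algebra.smul_def, map_sub, map_one, map_ofNat, Nat.cast_one, tsub_self]
    ring
  rw [e1, map_sub, map_smul, h0, smul_eq_mul] at h1
  rw [eq_div_iff hd]
  linear_combination -h1

theorem mean_isotropic_antisymm_fourth [Nonempty ι] (hv : star v ⬝ᵥ v = 1) (hc : v ⬝ᵥ v = 0)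
    (hP : Pᵀ = -P) (hq : P * P = 1) (hd : (Fintype.card ι : ℂ) - 1 ≠ 0) :
    mean ι ℝ (formS ρ v P ^ 4) = 3 / ((Fintype.card ι - 1) * (Fintype.card ι + 1)) := by
  have h2 := mean_isotropic_antisymm_second ρ hv hc hP (q := 1) (by simp [hq]) hd
  have h := mean_isotropic_antisymm_recursion ρ hv hc hP 3
  have hd1 : (Fintype.card ι : ℂ) + 1 ≠ 0 := Nat.cast_add_one_ne_zero _
  have e : ∀ {A : Type} [CommRing A] [Algebra ℂ A] (f : A),
      (2 - Fintype.card ι : ℂ) • f ^ (3 + 1) + ((3 : ℕ) : ℂ) • (f ^ (3 - 1) * (1 - f ^ 2)) =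
        (3 : ℂ) • f ^ 2 - ((Fintype.card ι : ℂ) + 1) • f ^ 4 := by
    intro A _ _ f
    simp only [Algebra.smul_def, map_sub, map_add, map_one, map_ofNat, Nat.cast_ofNat,
      Nat.add_one_sub_one]
    ring
  rw [hq, formS_one _ hv, e, map_sub, map_smul, map_smul, h2, smul_eq_mul, smul_eq_mul] at h
  rw [eq_div_iff (mul_ne_zero hd hd1)]
  field_simp at h
  linear_combination -h

theorem mean_isotropic_symm_second [Nonempty ι] (hv : star v ⬝ᵥ v = 1) (hc : v ⬝ᵥ v = 0)
    (hP : Pᵀ = P) (htr : P.trace = 0) {q : ℂ} (hq : (P * P).trace = Fintype.card ι * q)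
    (hd1 : (Fintype.card ι : ℂ) - 1 ≠ 0) :
    mean ι ℝ (formS ρ v P ^ 2) =
      (Fintype.card ι - 2) * q / ((Fintype.card ι - 1) * (Fintype.card ι + 2)) := by
  have hd2 : (Fintype.card ι : ℂ) + 2 ≠ 0 := by exact_mod_cast (by omega : Fintype.card ι + 2 ≠ 0)
  have h0 := mean_isotropic_first ρ hv hc (P := P * P) (by rw [Matrix.transpose_mul, hP]) hq
  have h1 := mean_isotropic_symm_recursion ρ hv hc hP 1
  have ht := mean_isotropic_formT ρ hv hc hP
  have e1 : ∀ {A : Type} [CommRing A] [Algebra ℂ A] (f g t : A),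
      ((0 : ℂ) • 1 - (Fintype.card ι : ℂ) • f) * f ^ 1 +
        ((1 : ℕ) : ℂ) • (f ^ (1 - 1) * (g - f ^ 2 - t)) =
        g - ((Fintype.card ι : ℂ) + 1) • f ^ 2 - t := by
    intro A _ _ f g t
    simp only [Algebra.smul_def, map_add, map_one, map_zero, Nat.cast_one, tsub_self]
    ring
  rw [htr, e1, map_sub, map_sub, map_smul, h0, smul_eq_mul] at h1
  rw [map_sub, map_smul, map_smul, map_sub, h0, smul_eq_mul, smul_eq_mul] at ht
  rw [eq_div_iff (mul_ne_zero hd1 hd2)]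
  -- the multiple of `h1` is chosen such that `formT` cancels
  linear_combination -(Fintype.card ι : ℂ) * h1 + ht

theorem mean_isotropic_symm_fourth [Nonempty ι] (hv : star v ⬝ᵥ v = 1) (hc : v ⬝ᵥ v = 0)
    (hP : Pᵀ = P) (htr : P.trace = 0) (hq : P * P = 1) (hd1 : (Fintype.card ι : ℂ) - 1 ≠ 0) :
    mean ι ℝ (formS ρ v P ^ 4) = 3 * (Fintype.card ι - 2) /
      ((Fintype.card ι - 1) * (Fintype.card ι + 1) * (Fintype.card ι + 6)) := by
  have hd2 : (Fintype.card ι : ℂ) + 2 ≠ 0 := by exact_mod_cast (by omega : Fintype.card ι + 2 ≠ 0)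
  have hd6 : (Fintype.card ι : ℂ) + 6 ≠ 0 := by exact_mod_cast (by omega : Fintype.card ι + 6 ≠ 0)
  have hd3 : (Fintype.card ι : ℂ) + 1 ≠ 0 := Nat.cast_add_one_ne_zero _
  have h2 := mean_isotropic_symm_second ρ hv hc hP htr (q := 1) (by simp [hq]) hd1
  have h := mean_isotropic_symm_recursion ρ hv hc hP 3
  have ht := mean_isotropic_formT_mul_sq ρ hv hc hP hq
  have e : ∀ {A : Type} [CommRing A] [Algebra ℂ A] (f t : A),
      ((0 : ℂ) • 1 - (Fintype.card ι : ℂ) • f) * f ^ 3 +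
        ((3 : ℕ) : ℂ) • (f ^ (3 - 1) * (1 - f ^ 2 - t)) =
        (3 : ℂ) • f ^ 2 - ((Fintype.card ι : ℂ) + 3) • f ^ 4 - (3 : ℂ) • (t * f ^ 2) := by
    intro A _ _ f t
    simp only [Algebra.smul_def, map_add, map_zero, map_ofNat, Nat.cast_ofNat, Nat.add_one_sub_one]
    ring
  rw [htr, hq, formS_one _ hv, e, map_sub, map_sub, map_smul, map_smul, map_smul, smul_eq_mul,
    smul_eq_mul, smul_eq_mul] at h
  rw [map_sub, map_smul, map_smul, map_sub, smul_eq_mul, smul_eq_mul] at ht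
  have key : (Fintype.card ι + 1 : ℂ) * (Fintype.card ι + 6) * mean ι ℝ (formS ρ v P ^ 4) =
      3 * (Fintype.card ι + 2) * mean ι ℝ (formS ρ v P ^ 2) := by
    -- the multiples are chosen such that `formT ρ v P * formS ρ v P ^ 2` cancels
    linear_combination -(Fintype.card ι + 4 : ℂ) * h + 3 * ht
  rw [h2] at key
  rw [eq_div_iff (by simp [hd1, hd3, hd6])]
  field_simp at key
  linear_combination key

end Moments

/-! ### The three ensembles, and witnesses of symmetric and antisymmetric operators -/

section Ensembles

variable {n : ℕ}

theorem ketZero_norm (n : ℕ) : star (ketZero n) ⬝ᵥ ketZero n = 1 := by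
  simp [ketZero]

theorem ketZero_real (n : ℕ) : star (ketZero n) = ketZero n := by
  ext x
  by_cases h : x = 0
  · simp [ketZero, h]
  · simp [ketZero, h]

theorem sum_bits_prod (f : Fin n → Fin 2 → ℂ) :
    ∑ x : Bits n, ∏ k, f k (x k) = ∏ k, ∑ b, f k b := by
  rw [Finset.prod_univ_sum, Fintype.piFinset_univ]

theorem ketPlusY_norm (n : ℕ) : star (ketPlusY n) ⬝ᵥ ketPlusY n = 1 := by
  have h2 : (Real.sqrt 2 : ℂ) * Real.sqrt 2 = 2 := by
    rw [← Complex.ofReal_mul, Real.mul_self_sqrt (by norm_num)]; norm_num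
  have h : star (ketPlusY n) ⬝ᵥ ketPlusY n = ∑ x : Bits n, ∏ k,
      (star (![1, Complex.I] (x k) / (Real.sqrt 2 : ℂ)) *
        (![1, Complex.I] (x k) / (Real.sqrt 2 : ℂ))) := by
    simp only [dotProduct, Pi.star_apply, ketPlusY, star_prod, Finset.prod_mul_distrib]
  rw [h, sum_bits_prod (fun _ b => star (![1, Complex.I] b / (Real.sqrt 2 : ℂ)) *
        (![1, Complex.I] b / (Real.sqrt 2 : ℂ)))]
  refine Finset.prod_eq_one fun k _ => ?_
  simp [Fin.sum_univ_two, div_mul_div_comm, h2]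
  norm_num

/-- The bilinear square of `|+_y⟩` is `(1 + i²) / 2 = 0`. -/
theorem ketPlusY_isotropic (hn : 1 ≤ n) : ketPlusY n ⬝ᵥ ketPlusY n = 0 := by
  have h : ketPlusY n ⬝ᵥ ketPlusY n = ∑ x : Bits n, ∏ k,
      ((![1, Complex.I] (x k) / (Real.sqrt 2 : ℂ)) *
        (![1, Complex.I] (x k) / (Real.sqrt 2 : ℂ))) := by
    simp only [dotProduct, ketPlusY, Finset.prod_mul_distrib]
  rw [h, sum_bits_prod (fun _ b => (![1, Complex.I] b / (Real.sqrt 2 : ℂ)) *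
        (![1, Complex.I] b / (Real.sqrt 2 : ℂ)))]
  refine Finset.prod_eq_zero (Finset.mem_univ ⟨0, hn⟩) ?_
  simp [Fin.sum_univ_two, div_mul_div_comm]
  ring

/-- The inclusion of `ℝ` into `ℂ`. -/
def realInclusion : ℝ →⋆ₐ[ℝ] ℂ := StarAlgHom.ofId ℝ ℂ

theorem haarKet_eq (U : Matrix.unitaryGroup (Bits n) ℂ) :
    haarKet U = orbitVec (StarAlgHom.id ℝ ℂ) (ketZero n) U := by
  rw [haarKet, orbitVec]
  congr 1

theorem imagKet_eq (U : Matrix.unitaryGroup (Bits n) ℝ) :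
    imagKet U = orbitVec realInclusion (ketZero n) U := by
  rw [imagKet, orbitVec]
  congr 1

theorem realKet_eq (U : Matrix.unitaryGroup (Bits n) ℝ) :
    realKet U = orbitVec realInclusion (ketPlusY n) U := by
  rw [realKet, orbitVec]
  congr 1

theorem ofReal_expVal {P : Op n} (hP : P.IsHermitian) (ψ : Ket n) :
    (expVal P ψ : ℂ) = star ψ ⬝ᵥ P *ᵥ ψ := by
  rw [expVal]
  refine Complex.conj_eq_iff_re.1 ?_
  rw [starRingEnd_apply, ← Matrix.star_dotProduct, Matrix.star_mulVec, hP.eq,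
    ← Matrix.dotProduct_mulVec]

theorem continuous_expVal (P : Op n) : Continuous (expVal P) := by
  unfold expVal Matrix.mulVec dotProduct
  simp only [Pi.star_apply]
  fun_prop

theorem continuous_witness (C : ℝ) (Ps : Finset (Op n)) (k : ℕ) : Continuous (witness C Ps k) := by
  have := fun P : Op n => continuous_expVal P
  unfold witness
  fun_prop

theorem continuous_haarKet : Continuous (haarKet (n := n)) := by
  simp only [funext haarKet_eq]; exact continuous_orbitVec _ _

theorem continuous_imagKet : Continuous (imagKet (n := n)) := by
  simp only [funext imagKet_eq]; exact continuous_orbitVec _ _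

theorem continuous_realKet : Continuous (realKet (n := n)) := by
  simp only [funext realKet_eq]; exact continuous_orbitVec _ _

theorem integral_witness {𝕜 : Type} [RCLike 𝕜] {ket : Matrix.unitaryGroup (Bits n) 𝕜 → Ket n}
    (hket : Continuous ket) (C : ℝ) (Ps : Finset (Op n)) (k : ℕ) :
    ∫ U, witness C Ps k (ket U) ∂haarProb (Bits n) 𝕜 =
      C * ∑ P ∈ Ps, ∫ U, expVal P (ket U) ^ (2 * k) ∂haarProb (Bits n) 𝕜 := by
  simp only [witness]
  rw [integral_const_mul, integral_finsetSum]
  exact fun P _ => integrable_of_continuous (((continuous_expVal P).comp hket).pow _)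

theorem integral_expVal_pow {𝕜 : Type} [RCLike 𝕜] (ρ : 𝕜 →⋆ₐ[ℝ] ℂ) (v : Ket n)
    {ket : Matrix.unitaryGroup (Bits n) 𝕜 → Ket n} (hket : ∀ U, ket U = orbitVec ρ v U)
    {P : Op n} (hP : P.IsHermitian) {k : ℕ} {r : ℝ} (h : mean (Bits n) 𝕜 (formS ρ v P ^ k) = r) :
    ∫ U, expVal P (ket U) ^ k ∂haarProb (Bits n) 𝕜 = r := by
  apply Complex.ofReal_injective
  rw [← h, mean_apply, ← integral_complex_ofReal]
  congr 1
  ext U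
  rw [Complex.ofReal_pow, hket, ofReal_expVal hP, ContinuousMap.pow_apply, formS_apply]

theorem card_bits (n : ℕ) : (Fintype.card (Bits n) : ℂ) = ((2 ^ n : ℝ) : ℂ) := by
  simp

theorem card_bits_sub_one_ne_zero (hn : 1 ≤ n) : (Fintype.card (Bits n) : ℂ) - 1 ≠ 0 := by
  have h : (2 : ℝ) ^ n - 1 ≠ 0 := by
    have : (1 : ℝ) < 2 ^ n := one_lt_pow₀ (by norm_num) (by omega)
    linarith
  rw [card_bits]
  exact_mod_cast h

/-- A traceless Hermitian operator with `Tr[P²] = 2ⁿ q` which is symmetric or antisymmetric. The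
mean of `⟨ψ|P|ψ⟩²` over any of the three ensembles depends only on `n`, `q` and the symmetry. -/
structure IsObservable (P : Op n) (q : ℝ) : Prop where
  hermitian : P.IsHermitian
  trace : P.trace = 0
  trace_sq : (P * P).trace = 2 ^ n * q
  symm : Pᵀ = P ∨ Pᵀ = -P

theorem IsObservable.trace_sq' {P : Op n} {q : ℝ} (h : IsObservable P q) :
    (P * P).trace = Fintype.card (Bits n) * (q : ℂ) := by
  rw [h.trace_sq, card_bits]; simp

/-- Over the full unitary group only the number of observables matters. -/
theorem expHaar_witness_one {Ps : Finset (Op n)} {q : ℝ} (h : ∀ P ∈ Ps, IsObservable P q) (C : ℝ) :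
    expHaar (witness C Ps 1) = C * (Ps.card * (q / (2 ^ n + 1))) := by
  rw [expHaar, integral_witness continuous_haarKet]
  congr 1
  rw [← nsmul_eq_mul, ← Finset.sum_const]
  refine Finset.sum_congr rfl fun P hP => integral_expVal_pow _ _ haarKet_eq (h P hP).hermitian ?_
  rw [mul_one, mean_unitary_second (ketZero_norm n) (h P hP).trace (h P hP).trace_sq', card_bits]
  push_cast
  rfl

open Classical in
/-- Over real states only the symmetric observables contribute. -/
theorem expImag_witness_one {Ps : Finset (Op n)} {q : ℝ} (h : ∀ P ∈ Ps, IsObservable P q) (C : ℝ) :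
    expImag (witness C Ps 1) = C * ((Ps.filter fun P => Pᵀ = P).card * (2 * q / (2 ^ n + 2))) := by
  rw [expImag, integral_witness continuous_imagKet]
  congr 1
  rw [← nsmul_eq_mul, ← Finset.sum_const, Finset.sum_filter]
  refine Finset.sum_congr rfl fun P hP => integral_expVal_pow _ _ imagKet_eq (h P hP).hermitian ?_
  rw [mul_one]
  split_ifs with hs
  · rw [mean_real_second _ (ketZero_norm n) (ketZero_real n) hs (h P hP).trace
      (h P hP).trace_sq', card_bits]
    push_cast
    rfl
  · rw [formS_real_antisymm _ (ketZero_real n) ((h P hP).symm.resolve_left hs)]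
    simp

open Classical in
/-- Over the orthogonal orbit of `|+_y⟩^{⊗ n}` symmetric and antisymmetric observables contribute
with different weights. -/
theorem expReal_witness_one (hn : 1 ≤ n) {Ps : Finset (Op n)} {q : ℝ}
    (h : ∀ P ∈ Ps, IsObservable P q) (C : ℝ) :
    expReal (witness C Ps 1) =
      C * ((Ps.filter fun P => Pᵀ = P).card * ((2 ^ n - 2) * q / ((2 ^ n - 1) * (2 ^ n + 2))) +
        (Ps.filter fun P => ¬ Pᵀ = P).card * (q / (2 ^ n - 1))) := by
  rw [expReal, integral_witness continuous_realKet]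
  congr 1
  rw [← nsmul_eq_mul, ← Finset.sum_const, ← nsmul_eq_mul, ← Finset.sum_const, ← Finset.sum_ite]
  refine Finset.sum_congr rfl fun P hP => integral_expVal_pow _ _ realKet_eq (h P hP).hermitian ?_
  rw [mul_one]
  split_ifs with hs
  · rw [mean_isotropic_symm_second _ (ketPlusY_norm n) (ketPlusY_isotropic hn) hs (h P hP).trace
      (h P hP).trace_sq' (card_bits_sub_one_ne_zero hn), card_bits]
    push_cast
    rfl
  · rw [mean_isotropic_antisymm_second _ (ketPlusY_norm n) (ketPlusY_isotropic hn)
      ((h P hP).symm.resolve_left hs) (h P hP).trace_sq' (card_bits_sub_one_ne_zero hn), card_bits]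
    push_cast
    rfl

theorem expHaar_witness_two {Ps : Finset (Op n)} {q : ℝ} (h : ∀ P ∈ Ps, IsObservable P q)
    (h1 : ∀ P ∈ Ps, P * P = 1) (C : ℝ) :
    expHaar (witness C Ps 2) = C * (Ps.card * (3 / ((2 ^ n + 1) * (2 ^ n + 3)))) := by
  rw [expHaar, integral_witness continuous_haarKet]
  congr 1
  rw [← nsmul_eq_mul, ← Finset.sum_const]
  refine Finset.sum_congr rfl fun P hP => integral_expVal_pow _ _ haarKet_eq (h P hP).hermitian ?_
  rw [mean_unitary_fourth (ketZero_norm n) (h P hP).trace (h1 P hP), card_bits]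
  push_cast
  rfl

open Classical in
theorem expImag_witness_two {Ps : Finset (Op n)} {q : ℝ} (h : ∀ P ∈ Ps, IsObservable P q)
    (h1 : ∀ P ∈ Ps, P * P = 1) (C : ℝ) :
    expImag (witness C Ps 2) =
      C * ((Ps.filter fun P => Pᵀ = P).card * (12 / ((2 ^ n + 2) * (2 ^ n + 6)))) := by
  rw [expImag, integral_witness continuous_imagKet]
  congr 1
  rw [← nsmul_eq_mul, ← Finset.sum_const, Finset.sum_filter]
  refine Finset.sum_congr rfl fun P hP => integral_expVal_pow _ _ imagKet_eq (h P hP).hermitian ?_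
  split_ifs with hs
  · rw [mean_real_fourth _ (ketZero_norm n) (ketZero_real n) hs (h P hP).trace (h1 P hP),
      card_bits]
    push_cast
    rfl
  · rw [formS_real_antisymm _ (ketZero_real n) ((h P hP).symm.resolve_left hs)]
    simp

open Classical in
theorem expReal_witness_two (hn : 1 ≤ n) {Ps : Finset (Op n)} {q : ℝ}
    (h : ∀ P ∈ Ps, IsObservable P q) (h1 : ∀ P ∈ Ps, P * P = 1) (C : ℝ) :
    expReal (witness C Ps 2) =
      C * ((Ps.filter fun P => Pᵀ = P).card *
          (3 * (2 ^ n - 2) / ((2 ^ n - 1) * (2 ^ n + 1) * (2 ^ n + 6))) +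
        (Ps.filter fun P => ¬ Pᵀ = P).card * (3 / ((2 ^ n - 1) * (2 ^ n + 1)))) := by
  rw [expReal, integral_witness continuous_realKet]
  congr 1
  rw [← nsmul_eq_mul, ← Finset.sum_const, ← nsmul_eq_mul, ← Finset.sum_const, ← Finset.sum_ite]
  refine Finset.sum_congr rfl fun P hP => integral_expVal_pow _ _ realKet_eq (h P hP).hermitian ?_
  split_ifs with hs
  · rw [mean_isotropic_symm_fourth _ (ketPlusY_norm n) (ketPlusY_isotropic hn) hs (h P hP).trace
      (h1 P hP) (card_bits_sub_one_ne_zero hn), card_bits]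
    push_cast
    rfl
  · rw [mean_isotropic_antisymm_fourth _ (ketPlusY_norm n) (ketPlusY_isotropic hn)
      ((h P hP).symm.resolve_left hs) (h1 P hP) (card_bits_sub_one_ne_zero hn), card_bits]
    push_cast
    rfl

end Ensembles

/-! ### Pauli strings -/

section Tensor

variable {n : ℕ}

/-- The tensor product `A₁ ⊗ ⋯ ⊗ Aₙ` of one-qubit matrices. -/
def tensor (A : Fin n → Matrix (Fin 2) (Fin 2) ℂ) : Op n :=
  Matrix.of fun x y => ∏ k, A k (x k) (y k)

theorem tensor_mul (A B : Fin n → Matrix (Fin 2) (Fin 2) ℂ) :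
    tensor A * tensor B = tensor fun k => A k * B k := by
  ext x y
  simp only [tensor, Matrix.mul_apply, Matrix.of_apply, ← Finset.prod_mul_distrib]
  exact sum_bits_prod fun k b => A k (x k) b * B k b (y k)

theorem trace_tensor (A : Fin n → Matrix (Fin 2) (Fin 2) ℂ) :
    (tensor A).trace = ∏ k, (A k).trace :=
  sum_bits_prod fun k b => A k b b

theorem tensor_one : tensor (fun _ : Fin n => (1 : Matrix (Fin 2) (Fin 2) ℂ)) = 1 := by
  ext x y
  simp only [tensor, Matrix.of_apply, Matrix.one_apply, Finset.prod_ite_zero,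
    Finset.prod_const_one, funext_iff, Finset.mem_univ, true_imp_iff]

/-- The sign by which the Pauli matrix `pauli a` changes under transposition. -/
def pauliSign (a : Fin 4) : ℤ := if a = 2 then -1 else 1

theorem pauli_conjTranspose (a : Fin 4) : (pauli a)ᴴ = pauli a := by
  fin_cases a <;> ext i j <;> fin_cases i <;> fin_cases j <;> simp [pauli]

theorem pauli_transpose (a : Fin 4) : (pauli a)ᵀ = (pauliSign a : ℂ) • pauli a := by
  fin_cases a <;> ext i j <;> fin_cases i <;> fin_cases j <;> simp [pauli, pauliSign]

theorem pauli_mul_self (a : Fin 4) : pauli a * pauli a = 1 := by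
  fin_cases a <;> ext i j <;> fin_cases i <;> fin_cases j <;>
    simp [pauli, Matrix.mul_apply, Fin.sum_univ_two]

theorem trace_pauli_mul (a b : Fin 4) :
    (pauli a * pauli b).trace = if a = b then 2 else 0 := by
  fin_cases a <;> fin_cases b <;>
    simp [pauli, Matrix.trace, Fin.sum_univ_two, one_add_one_eq_two]

theorem pauliString_eq_tensor (σ : Fin n → Fin 4) :
    pauliString σ = tensor fun k => pauli (σ k) := rfl

theorem pauliString_zero : pauliString (0 : Fin n → Fin 4) = 1 := tensor_one

theorem pauliString_isHermitian (σ : Fin n → Fin 4) : (pauliString σ).IsHermitian := by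
  ext x y
  simp only [pauliString, Matrix.conjTranspose_apply, Matrix.of_apply, star_prod]
  exact Finset.prod_congr rfl fun k _ => by
    rw [← Matrix.conjTranspose_apply, pauli_conjTranspose]

/-- The sign by which a Pauli string changes under transposition: `(-1)` to the number of its
factors `Y`. -/
def stringSign (σ : Fin n → Fin 4) : ℤ := ∏ k, pauliSign (σ k)

theorem pauliString_transpose (σ : Fin n → Fin 4) :
    (pauliString σ)ᵀ = (stringSign σ : ℂ) • pauliString σ := by
  ext x y
  simp only [pauliString, Matrix.transpose_apply, Matrix.of_apply, Matrix.smul_apply, stringSign,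
    Int.cast_prod, smul_eq_mul, ← Finset.prod_mul_distrib]
  exact Finset.prod_congr rfl fun k _ => by
    rw [← Matrix.transpose_apply (pauli (σ k)), pauli_transpose]; rfl

theorem stringSign_eq (σ : Fin n → Fin 4) : stringSign σ = 1 ∨ stringSign σ = -1 := by
  unfold stringSign
  refine Finset.prod_induction _ (fun z : ℤ => z = 1 ∨ z = -1) ?_ (Or.inl rfl) fun k _ => ?_
  · rintro a b (rfl | rfl) (rfl | rfl) <;> simp
  · unfold pauliSign; split_ifs <;> simp

theorem trace_pauliString_mul (σ τ : Fin n → Fin 4) :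
    (pauliString σ * pauliString τ).trace = if σ = τ then 2 ^ n else 0 := by
  rw [pauliString_eq_tensor, pauliString_eq_tensor, tensor_mul, trace_tensor]
  simp only [trace_pauli_mul]
  split_ifs with h
  · simp [h]
  · obtain ⟨k, hk⟩ := Function.ne_iff.1 h
    exact Finset.prod_eq_zero (Finset.mem_univ k) (if_neg hk)

theorem pauliString_injective : Function.Injective (pauliString (n := n)) := by
  intro σ τ h
  by_contra hne
  have h1 := trace_pauliString_mul σ τ
  rw [← h, trace_pauliString_mul, if_pos rfl, if_neg hne] at h1
  exact pow_ne_zero n two_ne_zero h1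

theorem pauliString_mul_self (σ : Fin n → Fin 4) : pauliString σ * pauliString σ = 1 := by
  rw [pauliString_eq_tensor, tensor_mul]
  simp only [pauli_mul_self]
  exact tensor_one

theorem trace_pauliString {σ : Fin n → Fin 4} (h : σ ≠ 0) : (pauliString σ).trace = 0 := by
  have := trace_pauliString_mul σ 0
  rwa [pauliString_zero, mul_one, if_neg h] at this

theorem pauliString_ne_zero (σ : Fin n → Fin 4) : pauliString σ ≠ 0 := by
  intro h
  have := pauliString_mul_self σ
  rw [h, zero_mul] at this
  exact zero_ne_one this

theorem eq_zero_of_eq_neg {A : Op n} (h : A = -A) : A = 0 := by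
  ext x y
  exact self_eq_neg.1 (congrFun (congrFun h x) y)

theorem pauliString_symm_iff (σ : Fin n → Fin 4) :
    (pauliString σ)ᵀ = pauliString σ ↔ stringSign σ = 1 := by
  rw [pauliString_transpose]
  rcases stringSign_eq σ with h | h
  · simp [h]
  · simpa [h] using fun e : -pauliString σ = pauliString σ =>
      pauliString_ne_zero σ (eq_zero_of_eq_neg e.symm)

theorem pauliString_antisymm_iff (σ : Fin n → Fin 4) :
    (pauliString σ)ᵀ = -pauliString σ ↔ stringSign σ ≠ 1 := by
  rw [pauliString_transpose]
  rcases stringSign_eq σ with h | h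
  · simpa [h] using fun e : pauliString σ = -pauliString σ =>
      pauliString_ne_zero σ (eq_zero_of_eq_neg e)
  · simp [h]

theorem pauliString_isObservable {σ : Fin n → Fin 4} (h : σ ≠ 0) :
    IsObservable (pauliString σ) 1 where
  hermitian := pauliString_isHermitian σ
  trace := trace_pauliString h
  trace_sq := by rw [pauliString_mul_self]; simp
  symm := by
    by_cases hs : stringSign σ = 1
    · exact Or.inl ((pauliString_symm_iff σ).2 hs)
    · exact Or.inr ((pauliString_antisymm_iff σ).2 hs)

theorem sum_stringSign (n : ℕ) : ∑ σ : Fin n → Fin 4, stringSign σ = 2 ^ n := by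
  unfold stringSign
  rw [← Fintype.piFinset_univ,
    ← Finset.prod_univ_sum (fun _ => Finset.univ) (fun _ => pauliSign)]
  simp [Fin.sum_univ_four, pauliSign]

/-- The numbers of symmetric and antisymmetric Pauli strings have sum `4ⁿ` and, by
`sum_stringSign`, difference `2ⁿ`. -/
theorem card_stringSign_eq_one (n : ℕ) :
    ((Finset.univ.filter fun σ : Fin n → Fin 4 => stringSign σ = 1).card : ℝ) =
      (4 ^ n + 2 ^ n) / 2 ∧
    ((Finset.univ.filter fun σ : Fin n → Fin 4 => ¬ stringSign σ = 1).card : ℝ) =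
      (4 ^ n - 2 ^ n) / 2 := by
  have h1 := Finset.card_filter_add_card_filter_not (s := Finset.univ)
    (fun σ : Fin n → Fin 4 => stringSign σ = 1)
  have h2 := sum_stringSign n
  rw [← Finset.sum_filter_add_sum_filter_not _ (fun σ : Fin n → Fin 4 => stringSign σ = 1),
    Finset.sum_congr rfl (g := fun _ => (1 : ℤ)) (by simp), Finset.sum_const,
    Finset.sum_congr (g := fun _ => (-1 : ℤ)) rfl (by
      intro σ hσ
      exact (stringSign_eq σ).resolve_left (Finset.mem_filter.1 hσ).2), Finset.sum_const] at h2
  simp only [Finset.card_univ, Fintype.card_pi, Fintype.card_fin, Finset.prod_const] at h1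
  simp only [nsmul_eq_mul] at h2
  have h1' : ((Finset.univ.filter fun σ : Fin n → Fin 4 => stringSign σ = 1).card : ℝ) +
      (Finset.univ.filter fun σ : Fin n → Fin 4 => ¬ stringSign σ = 1).card = 4 ^ n := by
    exact_mod_cast h1
  have h2' : ((Finset.univ.filter fun σ : Fin n → Fin 4 => stringSign σ = 1).card : ℝ) * 1 +
      (Finset.univ.filter fun σ : Fin n → Fin 4 => ¬ stringSign σ = 1).card * (-1) = 2 ^ n := by
    exact_mod_cast h2
  constructor <;> linarith

end Tensor

section Counting

variable {n : ℕ}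

theorem card_filter_image {α : Type*} [DecidableEq (Op n)] {s : Finset α} {f : α → Op n}
    (hf : Set.InjOn f s) (p : Op n → Prop) [DecidablePred p] [DecidablePred fun a => p (f a)] :
    ((s.image f).filter p).card = (s.filter fun a => p (f a)).card := by
  rw [Finset.filter_image, Finset.card_image_of_injOn]
  · congr
  · intro x hx y hy h
    simp only [Finset.coe_filter, Set.mem_ofPred_eq] at hx hy
    exact hf hx.1 hy.1 h

theorem card_filter_not_of_card {α : Type*} {s : Finset α} {p : α → Prop} [DecidablePred p]
    [DecidablePred fun a => ¬ p a] {a b : ℕ} (ha : (s.filter p).card = a) (hs : s.card = a + b) :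
    (s.filter fun x => ¬ p x).card = b := by
  have := Finset.card_filter_add_card_filter_not (s := s) p
  omega

open Classical in
theorem stabOps_eq (n : ℕ) :
    stabOps n = (Finset.univ.filter fun σ : Fin n → Fin 4 => σ ≠ 0).image pauliString := by
  rw [stabOps, Finset.filter_image]
  congr 1
  ext σ
  simp [← pauliString_zero, pauliString_injective.eq_iff]

theorem stabOps_isObservable {P : Op n} (hP : P ∈ stabOps n) :
    IsObservable P 1 ∧ P * P = 1 := by
  rw [stabOps_eq, Finset.mem_image] at hP
  obtain ⟨σ, hσ, rfl⟩ := hP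
  exact ⟨pauliString_isObservable (Finset.mem_filter.1 hσ).2, pauliString_mul_self σ⟩

theorem stringSign_zero : stringSign (0 : Fin n → Fin 4) = 1 := by
  simp [stringSign, pauliSign]

open Classical in
theorem card_stabOps_symm (n : ℕ) :
    (((stabOps n).filter fun P => Pᵀ = P).card : ℝ) = (4 ^ n + 2 ^ n) / 2 - 1 := by
  rw [stabOps_eq, card_filter_image pauliString_injective.injOn]
  simp only [pauliString_symm_iff]
  have h0 : (0 : Fin n → Fin 4) ∈ Finset.univ.filter fun σ => stringSign σ = 1 := by
    simp [stringSign_zero]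
  rw [← (card_stringSign_eq_one n).1, Finset.filter_filter, eq_sub_iff_add_eq, ← Nat.cast_add_one,
    Nat.cast_inj, ← Finset.card_erase_add_one h0]
  congr 2
  ext σ
  simp

open Classical in
theorem card_stabOps_antisymm (n : ℕ) :
    (((stabOps n).filter fun P => ¬ Pᵀ = P).card : ℝ) = (4 ^ n - 2 ^ n) / 2 := by
  rw [stabOps_eq, card_filter_image pauliString_injective.injOn]
  simp only [pauliString_symm_iff]
  rw [← (card_stringSign_eq_one n).2, Finset.filter_filter, Nat.cast_inj]
  congr 1
  ext σ
  simp only [Finset.mem_filter, Finset.mem_univ, true_and, and_iff_right_iff_imp]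
  rintro h rfl
  exact h stringSign_zero

open Classical in
theorem card_stabOps (n : ℕ) : ((stabOps n).card : ℝ) = 4 ^ n - 1 := by
  rw [← Finset.card_filter_add_card_filter_not (fun P : Op n => Pᵀ = P), Nat.cast_add,
    card_stabOps_symm, card_stabOps_antisymm]
  ring

open Classical in
theorem symOps_eq (n : ℕ) : symOps n = (stabOps n).filter fun P => Pᵀ = P := by
  simp only [symOps, eq_comm]

open Classical in
theorem asymOps_eq (n : ℕ) : asymOps n = (stabOps n).filter fun P => ¬ Pᵀ = P := by
  rw [asymOps, stabOps, Finset.filter_filter]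
  ext P
  simp only [Finset.mem_filter, Finset.mem_image, Finset.mem_univ, true_and, and_congr_right_iff]
  rintro ⟨σ, rfl⟩
  have e : pauliString σ = -(pauliString σ)ᵀ ↔ (pauliString σ)ᵀ = -pauliString σ := by
    rw [eq_comm, neg_eq_iff_eq_neg]
  rw [e, pauliString_antisymm_iff, pauliString_symm_iff, iff_and_self, ← pauliString_zero,
    pauliString_injective.ne_iff]
  rintro h rfl
  exact h stringSign_zero

theorem one_lt_two_pow_real (hn : 1 ≤ n) : (1 : ℝ) < 2 ^ n := one_lt_pow₀ (by norm_num) (by omega)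

theorem four_pow_eq (n : ℕ) : (4 : ℝ) ^ n = (2 ^ n) ^ 2 := by
  rw [← pow_mul, mul_comm, pow_mul]; norm_num

theorem imagW_values (hn : 1 ≤ n) :
    expHaar (imagW n) = (2 ^ n + 2) / (2 ^ (n + 1) + 2) ∧ expImag (imagW n) = 1 ∧
      expReal (imagW n) = (2 ^ n - 2) / (2 * (2 ^ n - 1)) := by
  classical
  have hobs : ∀ P ∈ symOps n, IsObservable P 1 := fun P hP =>
    (stabOps_isObservable (Finset.mem_filter.1 hP).1).1
  have h1 : (symOps n).filter (fun P => Pᵀ = P) = symOps n :=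
    Finset.filter_true_of_mem fun P hP => (Finset.mem_filter.1 hP).2.symm
  have h2 : (symOps n).filter (fun P => ¬ Pᵀ = P) = ∅ :=
    Finset.filter_false_of_mem fun P hP => not_not.2 (Finset.mem_filter.1 hP).2.symm
  have hc : ((symOps n).card : ℝ) = (4 ^ n + 2 ^ n) / 2 - 1 := by
    rw [symOps_eq, card_stabOps_symm]
  have hd := one_lt_two_pow_real hn
  rw [imagW, expHaar_witness_one hobs, expImag_witness_one hobs, expReal_witness_one hn hobs, h1,
    h2, hc, four_pow_eq, pow_succ (2 : ℝ) n]
  generalize (2 : ℝ) ^ n = d at hd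
  have : d - 1 ≠ 0 := by linarith
  refine ⟨?_, ?_, ?_⟩
  · field_simp; ring
  · field_simp; ring
  · simp; field_simp; ring

theorem realW_values (hn : 1 ≤ n) :
    expHaar (realW n) = (2 ^ n - 1) / (2 ^ n + 1) ∧ expImag (realW n) = 0 ∧
      expReal (realW n) = 1 := by
  classical
  have hobs : ∀ P ∈ asymOps n, IsObservable P 1 := fun P hP => by
    rw [asymOps_eq] at hP
    exact (stabOps_isObservable (Finset.mem_filter.1 hP).1).1
  have h1 : (asymOps n).filter (fun P => Pᵀ = P) = ∅ :=
    Finset.filter_false_of_mem fun P hP => by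
      rw [asymOps_eq] at hP
      exact (Finset.mem_filter.1 hP).2
  have h2 : (asymOps n).filter (fun P => ¬ Pᵀ = P) = asymOps n :=
    Finset.filter_true_of_mem fun P hP => by
      rw [asymOps_eq] at hP
      exact (Finset.mem_filter.1 hP).2
  have hc : ((asymOps n).card : ℝ) = (4 ^ n - 2 ^ n) / 2 := by
    rw [asymOps_eq, card_stabOps_antisymm]
  have hd := one_lt_two_pow_real hn
  -- `n - 1` is a truncated subtraction, which is harmless for `1 ≤ n`
  have hp : (2 : ℝ) ^ (n - 1) = 2 ^ n / 2 := by
    obtain ⟨m, rfl⟩ : ∃ m, n = m + 1 := ⟨n - 1, by omega⟩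
    simp [pow_succ]
  rw [realW, expHaar_witness_one hobs, expImag_witness_one hobs, expReal_witness_one hn hobs, h1,
    h2, hc, four_pow_eq, hp]
  generalize (2 : ℝ) ^ n = d at hd
  have : d - 1 ≠ 0 := by linarith
  refine ⟨?_, ?_, ?_⟩
  · field_simp
  · simp
  · simp; field_simp

theorem stabW_values (hn : 1 ≤ n) :
    expHaar (stabW n) = 3 / (3 + 2 ^ n) ∧ expImag (stabW n) = 6 / (6 + 2 ^ n) ∧
      expReal (stabW n) =
        3 * (3 * 2 ^ n + 4 ^ n - 2) / ((2 ^ n - 1) * (2 ^ n + 1) * (2 ^ n + 6)) := by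
  classical
  have hobs : ∀ P ∈ stabOps n, IsObservable P 1 := fun P hP => (stabOps_isObservable hP).1
  have hsq : ∀ P ∈ stabOps n, P * P = 1 := fun P hP => (stabOps_isObservable hP).2
  have hd := one_lt_two_pow_real hn
  rw [stabW, expHaar_witness_two hobs hsq, expImag_witness_two hobs hsq,
    expReal_witness_two hn hobs hsq, card_stabOps, card_stabOps_symm, card_stabOps_antisymm,
    four_pow_eq]
  generalize (2 : ℝ) ^ n = d at hd
  have : d - 1 ≠ 0 := by linarith
  refine ⟨?_, ?_, ?_⟩
  · field_simp; ring
  · field_simp; ring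
  · field_simp; ring

end Counting

section Local

variable {n : ℕ}

theorem stringSign_single (i : Fin n) (a : Fin 4) :
    stringSign (Pi.single i a : Fin n → Fin 4) = pauliSign a := by
  unfold stringSign
  rw [Finset.prod_eq_single i]
  · simp
  · intro k _ hk
    simp [hk, pauliSign]
  · simp

open Classical in
theorem entOps_eq (n : ℕ) : entOps n =
    (Finset.univ : Finset (Fin n × Fin 3)).image fun p => localPauli p.1 p.2.succ := by
  ext P
  simp only [entOps, Finset.mem_biUnion, Finset.mem_univ, true_and, Finset.mem_insert,
    Finset.mem_singleton, Finset.mem_image, Prod.exists, Fin.exists_fin_succ]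
  refine exists_congr fun i => ?_
  simp [eq_comm]

theorem localPauli_injective :
    Function.Injective fun p : Fin n × Fin 3 => localPauli p.1 p.2.succ := by
  rintro ⟨i, a⟩ ⟨j, b⟩ h
  have h1 := pauliString_injective h
  have hi := congrFun h1 i
  simp only [Pi.single_eq_same, Pi.single_apply] at hi
  split_ifs at hi with hij
  · subst hij
    rw [Fin.succ_inj.1 hi]
  · exact absurd hi (Fin.succ_ne_zero a)

theorem entW_values (hn : 1 ≤ n) :
    expHaar (entW n) = 3 / (2 ^ n + 1) ∧ expImag (entW n) = 4 / (2 ^ n + 2) ∧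
      expReal (entW n) = (3 * 2 ^ n - 2) / ((2 ^ n - 1) * (2 ^ n + 2)) := by
  classical
  have hobs : ∀ P ∈ entOps n, IsObservable P 1 := fun P hP => by
    rw [entOps_eq, Finset.mem_image] at hP
    obtain ⟨p, _, rfl⟩ := hP
    exact pauliString_isObservable (by simp)
  have hc : (entOps n).card = n * 3 := by
    rw [entOps_eq, Finset.card_image_of_injective _ localPauli_injective]
    simp
  have hs : ∀ p : Fin n × Fin 3,
      (localPauli p.1 p.2.succ)ᵀ = localPauli p.1 p.2.succ ↔ p.2 ≠ 1 := by
    rintro ⟨i, a⟩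
    rw [localPauli, pauliString_symm_iff, stringSign_single]
    fin_cases a <;> simp [pauliSign]
  have h1 : ((entOps n).filter fun P => Pᵀ = P).card = n * 2 := by
    rw [entOps_eq, card_filter_image localPauli_injective.injOn]
    simp only [hs]
    rw [show (Finset.univ.filter fun p : Fin n × Fin 3 => p.2 ≠ 1) =
      Finset.univ ×ˢ {0, 2} by ext ⟨i, a⟩; fin_cases a <;> simp, Finset.card_product]
    simp
  have h2 : ((entOps n).filter fun P => ¬ Pᵀ = P).card = n :=
    card_filter_not_of_card h1 (by omega)
  have hd := one_lt_two_pow_real hn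
  have hn0 : (n : ℝ) ≠ 0 := by positivity
  rw [entW, expHaar_witness_one hobs, expImag_witness_one hobs, expReal_witness_one hn hobs, h1,
    h2, hc]
  push_cast
  generalize (2 : ℝ) ^ n = d at hd
  have : d - 1 ≠ 0 := by linarith
  refine ⟨?_, ?_, ?_⟩
  · field_simp
  · field_simp; ring
  · field_simp; ring

open Classical in
/-- Triples of observables such as the spin components: two symmetric ones and an antisymmetric
one. -/
theorem witness_triple_values (hn : 1 ≤ n) {A B D : Op n} {q : ℝ} (hq : q ≠ 0)
    (hA : IsObservable A q) (hB : IsObservable B q) (hD : IsObservable D q)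
    (hAs : Aᵀ = A) (hBs : Bᵀ = -B) (hDs : Dᵀ = D) (hAD : A ≠ D) (C : ℝ) :
    expHaar (witness C {A, B, D} 1) = C * q * (3 / (2 ^ n + 1)) ∧
    expImag (witness C {A, B, D} 1) = C * q * (4 / (2 ^ n + 2)) ∧
    expReal (witness C {A, B, D} 1) =
      C * q * ((3 * 2 ^ n - 2) / ((2 ^ n - 1) * (2 ^ n + 2))) := by
  have hB' : Bᵀ ≠ B := by
    intro h
    have hB0 : B = 0 := eq_zero_of_eq_neg (by rw [← hBs, h])
    have := hB.trace_sq
    rw [hB0, zero_mul, Matrix.trace_zero] at this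
    simp [hq] at this
  have hAB : A ≠ B := by rintro rfl; exact hB' hAs
  have hBD : B ≠ D := by rintro rfl; exact hB' hDs
  have hobs : ∀ P ∈ ({A, B, D} : Finset (Op n)), IsObservable P q := by
    intro P hP
    simp only [Finset.mem_insert, Finset.mem_singleton] at hP
    rcases hP with rfl | rfl | rfl <;> assumption
  have hc : ({A, B, D} : Finset (Op n)).card = 3 := by simp [hAB, hAD, hBD]
  have h1 : (({A, B, D} : Finset (Op n)).filter fun P => Pᵀ = P).card = 2 := by
    simp [Finset.filter_insert, Finset.filter_singleton, hAs, hDs, hB', hAD]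
  have h2 : (({A, B, D} : Finset (Op n)).filter fun P => ¬ Pᵀ = P).card = 1 := by
    simp [Finset.filter_insert, Finset.filter_singleton, hAs, hDs, hB']
  have hd := one_lt_two_pow_real hn
  rw [expHaar_witness_one hobs, expImag_witness_one hobs, expReal_witness_one hn hobs, h1, h2, hc]
  generalize (2 : ℝ) ^ n = d at hd
  have : d - 1 ≠ 0 := by linarith
  push_cast
  refine ⟨?_, ?_, ?_⟩
  · ring
  · ring
  · field_simp; ring

theorem trace_sum_localPauli_mul {a b : Fin 4} (ha : a ≠ 0) (hb : b ≠ 0) :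
    ((∑ i : Fin n, localPauli i a) * ∑ i : Fin n, localPauli i b).trace =
      if a = b then 2 ^ n * n else 0 := by
  have h : ∀ i j : Fin n, (Pi.single i a : Fin n → Fin 4) = Pi.single j b ↔ i = j ∧ a = b := by
    intro i j
    constructor
    · intro h
      have := congrFun h i
      simp only [Pi.single_eq_same, Pi.single_apply] at this
      split_ifs at this with hij
      · exact ⟨hij, this⟩
      · exact absurd this ha
    · rintro ⟨rfl, rfl⟩; rfl
  simp only [Finset.sum_mul_sum, Matrix.trace_sum, localPauli, trace_pauliString_mul, h]
  by_cases hab : a = b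
  · simp [hab, mul_comm]
  · simp [hab]

theorem sum_localPauli_transpose (a : Fin 4) :
    (∑ i : Fin n, localPauli i a)ᵀ = (pauliSign a : ℂ) • ∑ i : Fin n, localPauli i a := by
  rw [Matrix.transpose_sum, Finset.smul_sum]
  refine Finset.sum_congr rfl fun i _ => ?_
  rw [localPauli, pauliString_transpose, stringSign_single]

theorem sum_localPauli_isObservable {a : Fin 4} (ha : a ≠ 0) :
    IsObservable (∑ i : Fin n, localPauli i a) n where
  hermitian := by
    unfold Matrix.IsHermitian
    rw [Matrix.conjTranspose_sum]
    exact Finset.sum_congr rfl fun i _ => pauliString_isHermitian _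
  trace := by
    rw [Matrix.trace_sum]
    exact Finset.sum_eq_zero fun i _ => trace_pauliString (by simpa using ha)
  trace_sq := by
    rw [trace_sum_localPauli_mul ha ha, if_pos rfl]
    simp
  symm := by
    rw [sum_localPauli_transpose]
    unfold pauliSign
    split_ifs <;> simp

theorem uentW_values (hn : 1 ≤ n) :
    expHaar (uentW n) = 3 / (n * (2 ^ n + 1)) ∧ expImag (uentW n) = 4 / (n * (2 ^ n + 2)) ∧
      expReal (uentW n) = (3 * 2 ^ n - 2) / (n * (2 ^ n - 1) * (2 ^ n + 2)) := by
  classical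
  have hn0 : (n : ℝ) ≠ 0 := by positivity
  have hne : ∑ i : Fin n, localPauli i 1 ≠ ∑ i : Fin n, localPauli i 3 := by
    intro h
    have h1 := trace_sum_localPauli_mul (n := n) (a := 1) (b := 3) (by decide) (by decide)
    rw [← h, trace_sum_localPauli_mul (by decide) (by decide), if_pos rfl,
      if_neg (by decide)] at h1
    simp at h1
    omega
  obtain ⟨h1, h2, h3⟩ := witness_triple_values hn hn0
    (sum_localPauli_isObservable (a := 1) (by decide))
    (sum_localPauli_isObservable (a := 2) (by decide))
    (sum_localPauli_isObservable (a := 3) (by decide))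
    (by rw [sum_localPauli_transpose]; simp [pauliSign])
    (by rw [sum_localPauli_transpose]; simp [pauliSign])
    (by rw [sum_localPauli_transpose]; simp [pauliSign]) hne (1 / (n : ℝ) ^ 2)
  rw [uentW, uentOps, h1, h2, h3]
  have hd := one_lt_two_pow_real hn
  generalize (2 : ℝ) ^ n = d at hd
  have : d - 1 ≠ 0 := by linarith
  refine ⟨?_, ?_, ?_⟩ <;> field_simp

end Local

/-! ### Quadratic Majorana operators -/

section Majorana

variable {n : ℕ}

/-- The sign `±1` with which two Pauli matrices commute. -/
def commSign (a b : Fin 4) : ℂ := if a = 0 ∨ b = 0 ∨ a = b then 1 else -1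

theorem pauli_mul_comm (a b : Fin 4) : pauli a * pauli b = commSign a b • (pauli b * pauli a) := by
  fin_cases a <;> fin_cases b <;> ext i j <;> fin_cases i <;> fin_cases j <;>
    simp [pauli, commSign, Matrix.mul_apply, Fin.sum_univ_two]

theorem pauliString_mul_comm (σ τ : Fin n → Fin 4) :
    pauliString σ * pauliString τ =
      (∏ k, commSign (σ k) (τ k)) • (pauliString τ * pauliString σ) := by
  rw [pauliString_eq_tensor, pauliString_eq_tensor, tensor_mul, tensor_mul]
  ext x y
  simp only [tensor, Matrix.of_apply, Matrix.smul_apply, smul_eq_mul, ← Finset.prod_mul_distrib]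
  exact Finset.prod_congr rfl fun k _ => by rw [pauli_mul_comm]; rfl

theorem majorana_mul_self (a : Fin (2 * n)) : (majorana a : Op n) * majorana a = 1 :=
  pauliString_mul_self _

theorem majorana_anticomm_of_lt {a b : Fin (2 * n)} (h : a < b) :
    (majorana a : Op n) * majorana b = -(majorana b * majorana a) := by
  rw [majorana, majorana, pauliString_mul_comm]
  have ha : (a : ℕ) / 2 < n := by omega
  have hab : (a : ℕ) < b := h
  -- only the qubit on which `γ_a` acts by `X` or `Y` contributes a sign
  rw [Finset.prod_eq_single ⟨(a : ℕ) / 2, ha⟩]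
  · have : commSign (if (a : ℕ) % 2 = 0 then 1 else 2)
        (if (a : ℕ) / 2 < (b : ℕ) / 2 then 3
          else if (a : ℕ) / 2 = (b : ℕ) / 2 then (if (b : ℕ) % 2 = 0 then 1 else 2) else 0) =
        -1 := by
      by_cases h1 : (a : ℕ) / 2 < (b : ℕ) / 2
      · rw [if_pos h1]
        split_ifs <;> simp [commSign]
      · have h2 : (a : ℕ) / 2 = (b : ℕ) / 2 := by omega
        rw [if_neg h1, if_pos h2, if_pos (by omega), if_neg (by omega)]
        simp [commSign]
    simp only [lt_irrefl, if_false, if_true, this, neg_smul, one_smul]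
  · intro k _ hk
    have hk' : (k : ℕ) ≠ (a : ℕ) / 2 := fun e => hk (Fin.ext e)
    by_cases h1 : (k : ℕ) < (a : ℕ) / 2
    · have h2 : (k : ℕ) < (b : ℕ) / 2 := by omega
      simp [commSign, h1, h2]
    · simp [commSign, h1, hk']
  · simp

theorem majorana_anticomm {a b : Fin (2 * n)} (h : a ≠ b) :
    (majorana a : Op n) * majorana b = -(majorana b * majorana a) := by
  rcases lt_or_gt_of_ne h with h | h
  · exact majorana_anticomm_of_lt h
  · rw [majorana_anticomm_of_lt h, neg_neg]

/-- Majorana operators with even (zero-based) index are symmetric, the others antisymmetric. -/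
theorem majorana_transpose (a : Fin (2 * n)) :
    (majorana a : Op n)ᵀ = ((-1 : ℂ) ^ (a : ℕ)) • majorana a := by
  have ha : (a : ℕ) / 2 < n := by omega
  rw [majorana, pauliString_transpose, stringSign, Finset.prod_eq_single ⟨(a : ℕ) / 2, ha⟩]
  · congr 1
    rcases Nat.mod_two_eq_zero_or_one a with h | h
    · simp [pauliSign, h, (Nat.even_iff.2 h).neg_one_pow]
    · simp [pauliSign, h, (Nat.odd_iff.2 h).neg_one_pow]
  · intro k _ hk
    have hk' : (k : ℕ) ≠ (a : ℕ) / 2 := fun e => hk (Fin.ext e)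
    unfold pauliSign
    split_ifs with h1 h2 <;> simp_all
  · simp

/-- The quadratic Majorana operator `i γ_a γ_b`. -/
def majoranaPair (p : Fin (2 * n) × Fin (2 * n)) : Op n :=
  Complex.I • (majorana p.1 * majorana p.2)

theorem majoranaPair_mul_self {p : Fin (2 * n) × Fin (2 * n)} (h : p.1 < p.2) :
    (majoranaPair p : Op n) * majoranaPair p = 1 := by
  have e : (majorana p.1 : Op n) * majorana p.2 * (majorana p.1 * majorana p.2) = -1 := by
    rw [mul_assoc, ← mul_assoc (majorana p.2), majorana_anticomm h.ne', neg_mul, mul_assoc,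
      majorana_mul_self, mul_one, mul_neg, majorana_mul_self]
  rw [majoranaPair, smul_mul_smul_comm, e, Complex.I_mul_I]
  simp

theorem majoranaPair_transpose {p : Fin (2 * n) × Fin (2 * n)} (h : p.1 < p.2) :
    (majoranaPair p : Op n)ᵀ =
      (-((-1 : ℂ) ^ (p.1 : ℕ) * (-1) ^ (p.2 : ℕ))) • majoranaPair p := by
  rw [majoranaPair, Matrix.transpose_smul, Matrix.transpose_mul, majorana_transpose,
    majorana_transpose, smul_mul_smul_comm, majorana_anticomm h.ne']
  rw [smul_smul, smul_neg, smul_smul, ← neg_smul]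
  congr 1
  ring

theorem majoranaPair_ne_zero {p : Fin (2 * n) × Fin (2 * n)} (h : p.1 < p.2) :
    (majoranaPair p : Op n) ≠ 0 := by
  intro h0
  have := majoranaPair_mul_self h
  rw [h0, zero_mul] at this
  exact zero_ne_one this

theorem majoranaPair_isObservable {p : Fin (2 * n) × Fin (2 * n)} (h : p.1 < p.2) :
    IsObservable (majoranaPair p : Op n) 1 where
  hermitian := by
    have h1 : ∀ a : Fin (2 * n), (majorana a : Op n)ᴴ = majorana a := fun a =>
      pauliString_isHermitian _
    unfold Matrix.IsHermitian majoranaPair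
    rw [Matrix.conjTranspose_smul, Matrix.conjTranspose_mul, h1, h1, majorana_anticomm h.ne']
    simp
  trace := by
    have e : ((majorana p.1 : Op n) * majorana p.2).trace = 0 := by
      have h1 := congrArg Matrix.trace (majorana_anticomm h.ne)
      rw [Matrix.trace_neg, Matrix.trace_mul_comm (majorana p.2)] at h1
      exact self_eq_neg.1 h1
    rw [majoranaPair, Matrix.trace_smul, e, smul_zero]
  trace_sq := by rw [majoranaPair_mul_self h]; simp
  symm := by
    rw [majoranaPair_transpose h]
    rcases neg_one_pow_eq_or ℂ (p.1 : ℕ) with h1 | h1 <;>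
      rcases neg_one_pow_eq_or ℂ (p.2 : ℕ) with h2 | h2 <;> simp [h1, h2]

theorem majoranaPair_symm_iff {p : Fin (2 * n) × Fin (2 * n)} (h : p.1 < p.2) :
    (majoranaPair p : Op n)ᵀ = majoranaPair p ↔ (-1 : ℤ) ^ (p.1 : ℕ) * (-1) ^ (p.2 : ℕ) = -1 := by
  have hne : ¬ -(majoranaPair p : Op n) = majoranaPair p := fun e =>
    majoranaPair_ne_zero h (eq_zero_of_eq_neg e.symm)
  rw [majoranaPair_transpose h]
  rcases Nat.even_or_odd (p.1 : ℕ) with h1 | h1 <;>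
    rcases Nat.even_or_odd (p.2 : ℕ) with h2 | h2 <;>
    simp [h1.neg_one_pow, h2.neg_one_pow, hne]

/-- `i γ_a γ_b` anticommutes with `γ_a`, `γ_b` and commutes with all other Majorana operators,
which distinguishes the pairs from one another. -/
theorem mem_pair_of_majoranaPair_eq {p r : Fin (2 * n) × Fin (2 * n)} (hp : p.1 < p.2)
    (h : (majoranaPair p : Op n) = majoranaPair r) {e : Fin (2 * n)} (he : e = p.1 ∨ e = p.2) :
    e = r.1 ∨ e = r.2 := by
  by_contra! hr
  have h1 : (majoranaPair p : Op n) * majorana e = -(majorana e * majoranaPair p) := by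
    simp only [majoranaPair, smul_mul_assoc, mul_smul_comm, ← smul_neg]
    congr 1
    rcases he with rfl | rfl
    · rw [mul_assoc, majorana_anticomm hp.ne', mul_neg]
    · rw [← mul_assoc, majorana_anticomm hp.ne', neg_mul, neg_neg]
  have h2 : (majoranaPair r : Op n) * majorana e = majorana e * majoranaPair r := by
    simp only [majoranaPair, smul_mul_assoc, mul_smul_comm]
    congr 1
    rw [mul_assoc, majorana_anticomm hr.2.symm, mul_neg, ← mul_assoc, majorana_anticomm hr.1.symm,
      neg_mul, neg_neg, mul_assoc]
  rw [h, h2] at h1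
  have h3 := congrArg (majorana e * ·) (eq_zero_of_eq_neg h1)
  simp only [← mul_assoc, majorana_mul_self, one_mul, mul_zero] at h3
  exact majoranaPair_ne_zero hp (h.trans h3)

theorem majoranaPair_injOn :
    Set.InjOn (majoranaPair (n := n))
      (Finset.univ.filter fun p : Fin (2 * n) × Fin (2 * n) => p.1 < p.2) := by
  intro p hp r hr h
  have hp' : p.1 < p.2 := by simpa using hp
  have hr' : r.1 < r.2 := by simpa using hr
  have h1 := mem_pair_of_majoranaPair_eq hp' h (Or.inl rfl)
  have h2 := mem_pair_of_majoranaPair_eq hp' h (Or.inr rfl)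
  have h3 := mem_pair_of_majoranaPair_eq hr' h.symm (Or.inl rfl)
  ext <;> omega

/-- A symmetric irreflexive relation holds for twice as many pairs as increasing pairs. -/
theorem two_mul_card_lt {m : ℕ} (r : Fin m × Fin m → Prop) [DecidablePred r]
    (hs : ∀ p, r p → r p.swap) (hi : ∀ p, r p → p.1 ≠ p.2) :
    2 * ((Finset.univ.filter fun p : Fin m × Fin m => p.1 < p.2).filter r).card =
      (Finset.univ.filter r).card := by
  have h : (Finset.univ.filter fun p : Fin m × Fin m => p.2 < p.1 ∧ r p).card =
      (Finset.univ.filter fun p : Fin m × Fin m => p.1 < p.2 ∧ r p).card :=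
    Finset.card_bij' (fun p _ => p.swap) (fun p _ => p.swap)
      (by simpa using fun a b h1 h2 => ⟨h1, hs _ h2⟩)
      (by simpa using fun a b h1 h2 => ⟨h1, hs _ h2⟩) (by simp) (by simp)
  rw [Finset.filter_filter, two_mul]
  nth_rw 2 [← h]
  rw [← Finset.card_union_of_disjoint]
  · congr 1
    ext p
    simp only [Finset.mem_union, Finset.mem_filter, Finset.mem_univ, true_and]
    constructor
    · rintro (h | h) <;> exact h.2
    · intro hr
      rcases lt_or_gt_of_ne (hi p hr) with h | h
      · exact Or.inl ⟨h, hr⟩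
      · exact Or.inr ⟨h, hr⟩
  · rw [Finset.disjoint_filter]
    rintro p _ ⟨h1, _⟩ ⟨h2, _⟩
    exact lt_asymm h1 h2

theorem card_increasing_pairs (n : ℕ) :
    ((Finset.univ.filter fun p : Fin (2 * n) × Fin (2 * n) => p.1 < p.2).card : ℤ) =
      n * (2 * n - 1) := by
  have h := two_mul_card_lt (m := 2 * n) (fun p => p.1 ≠ p.2) (fun p h => h.symm) fun p h => h
  have h1 : (Finset.univ.filter fun p : Fin (2 * n) × Fin (2 * n) => p.1 < p.2).filter
      (fun p => p.1 ≠ p.2) = Finset.univ.filter fun p : Fin (2 * n) × Fin (2 * n) => p.1 < p.2 :=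
    Finset.filter_true_of_mem fun p hp => (Finset.mem_filter.1 hp).2.ne
  have h2 : (Finset.univ.filter fun p : Fin (2 * n) × Fin (2 * n) => p.1 ≠ p.2).card =
      (2 * n) * (2 * n) - 2 * n := by
    have := Finset.offDiag_card (Finset.univ : Finset (Fin (2 * n)))
    rw [Finset.card_univ, Fintype.card_fin] at this
    rw [← this]
    congr 1
    ext p
    simp
  rw [h1, h2] at h
  have h3 : 2 * n ≤ 2 * n * (2 * n) := Nat.le_mul_self _
  zify [h3] at h
  linarith

/-- The symmetric operators `i γ_a γ_b` are those with `a`, `b` of different parity; these are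
counted by the signs `(-1) ^ (a + b)`, which sum to zero over all pairs. -/
theorem card_increasing_pairs_parity (n : ℕ) :
    ((Finset.univ.filter fun p : Fin (2 * n) × Fin (2 * n) => p.1 < p.2).filter
      fun p => (-1 : ℤ) ^ (p.1 : ℕ) * (-1) ^ (p.2 : ℕ) = -1).card = n ^ 2 := by
  have h := two_mul_card_lt (m := 2 * n)
    (fun p => (-1 : ℤ) ^ (p.1 : ℕ) * (-1) ^ (p.2 : ℕ) = -1)
    (fun p h => by rwa [Prod.fst_swap, Prod.snd_swap, mul_comm])
    fun p h e => by
      rw [e, ← mul_pow] at h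
      norm_num at h
  -- each coordinate runs over equally many even and odd indices
  have h1 : ∑ p : Fin (2 * n) × Fin (2 * n), (-1 : ℤ) ^ (p.1 : ℕ) * (-1) ^ (p.2 : ℕ) = 0 := by
    have h0 : ∑ a : Fin (2 * n), (-1 : ℤ) ^ (a : ℕ) = 0 := by
      rw [Fin.sum_univ_eq_sum_range (fun i => (-1 : ℤ) ^ i), neg_one_geom_sum]
      simp
    rw [Fintype.sum_prod_type]
    dsimp only
    rw [← Finset.sum_mul_sum, h0, zero_mul]
  have h2 : ∀ p : Fin (2 * n) × Fin (2 * n), (-1 : ℤ) ^ (p.1 : ℕ) * (-1) ^ (p.2 : ℕ) =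
      1 - 2 * if (-1 : ℤ) ^ (p.1 : ℕ) * (-1) ^ (p.2 : ℕ) = -1 then 1 else 0 := by
    intro p
    rcases neg_one_pow_eq_or ℤ (p.1 : ℕ) with h1 | h1 <;>
      rcases neg_one_pow_eq_or ℤ (p.2 : ℕ) with h2 | h2 <;> simp [h1, h2]
  rw [Finset.sum_congr rfl fun p _ => h2 p, Finset.sum_sub_distrib, ← Finset.mul_sum,
    Finset.sum_boole] at h1
  simp only [Finset.sum_const, Finset.card_univ, Fintype.card_prod, Fintype.card_fin,
    nsmul_eq_mul, mul_one] at h1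
  rw [← h] at h1
  push_cast at h1
  zify
  nlinarith

theorem fermW_values (hn : 1 ≤ n) :
    expHaar (fermW n) = (2 * n - 1) / (2 ^ n + 1) ∧ expImag (fermW n) = 2 * n / (2 ^ n + 2) ∧
      expReal (fermW n) = (2 ^ n * (2 * n - 1) - 2) / ((2 ^ n - 1) * (2 ^ n + 2)) := by
  classical
  have heq : fermOps n = (Finset.univ.filter fun p : Fin (2 * n) × Fin (2 * n) =>
      p.1 < p.2).image majoranaPair := by
    ext; simp [fermOps, majoranaPair]
  have hobs : ∀ P ∈ fermOps n, IsObservable P 1 := fun P hP => by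
    rw [heq, Finset.mem_image] at hP
    obtain ⟨p, hp, rfl⟩ := hP
    exact majoranaPair_isObservable (Finset.mem_filter.1 hp).2
  have hc : ((fermOps n).card : ℝ) = n * (2 * n - 1) := by
    rw [heq, Finset.card_image_of_injOn majoranaPair_injOn]
    exact_mod_cast congrArg (Int.cast : ℤ → ℝ) (card_increasing_pairs n)
  have h1 : ((fermOps n).filter fun P => Pᵀ = P).card = n ^ 2 := by
    rw [heq, card_filter_image majoranaPair_injOn, ← card_increasing_pairs_parity]
    congr 1
    refine Finset.filter_congr fun p hp => ?_
    exact majoranaPair_symm_iff (Finset.mem_filter.1 hp).2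
  have h2 : (((fermOps n).filter fun P => ¬ Pᵀ = P).card : ℝ) = n * (n - 1) := by
    have h := Finset.card_filter_add_card_filter_not (s := fermOps n) fun P => Pᵀ = P
    rw [h1] at h
    have h' := congrArg (Nat.cast : ℕ → ℝ) h
    rw [hc] at h'
    push_cast at h'
    linarith
  have hd := one_lt_two_pow_real hn
  have hn0 : (n : ℝ) ≠ 0 := by positivity
  rw [fermW, expHaar_witness_one hobs, expImag_witness_one hobs, expReal_witness_one hn hobs, h1,
    h2, hc]
  push_cast
  generalize (2 : ℝ) ^ n = d at hd
  have : d - 1 ≠ 0 := by linarith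
  refine ⟨?_, ?_, ?_⟩
  · field_simp
  · field_simp
  · field_simp; ring

end Majorana

/-! ### Spin operators -/

section Spin

variable {n : ℕ}

/-- The position of a bit string in the lexicographic order. -/
def bitIndex (n : ℕ) : Bits n ≃ Fin (2 ^ n) :=
  (Equiv.arrowCongr Fin.revPerm (Equiv.refl (Fin 2))).trans finFunctionFinEquiv

theorem magnetic_eq (x : Bits n) : magnetic x = spin n - ((bitIndex n x : ℕ) : ℝ) := by
  rw [magnetic]
  congr 1
  simp only [bitIndex, Equiv.trans_apply, finFunctionFinEquiv_apply, Equiv.arrowCongr_apply,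
    Equiv.coe_refl, Function.comp_apply, id, Nat.cast_sum, Nat.cast_mul, Nat.cast_pow,
    Nat.cast_ofNat]
  rw [← Equiv.sum_comp Fin.revPerm]
  refine Finset.sum_congr rfl fun k _ => ?_
  have : n - 1 - (Fin.rev k : ℕ) = k := by rw [Fin.val_rev]; omega
  rw [Fin.revPerm_apply, this]
  simp

theorem sum_magnetic (f : ℝ → ℝ) :
    ∑ x : Bits n, f (magnetic x) = ∑ k ∈ Finset.range (2 ^ n), f (spin n - k) := by
  simp only [magnetic_eq]
  rw [Equiv.sum_comp (bitIndex n) fun k : Fin (2 ^ n) => f (spin n - ((k : ℕ) : ℝ)),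
    Fin.sum_univ_eq_sum_range fun k => f (spin n - (k : ℝ))]

theorem sum_range_sub (s : ℝ) (m : ℕ) :
    ∑ k ∈ Finset.range m, (s - k) = m * s - m * (m - 1) / 2 := by
  induction m with
  | zero => simp
  | succ m ih => rw [Finset.sum_range_succ, ih]; push_cast; ring

theorem sum_range_sub_sq (s : ℝ) (m : ℕ) :
    ∑ k ∈ Finset.range m, (s - k) ^ 2 =
      m * s ^ 2 - s * (m * (m - 1)) + m * (m - 1) * (2 * m - 1) / 6 := by
  induction m with
  | zero => simp
  | succ m ih => rw [Finset.sum_range_succ, ih]; push_cast; ring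

theorem sum_magnetic_first (n : ℕ) : ∑ x : Bits n, magnetic x = 0 := by
  rw [sum_magnetic fun m => m, sum_range_sub, spin]
  push_cast
  ring

theorem sum_magnetic_sq (n : ℕ) :
    ∑ x : Bits n, magnetic x ^ 2 = 2 ^ n * (((2 ^ n) ^ 2 - 1) / 12) := by
  rw [sum_magnetic fun m => m ^ 2, sum_range_sub_sq, spin]
  push_cast
  ring

theorem magnetic_abs_le (x : Bits n) : |magnetic x| ≤ spin n := by
  have h : ((bitIndex n x : ℕ) : ℝ) + 1 ≤ 2 ^ n := by exact_mod_cast (bitIndex n x).2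
  have h0 : (0 : ℝ) ≤ ((bitIndex n x : ℕ) : ℝ) := Nat.cast_nonneg _
  have hs : 2 * spin n = 2 ^ n - 1 := by rw [spin]; ring
  rw [magnetic_eq, abs_le]
  constructor <;> linarith

theorem magnetic_mul_le (x y : Bits n) : 0 ≤ spin n * (spin n + 1) - magnetic x * magnetic y := by
  have hx := magnetic_abs_le x
  have hy := magnetic_abs_le y
  have h0 : 0 ≤ spin n := (abs_nonneg _).trans hx
  have h1 : magnetic x * magnetic y ≤ spin n * spin n := by
    refine (le_abs_self _).trans ?_
    rw [abs_mul]
    exact mul_le_mul hx hy (abs_nonneg _) h0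
  linarith [mul_add (spin n) (spin n) 1]

open Classical in
/-- The raising operator contributes `s (s + 1) - m (m + 1)`, also for `m = s`, where there is no
state to raise to. -/
theorem sum_raise (y : Bits n) :
    ∑ x : Bits n, (if magnetic x = magnetic y + 1 then
      spin n * (spin n + 1) - magnetic x * magnetic y else 0) =
      spin n * (spin n + 1) - (magnetic y + 1) * magnetic y := by
  by_cases hy : (bitIndex n y : ℕ) = 0
  -- the empty sum agrees with the formula, since `s (s + 1) - (m + 1) m = 0` for `m = s`
  · have hm : magnetic y = spin n := by rw [magnetic_eq, hy]; simp
    rw [Finset.sum_eq_zero]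
    · rw [hm]; ring
    · intro x _
      rw [if_neg]
      intro h
      have := (le_abs_self _).trans (magnetic_abs_le x)
      rw [h, hm] at this
      linarith
  · have hlt : (bitIndex n y : ℕ) - 1 < 2 ^ n := by omega
    have hx : ∀ x : Bits n,
        magnetic x = magnetic y + 1 ↔ x = (bitIndex n).symm ⟨(bitIndex n y : ℕ) - 1, hlt⟩ := by
      intro x
      rw [Equiv.eq_symm_apply, Fin.ext_iff, magnetic_eq, magnetic_eq]
      have h1 : (((bitIndex n y : ℕ) - 1 : ℕ) : ℝ) = (bitIndex n y : ℕ) - 1 := by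
        rw [Nat.cast_sub (by omega), Nat.cast_one]
      rw [← Nat.cast_inj (R := ℝ), h1]
      constructor <;> intro h <;> linarith
    rw [Finset.sum_congr rfl fun x _ => if_congr (hx x) rfl rfl, Finset.sum_ite_eq',
      if_pos (Finset.mem_univ _), (hx _).2 rfl]

open Classical in
/-- The trace of `S₊ S₋`. -/
theorem sum_sum_raise (n : ℕ) :
    ∑ y : Bits n, ∑ x : Bits n, (if magnetic x = magnetic y + 1 then
      spin n * (spin n + 1) - magnetic x * magnetic y else 0) =
      2 ^ n * (((2 ^ n) ^ 2 - 1) / 6) := by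
  have h : ∀ y : Bits n, spin n * (spin n + 1) - (magnetic y + 1) * magnetic y =
      spin n * (spin n + 1) - magnetic y ^ 2 - magnetic y := fun y => by ring
  simp only [sum_raise, h, Finset.sum_sub_distrib, sum_magnetic_first, sum_magnetic_sq,
    Finset.sum_const, Finset.card_univ, nsmul_eq_mul]
  rw [spin]
  simp
  ring

open Classical in
/-- `S_x` and `S_y` have the same matrix entries up to phases, and these cancel in `S_xy S_yx`. -/
theorem trace_spin_sq {S : Op n} (hS : ∀ x y, S x y * S y x =
    (((1 / 4 : ℝ) * ((if magnetic x = magnetic y + 1 then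
        spin n * (spin n + 1) - magnetic x * magnetic y else 0) +
      (if magnetic y = magnetic x + 1 then
        spin n * (spin n + 1) - magnetic y * magnetic x else 0)) : ℝ) : ℂ)) :
    (S * S).trace = 2 ^ n * ((((2 ^ n) ^ 2 - 1) / 12 : ℝ) : ℂ) := by
  simp only [Matrix.trace, Matrix.diag_apply, Matrix.mul_apply, hS, ← Complex.ofReal_sum,
    ← Finset.mul_sum, Finset.sum_add_distrib]
  rw [Finset.sum_comm, sum_sum_raise]
  push_cast
  ring

theorem ofReal_sqrt_mul_self {r : ℝ} (h : 0 ≤ r) : (Real.sqrt r : ℂ) * Real.sqrt r = r := by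
  rw [← Complex.ofReal_mul, Real.mul_self_sqrt h]

theorem spinX_transpose (n : ℕ) : (spinX n)ᵀ = spinX n := by
  ext x y
  simp only [spinX, Matrix.transpose_apply, Matrix.of_apply, mul_comm (magnetic y),
    eq_comm (a := magnetic y), eq_comm (b := magnetic x)]
  ring

theorem spinY_transpose (n : ℕ) : (spinY n)ᵀ = -spinY n := by
  ext x y
  simp only [spinY, Matrix.transpose_apply, Matrix.of_apply, Matrix.neg_apply,
    mul_comm (magnetic y), eq_comm (a := magnetic y), eq_comm (b := magnetic x)]
  ring

theorem spinX_isObservable (n : ℕ) : IsObservable (spinX n) (((2 ^ n) ^ 2 - 1) / 12) where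
  hermitian := by
    have h : (spinX n)ᴴ = (spinX n)ᵀ := by
      ext x y
      simp only [spinX, Matrix.conjTranspose_apply, Matrix.transpose_apply, Matrix.of_apply,
        star_mul', star_add, Complex.star_def, Complex.conj_ofReal, apply_ite (starRingEnd ℂ)]
      simp [map_ofNat (starRingEnd ℂ) 2]
    rw [Matrix.IsHermitian, h, spinX_transpose]
  trace := Finset.sum_eq_zero fun x _ => by simp [spinX]
  trace_sq := by
    classical
    refine trace_spin_sq fun x y => ?_
    have hs := ofReal_sqrt_mul_self (magnetic_mul_le x y)
    simp only [spinX, Matrix.of_apply, eq_comm (a := magnetic x + 1),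
      eq_comm (a := magnetic y + 1), mul_comm (magnetic y) (magnetic x)]
    push_cast
    split_ifs with h1 h2 h2
    · linarith
    · push_cast at hs ⊢; linear_combination (1 / 4 : ℂ) * hs
    · push_cast at hs ⊢; linear_combination (1 / 4 : ℂ) * hs
    · simp
  symm := Or.inl (spinX_transpose n)

theorem spinY_isObservable (n : ℕ) : IsObservable (spinY n) (((2 ^ n) ^ 2 - 1) / 12) where
  hermitian := by
    have h : (spinY n)ᴴ = -(spinY n)ᵀ := by
      ext x y
      simp only [spinY, Matrix.conjTranspose_apply, Matrix.transpose_apply, Matrix.of_apply,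
        star_mul', star_sub, Complex.star_def, Complex.conj_ofReal, apply_ite (starRingEnd ℂ),
        Matrix.neg_apply]
      simp [map_ofNat (starRingEnd ℂ) 2]
    rw [Matrix.IsHermitian, h, spinY_transpose, neg_neg]
  trace := Finset.sum_eq_zero fun x _ => by simp [spinY]
  trace_sq := by
    classical
    refine trace_spin_sq fun x y => ?_
    have hs := ofReal_sqrt_mul_self (magnetic_mul_le x y)
    have hI : (1 / (2 * Complex.I)) * (1 / (2 * Complex.I)) = -(1 / 4 : ℂ) := by
      field_simp
      rw [Complex.I_sq]
      norm_num
    simp only [spinY, Matrix.of_apply, eq_comm (a := magnetic x + 1),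
      eq_comm (a := magnetic y + 1), mul_comm (magnetic y) (magnetic x)]
    generalize 1 / (2 * Complex.I) = c at hI
    push_cast
    split_ifs with h1 h2 h2
    · linarith
    · push_cast at hs ⊢; linear_combination -c * c * hs -
        (spin n * (spin n + 1) - magnetic x * magnetic y : ℂ) * hI
    · push_cast at hs ⊢; linear_combination -c * c * hs -
        (spin n * (spin n + 1) - magnetic x * magnetic y : ℂ) * hI
    · simp
  symm := Or.inr (spinY_transpose n)

theorem spinZ_transpose (n : ℕ) : (spinZ n)ᵀ = spinZ n := Matrix.diagonal_transpose _

theorem spinZ_isObservable (n : ℕ) : IsObservable (spinZ n) (((2 ^ n) ^ 2 - 1) / 12) where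
  hermitian := by
    rw [Matrix.IsHermitian, spinZ, Matrix.diagonal_conjTranspose]
    congr 1
    ext x
    simp
  trace := by
    rw [spinZ, Matrix.trace_diagonal, ← Complex.ofReal_sum, sum_magnetic_first]
    simp
  trace_sq := by
    rw [spinZ, Matrix.diagonal_mul_diagonal, Matrix.trace_diagonal]
    simp only [← sq, ← Complex.ofReal_pow, ← Complex.ofReal_sum, sum_magnetic_sq]
    push_cast
    ring
  symm := Or.inl (spinZ_transpose n)

theorem cohW_values (hn : 1 ≤ n) :
    expHaar (cohW n) = 1 / (2 ^ n - 1) ∧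
      expImag (cohW n) = 4 / 3 * ((2 ^ n + 1) / ((2 ^ n - 1) * (2 ^ n + 2))) ∧
      expReal (cohW n) =
        (3 * 2 ^ (2 * n) + 2 ^ n - 2) / (3 * (2 ^ n - 1) ^ 2 * (2 ^ n + 2)) := by
  have hd := one_lt_two_pow_real hn
  have hne : spinX n ≠ spinZ n := by
    intro h
    -- at the highest weight state the diagonal entry of `S_x` is zero, that of `S_z` is `s`
    have h0 := congrFun (congrFun h 0) 0
    have hm : magnetic (0 : Bits n) = spin n := by simp [magnetic]
    have hs : spin n ≠ 0 := by rw [spin]; linarith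
    simp only [spinX, spinZ, Matrix.of_apply, Matrix.diagonal_apply_eq, hm] at h0
    exact hs (Complex.ofReal_eq_zero.1 (by rw [← h0]; simp))
  have hq : ((2 ^ n) ^ 2 - 1 : ℝ) / 12 ≠ 0 := by nlinarith
  obtain ⟨h1, h2, h3⟩ := witness_triple_values hn hq (spinX_isObservable n) (spinY_isObservable n)
    (spinZ_isObservable n) (spinX_transpose n) (spinY_transpose n) (spinZ_transpose n) hne
    (1 / spin n ^ 2)
  rw [cohW, cohOps, h1, h2, h3, spin, pow_mul']
  generalize (2 : ℝ) ^ n = d at hd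
  have : d - 1 ≠ 0 := by linarith
  refine ⟨?_, ?_, ?_⟩
  · field_simp; ring
  · field_simp; ring
  · field_simp; ring

end Spin

/-! ### Twirled Pauli strings -/

section Twirl

variable {n : ℕ}

theorem qubitPerm_conj_pauliString (π : Equiv.Perm (Fin n)) (σ : Fin n → Fin 4) :
    qubitPerm π * pauliString σ * (qubitPerm π)ᴴ = pauliString (σ ∘ ⇑π⁻¹) := by
  have h : ∀ x z : Bits n, x = z ∘ ⇑π⁻¹ ↔ z = x ∘ π := by
    intro x z
    constructor
    · rintro rfl; ext k; simp
    · rintro rfl; ext k; simp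
  ext x y
  simp only [Matrix.mul_apply, qubitPerm, Matrix.of_apply, Matrix.conjTranspose_apply, h,
    ite_mul, one_mul, zero_mul, Finset.sum_ite_eq', Finset.mem_univ, if_true, apply_ite star,
    star_one, star_zero, mul_ite, mul_one, mul_zero]
  simp only [pauliString, Matrix.of_apply, Function.comp_apply]
  rw [← Equiv.prod_comp π fun k => pauli (σ (π⁻¹ k)) (x k) (y k)]
  simp

/-- The sum of a Pauli string over all permutations of the qubits. -/
def orbitSum (σ : Fin n → Fin 4) : Op n := ∑ π : Equiv.Perm (Fin n), pauliString (σ ∘ π)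

theorem twirl_pauliString (σ : Fin n → Fin 4) :
    twirl (pauliString σ) = ((n.factorial : ℂ)⁻¹) • orbitSum σ := by
  rw [twirl, orbitSum, ← Equiv.sum_comp (Equiv.inv (Equiv.Perm (Fin n)))]
  simp only [qubitPerm_conj_pauliString, Equiv.inv_apply, inv_inv]

/-- The overlap with a Pauli string counts the permutations which lead to it. -/
theorem trace_orbitSum_mul (σ τ : Fin n → Fin 4) :
    (orbitSum σ * pauliString τ).trace =
      2 ^ n * ((Finset.univ.filter fun π : Equiv.Perm (Fin n) => σ ∘ π = τ).card : ℂ) := by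
  rw [orbitSum, Finset.sum_mul, Matrix.trace_sum]
  simp only [trace_pauliString_mul]
  rw [← Finset.sum_filter, Finset.sum_const, nsmul_eq_mul, mul_comm]

theorem trace_orbitSum_mul_ne_zero_iff (σ τ : Fin n → Fin 4) :
    (orbitSum σ * pauliString τ).trace ≠ 0 ↔ ∃ π : Equiv.Perm (Fin n), σ ∘ π = τ := by
  rw [trace_orbitSum_mul]
  simp [Finset.filter_eq_empty_iff]

theorem orbitSum_comp (σ : Fin n → Fin 4) (π : Equiv.Perm (Fin n)) :
    orbitSum (σ ∘ π) = orbitSum σ := by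
  exact Equiv.sum_comp (Equiv.mulLeft π) fun π' => pauliString (σ ∘ π')

theorem stringSign_comp (σ : Fin n → Fin 4) (π : Equiv.Perm (Fin n)) :
    stringSign (σ ∘ π) = stringSign σ :=
  Equiv.prod_comp π fun k => pauliSign (σ k)

theorem exists_trace_orbitSum_sq (σ : Fin n → Fin 4) :
    ∃ r : ℝ, 0 < r ∧ (orbitSum σ * orbitSum σ).trace = r := by
  have h : (orbitSum σ * orbitSum σ).trace = ∑ π : Equiv.Perm (Fin n),
      2 ^ n * ((Finset.univ.filter fun π' : Equiv.Perm (Fin n) => σ ∘ π' = σ ∘ π).card : ℂ) := by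
    conv_lhs => enter [1, 2]; rw [orbitSum]
    rw [Finset.mul_sum, Matrix.trace_sum]
    simp only [trace_orbitSum_mul]
  refine ⟨∑ π : Equiv.Perm (Fin n),
    2 ^ n * ((Finset.univ.filter fun π' : Equiv.Perm (Fin n) => σ ∘ π' = σ ∘ π).card : ℝ),
    ?_, ?_⟩
  · refine Finset.sum_pos (fun π _ => ?_) Finset.univ_nonempty
    have : 0 < (Finset.univ.filter fun π' : Equiv.Perm (Fin n) => σ ∘ π' = σ ∘ π).card :=
      Finset.card_pos.2 ⟨π, by simp⟩
    positivity
  · rw [h]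
    push_cast
    rfl

/-- The normalized twirl of a Pauli string. -/
def twirlOp (σ : Fin n → Fin 4) : Op n := normalizeOp (twirl (pauliString σ))

/-- The factorial and the normalization combine into one positive factor. -/
theorem twirlOp_eq (σ : Fin n → Fin 4) :
    ∃ c : ℝ, 0 < c ∧ twirlOp σ = (c : ℂ) • orbitSum σ ∧ (twirlOp σ * twirlOp σ).trace = 2 ^ n := by
  obtain ⟨r, hr, h⟩ := exists_trace_orbitSum_sq σ
  have hf : (0 : ℝ) < (n.factorial : ℝ)⁻¹ := by positivity
  set f : ℝ := (n.factorial : ℝ)⁻¹ with hfdef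
  have ht : twirl (pauliString σ) = (f : ℂ) • orbitSum σ := by
    rw [twirl_pauliString, hfdef]; push_cast; rfl
  have htr : (twirl (pauliString σ) * twirl (pauliString σ)).trace = ((f * f * r : ℝ) : ℂ) := by
    rw [ht, smul_mul_smul_comm, Matrix.trace_smul, h, smul_eq_mul]
    push_cast
    rfl
  have hq : twirlOp σ = ((Real.sqrt (2 ^ n / (f * f * r)) : ℝ) : ℂ) • twirl (pauliString σ) := by
    rw [twirlOp, normalizeOp, htr, Complex.ofReal_re]
  refine ⟨Real.sqrt (2 ^ n / (f * f * r)) * f, by positivity, ?_, ?_⟩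
  · rw [hq, ht, smul_smul]
    push_cast
    rfl
  · rw [hq, smul_mul_smul_comm, Matrix.trace_smul, htr, ← Complex.ofReal_mul,
      Real.mul_self_sqrt (by positivity), smul_eq_mul, ← Complex.ofReal_mul,
      div_mul_cancel₀ _ (by positivity)]
    push_cast
    rfl

theorem twirlOp_eq_iff (σ τ : Fin n → Fin 4) :
    twirlOp σ = twirlOp τ ↔ ∃ π : Equiv.Perm (Fin n), σ ∘ π = τ := by
  constructor
  · intro h
    obtain ⟨c, hc, hσ, -⟩ := twirlOp_eq σ
    obtain ⟨d, hd, hτ, -⟩ := twirlOp_eq τ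
    rw [hσ, hτ] at h
    rw [← trace_orbitSum_mul_ne_zero_iff]
    intro h0
    have h1 : (orbitSum τ * pauliString τ).trace ≠ 0 :=
      (trace_orbitSum_mul_ne_zero_iff τ τ).2 ⟨1, rfl⟩
    have h2 := congrArg (fun M => (M * pauliString τ).trace) h
    simp only [smul_mul_assoc, Matrix.trace_smul, h0, smul_zero] at h2
    exact smul_ne_zero (Complex.ofReal_ne_zero.2 hd.ne') h1 h2.symm
  · rintro ⟨π, rfl⟩
    rw [twirlOp, twirlOp, twirl_pauliString, twirl_pauliString, orbitSum_comp]

theorem orbitSum_transpose (σ : Fin n → Fin 4) :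
    (orbitSum σ)ᵀ = (stringSign σ : ℂ) • orbitSum σ := by
  rw [orbitSum, Matrix.transpose_sum, Finset.smul_sum]
  simp only [pauliString_transpose, stringSign_comp]

theorem twirlOp_transpose (σ : Fin n → Fin 4) :
    (twirlOp σ)ᵀ = (stringSign σ : ℂ) • twirlOp σ := by
  obtain ⟨c, -, hσ, -⟩ := twirlOp_eq σ
  rw [hσ, Matrix.transpose_smul, orbitSum_transpose, smul_comm]

theorem twirlOp_symm_iff (σ : Fin n → Fin 4) : (twirlOp σ)ᵀ = twirlOp σ ↔ stringSign σ = 1 := by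
  rw [twirlOp_transpose]
  rcases stringSign_eq σ with h | h
  · simp [h]
  · simp only [h, Int.cast_neg, Int.cast_one, neg_smul, one_smul]
    refine iff_of_false (fun e => ?_) (by decide)
    obtain ⟨c, -, -, h1⟩ := twirlOp_eq σ
    rw [eq_zero_of_eq_neg e.symm, zero_mul, Matrix.trace_zero] at h1
    exact pow_ne_zero n two_ne_zero h1.symm

theorem twirlOp_isObservable {σ : Fin n → Fin 4} (h : σ ≠ 0) : IsObservable (twirlOp σ) 1 where
  hermitian := by
    obtain ⟨c, -, hσ, -⟩ := twirlOp_eq σ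
    rw [Matrix.IsHermitian, hσ, Matrix.conjTranspose_smul, orbitSum, Matrix.conjTranspose_sum]
    simp only [(pauliString_isHermitian _).eq, Complex.star_def, Complex.conj_ofReal]
  trace := by
    obtain ⟨c, -, hσ, -⟩ := twirlOp_eq σ
    rw [hσ, Matrix.trace_smul, orbitSum, Matrix.trace_sum, Finset.sum_eq_zero, smul_zero]
    intro π _
    refine trace_pauliString fun h0 => h ?_
    ext k
    simpa using congrArg Fin.val (congrFun h0 (π.symm k))
  trace_sq := by
    obtain ⟨c, -, -, h1⟩ := twirlOp_eq σ
    rw [h1]; simp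
  symm := by
    rw [twirlOp_transpose]
    rcases stringSign_eq σ with h | h <;> simp [h]

/-- The type of a Pauli string: the number of occurrences of each Pauli matrix. -/
def pauliType (σ : Fin n → Fin 4) (a : Fin 4) : ℕ := Fintype.card {k // σ k = a}

/-- Types classify the Pauli strings up to permutations of the qubits. -/
theorem pauliType_eq_iff (σ τ : Fin n → Fin 4) :
    pauliType σ = pauliType τ ↔ ∃ π : Equiv.Perm (Fin n), σ ∘ π = τ := by
  constructor
  · intro h
    have e : ∀ a, {k // τ k = a} ≃ {k // σ k = a} := fun a =>
      Fintype.equivOfCardEq (congrFun h a).symm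
    exact ⟨Equiv.ofFiberEquiv e, funext fun k => Equiv.ofFiberEquiv_map e k⟩
  · rintro ⟨π, rfl⟩
    ext a
    exact (Fintype.card_congr (π.subtypeEquiv fun k => Iff.rfl)).symm

theorem exists_pauliType_eq {t : Fin 4 → ℕ} (ht : ∑ a, t a = n) :
    ∃ σ : Fin n → Fin 4, pauliType σ = t := by
  let e : (Σ a, Fin (t a)) ≃ Fin n := Fintype.equivFinOfCardEq (by simpa using ht)
  refine ⟨fun k => (e.symm k).1, ?_⟩
  ext a
  have h : {k // (e.symm k).1 = a} ≃ Fin (t a) :=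
    (e.symm.subtypeEquiv (q := fun p => p.1 = a) fun k => Iff.rfl).trans (Equiv.sigmaSubtype a)
  rw [pauliType, Fintype.card_congr h, Fintype.card_fin]

theorem sum_pauliType (σ : Fin n → Fin 4) : ∑ a, pauliType σ a = n := by
  simp only [pauliType]
  rw [← Fintype.card_sigma, Fintype.card_congr (Equiv.sigmaFiberEquiv σ), Fintype.card_fin]

theorem stringSign_eq_pow (σ : Fin n → Fin 4) : stringSign σ = (-1) ^ pauliType σ 2 := by
  simp only [stringSign, pauliSign]
  rw [Finset.prod_ite, Finset.prod_const, Finset.prod_const_one, mul_one, pauliType,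
    Fintype.card_subtype]

end Twirl

section TypeCounting

open Finset.HasAntidiagonal (antidiagonal)

/-- A type sums to `n`; grouping `Y` with `1` and `X` with `Z` splits the sum over types. -/
theorem sum_antidiagonalTuple_four (n : ℕ) (f : ℕ → ℤ) :
    ∑ t ∈ Finset.Nat.antidiagonalTuple 4 n, f (t 2) =
      ∑ p ∈ antidiagonal n, (∑ r ∈ antidiagonal p.1, f r.1) * (p.2 + 1) := by
  have h : ∀ p : ℕ × ℕ, (∑ r ∈ antidiagonal p.1, f r.1) * ((p.2 : ℤ) + 1) =
      ∑ r ∈ antidiagonal p.1 ×ˢ antidiagonal p.2, f r.1.1 := by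
    intro p
    rw [Finset.sum_product, Finset.sum_mul]
    simp [mul_comm]
  simp only [h]
  rw [Finset.sum_sigma']
  refine Finset.sum_bij' (fun t _ => ⟨(t 2 + t 0, t 1 + t 3), ((t 2, t 0), (t 1, t 3))⟩)
    (fun j _ => ![j.2.1.2, j.2.2.1, j.2.1.1, j.2.2.2]) ?_ ?_ ?_ ?_ ?_
  · intro t ht
    rw [Finset.Nat.mem_antidiagonalTuple, Fin.sum_univ_four] at ht
    simp only [Finset.mem_sigma, Finset.HasAntidiagonal.mem_antidiagonal, Finset.mem_product,
      and_self, and_true]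
    omega
  · rintro ⟨p, r⟩ hj
    simp only [Finset.mem_sigma, Finset.HasAntidiagonal.mem_antidiagonal, Finset.mem_product] at hj
    rw [Finset.Nat.mem_antidiagonalTuple, Fin.sum_univ_four]
    simp
    omega
  · intro t _
    ext a
    fin_cases a <;> rfl
  · rintro ⟨⟨p1, p2⟩, r⟩ hj
    simp only [Finset.mem_sigma, Finset.HasAntidiagonal.mem_antidiagonal, Finset.mem_product] at hj
    obtain ⟨-, h1, h2⟩ := hj
    subst h1 h2
    rfl
  · intro t _
    rfl

/-- The number of types with an even number of factors `Y` minus the number of those with an odd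
number: in the generating function `1 / ((1 + y) (1 - y)³)`, the factor `1 / (1 - y²)` gives the
condition that `p.1` is even, and `1 / (1 - y)²` gives `p.2 + 1`. -/
def typeExcess (n : ℕ) : ℤ := ∑ p ∈ antidiagonal n, if Even p.1 then (p.2 + 1 : ℤ) else 0

theorem typeExcess_add_two (n : ℕ) : typeExcess (n + 2) = typeExcess n + n + 3 := by
  rw [typeExcess, Finset.Nat.sum_antidiagonal_succ, Finset.Nat.sum_antidiagonal_succ, typeExcess]
  have h : ∀ m : ℕ, Even (m + 1 + 1) ↔ Even m := fun m => by simp [Nat.even_add_one]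
  simp only [h]
  simp
  ring

/-- A bound for all `n`, even or odd, which suffices for the limits. -/
theorem typeExcess_bounds (n : ℕ) : 0 ≤ typeExcess n ∧ typeExcess n ≤ (n + 1) ^ 2 := by
  induction n using Nat.twoStepInduction with
  | zero => simp [typeExcess]
  | one => simp [typeExcess, Finset.Nat.antidiagonal_succ]
  | more n ih _ =>
    rw [typeExcess_add_two]
    push_cast
    constructor <;> nlinarith [ih.1, ih.2]

theorem typeExcess_two_mul (m : ℕ) : typeExcess (2 * m) = (m + 1) ^ 2 := by
  induction m with
  | zero => simp [typeExcess]
  | succ m ih =>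
    rw [mul_add, mul_one, typeExcess_add_two, ih]
    push_cast
    ring

theorem sum_antidiagonal_snd (n : ℕ) :
    ∑ p ∈ antidiagonal n, ((p.2 : ℝ) + 1) = (n + 1) * (n + 2) / 2 := by
  induction n with
  | zero => simp
  | succ n ih =>
    rw [Finset.Nat.sum_antidiagonal_succ, ih]
    push_cast
    ring

theorem sum_antidiagonal_mul (n : ℕ) :
    ∑ p ∈ antidiagonal n, ((p.1 : ℝ) + 1) * (p.2 + 1) =
      (n + 1) * (n + 2) * (n + 3) / 6 := by
  induction n with
  | zero => norm_num
  | succ n ih =>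
    have h : ∀ p : ℕ × ℕ, (((p.1 + 1 : ℕ) : ℝ) + 1) * (p.2 + 1) =
        ((p.1 : ℝ) + 1) * (p.2 + 1) + (p.2 + 1) := fun p => by push_cast; ring
    rw [Finset.Nat.sum_antidiagonal_succ]
    simp only [h, Finset.sum_add_distrib]
    rw [ih, ← Finset.sum_add_distrib, sum_antidiagonal_snd]
    push_cast
    ring

theorem sum_antidiagonal_neg_one_pow (u : ℕ) :
    ∑ r ∈ antidiagonal u, (-1 : ℤ) ^ r.1 = if Even u then 1 else 0 := by
  rw [Finset.Nat.sum_antidiagonal_eq_sum_range_succ_mk, neg_one_geom_sum]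
  simp only [Nat.even_add_one]
  split_ifs <;> simp_all

/-- Types of Pauli strings with an even and an odd number of factors `Y`: their sum is the number of
all types, their difference `typeExcess n`. -/
theorem card_types (n : ℕ) :
    (((Finset.Nat.antidiagonalTuple 4 n).filter fun t => Even (t 2)).card : ℝ) =
      (tetrahedral (n + 1) + typeExcess n) / 2 ∧
    (((Finset.Nat.antidiagonalTuple 4 n).filter fun t => ¬ Even (t 2)).card : ℝ) =
      (tetrahedral (n + 1) - typeExcess n) / 2 := by
  have h1 := sum_antidiagonalTuple_four n fun _ => 1
  have h2 := sum_antidiagonalTuple_four n fun i => (-1) ^ i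
  rw [← Finset.sum_filter_add_sum_filter_not _ (fun t : Fin 4 → ℕ => Even (t 2)),
    Finset.sum_const, Finset.sum_const] at h1
  rw [← Finset.sum_filter_add_sum_filter_not _ (fun t : Fin 4 → ℕ => Even (t 2)),
    Finset.sum_congr (g := fun _ => (1 : ℤ)) rfl
      (fun t ht => (Finset.mem_filter.1 ht).2.neg_one_pow), Finset.sum_const,
    Finset.sum_congr (g := fun _ => (-1 : ℤ)) rfl
      (fun t ht => (Nat.not_even_iff_odd.1 (Finset.mem_filter.1 ht).2).neg_one_pow),
    Finset.sum_const] at h2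
  simp only [sum_antidiagonal_neg_one_pow, ite_mul, one_mul, zero_mul] at h2
  rw [← typeExcess] at h2
  simp only [Finset.sum_const, Finset.Nat.card_antidiagonal, nsmul_eq_mul, mul_one] at h1 h2
  have h1' := congrArg (Int.cast : ℤ → ℝ) h1
  have h2' := congrArg (Int.cast : ℤ → ℝ) h2
  push_cast at h1' h2'
  rw [sum_antidiagonal_mul] at h1'
  have ht : tetrahedral (n + 1) = (n + 1) * (n + 2) * (n + 3) / 6 := by
    rw [tetrahedral]
    push_cast
    ring
  rw [ht]
  constructor <;> linarith

end TypeCounting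

section Equivariance

variable {n : ℕ}

open Classical in
/-- The distinct normalized twirls are indexed by the types other than that of the identity, and the
symmetric ones are those with an even number of factors `Y`. -/
theorem exists_snOps_eq_image (n : ℕ) : ∃ Q : (Fin 4 → ℕ) → Op n,
    snOps n = ((Finset.Nat.antidiagonalTuple 4 n).erase (pauliType (0 : Fin n → Fin 4))).image Q ∧
    Set.InjOn Q ((Finset.Nat.antidiagonalTuple 4 n).erase (pauliType (0 : Fin n → Fin 4))) ∧
    ∀ t ∈ (Finset.Nat.antidiagonalTuple 4 n).erase (pauliType (0 : Fin n → Fin 4)),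
      IsObservable (Q t) 1 ∧ ((Q t)ᵀ = Q t ↔ Even (t 2)) := by
  -- a representative of each type
  have hex : ∀ t : Fin 4 → ℕ, ∃ σ : Fin n → Fin 4,
      t ∈ Finset.Nat.antidiagonalTuple 4 n → pauliType σ = t := by
    intro t
    by_cases ht : t ∈ Finset.Nat.antidiagonalTuple 4 n
    · obtain ⟨σ, hσ⟩ := exists_pauliType_eq (Finset.Nat.mem_antidiagonalTuple.1 ht)
      exact ⟨σ, fun _ => hσ⟩
    · exact ⟨0, fun h => absurd h ht⟩
  choose s hs using hex
  have hmem : ∀ σ : Fin n → Fin 4, pauliType σ ∈ Finset.Nat.antidiagonalTuple 4 n := fun σ =>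
    Finset.Nat.mem_antidiagonalTuple.2 (sum_pauliType σ)
  have hzero : ∀ σ : Fin n → Fin 4, pauliType σ = pauliType (0 : Fin n → Fin 4) ↔ σ = 0 := by
    intro σ
    constructor
    · intro h
      obtain ⟨π, hπ⟩ := (pauliType_eq_iff 0 σ).1 h.symm
      rw [← hπ]
      rfl
    · rintro rfl; rfl
  refine ⟨fun t => twirlOp (s t), ?_, ?_, ?_⟩
  · ext M
    simp only [snOps, stabOps_eq, Finset.image_image, Finset.mem_image, Finset.mem_filter,
      Finset.mem_univ, true_and, Function.comp_apply, Finset.mem_erase]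
    constructor
    · rintro ⟨σ, hσ, rfl⟩
      refine ⟨pauliType σ, ⟨fun h => hσ ((hzero σ).1 h), hmem σ⟩, ?_⟩
      exact (twirlOp_eq_iff _ _).2 ((pauliType_eq_iff _ _).1 (hs _ (hmem σ)))
    · rintro ⟨t, ⟨ht0, ht⟩, rfl⟩
      refine ⟨s t, fun h => ht0 ?_, rfl⟩
      rw [← hs t ht, h]
  · intro t ht t' ht' h
    have h1 := (Finset.mem_erase.1 (Finset.mem_coe.1 ht)).2
    have h1' := (Finset.mem_erase.1 (Finset.mem_coe.1 ht')).2
    rw [← hs t h1, ← hs t' h1']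
    exact (pauliType_eq_iff _ _).2 ((twirlOp_eq_iff _ _).1 h)
  · intro t ht
    obtain ⟨ht0, ht⟩ := Finset.mem_erase.1 ht
    refine ⟨twirlOp_isObservable fun h => ht0 ?_, ?_⟩
    · rw [← hs t ht, h]
    · rw [twirlOp_symm_iff, stringSign_eq_pow, hs t ht, neg_one_pow_eq_one_iff_even (by decide)]

open Classical in
theorem snOps_counts (n : ℕ) :
    (∀ P ∈ snOps n, IsObservable P 1) ∧
    (((snOps n).filter fun P => Pᵀ = P).card : ℝ) =
      (tetrahedral (n + 1) + typeExcess n) / 2 - 1 ∧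
    (((snOps n).filter fun P => ¬ Pᵀ = P).card : ℝ) =
      (tetrahedral (n + 1) - typeExcess n) / 2 := by
  obtain ⟨Q, hQ, hinj, hprop⟩ := exists_snOps_eq_image n
  have h0 : pauliType (0 : Fin n → Fin 4) ∈
      (Finset.Nat.antidiagonalTuple 4 n).filter fun t => Even (t 2) := by
    rw [Finset.mem_filter, Finset.Nat.mem_antidiagonalTuple]
    refine ⟨sum_pauliType _, ?_⟩
    have : pauliType (0 : Fin n → Fin 4) 2 = 0 := by
      rw [pauliType, Fintype.card_eq_zero_iff]
      exact ⟨fun k => absurd k.2 (show ¬(0 : Fin 4) = 2 by decide)⟩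
    rw [this]
    exact Even.zero
  refine ⟨?_, ?_, ?_⟩
  · intro P hP
    rw [hQ, Finset.mem_image] at hP
    obtain ⟨t, ht, rfl⟩ := hP
    exact (hprop t ht).1
  · rw [hQ, card_filter_image hinj, Finset.filter_congr fun t ht => (hprop t ht).2,
      Finset.filter_erase, ← (card_types n).1, eq_sub_iff_add_eq, ← Nat.cast_add_one,
      Finset.card_erase_add_one h0]
  · rw [hQ, card_filter_image hinj, Finset.filter_congr fun t ht => (hprop t ht).2.not,
      Finset.filter_erase, ← (card_types n).2, Finset.erase_eq_of_notMem]
    intro h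
    exact (Finset.mem_filter.1 h).2 (Finset.mem_filter.1 h0).2

/-- The values for all `n`, even or odd, in terms of `typeExcess n`. -/
theorem snW_values (hn : 1 ≤ n) :
    expHaar (snW n) = (tetrahedral (n + 1) - 1) / (2 ^ (2 * n) - 1) ∧
    expImag (snW n) =
      (tetrahedral (n + 1) + typeExcess n - 2) / ((2 ^ n - 1) * (2 ^ n + 2)) ∧
    expReal (snW n) =
      (((tetrahedral (n + 1) + typeExcess n) / 2 - 1) * (2 ^ n - 2) +
        (tetrahedral (n + 1) - typeExcess n) / 2 * (2 ^ n + 2)) /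
          ((2 ^ n - 1) ^ 2 * (2 ^ n + 2)) := by
  classical
  obtain ⟨hobs, h1, h2⟩ := snOps_counts n
  have hc : ((snOps n).card : ℝ) = tetrahedral (n + 1) - 1 := by
    rw [← Finset.card_filter_add_card_filter_not (fun P : Op n => Pᵀ = P), Nat.cast_add, h1, h2]
    ring
  have hd := one_lt_two_pow_real hn
  rw [snW, expHaar_witness_one hobs, expImag_witness_one hobs, expReal_witness_one hn hobs, h1,
    h2, hc, pow_mul']
  generalize (2 : ℝ) ^ n = d at hd
  have : d - 1 ≠ 0 := by linarith
  have h3 : d ^ 2 - 1 = (d - 1) * (d + 1) := by ring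
  rw [h3]
  refine ⟨?_, ?_, ?_⟩
  · field_simp
  · field_simp
  · field_simp

theorem snW_values_even (hn : 1 ≤ n) (he : Even n) :
    expImag (snW n) =
      2 * (1 / 6 * ((n : ℝ) / 2 + 1) * ((n : ℝ) / 2 + 2) * (2 * n + 3) - 1) /
        ((2 ^ n - 1) * (2 ^ n + 2)) ∧
    expReal (snW n) =
      (2 ^ n * n * (n * (n + 6) + 11) - 3 * n * (n + 4)) /
        (6 * (2 ^ n - 1) ^ 2 * (2 ^ n + 2)) := by
  obtain ⟨-, h1, h2⟩ := snW_values hn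
  obtain ⟨m, rfl⟩ := even_iff_two_dvd.1 he
  have ht : tetrahedral (2 * m + 1) = (2 * m + 1) * (2 * m + 2) * (2 * m + 3) / 6 := by
    rw [tetrahedral]
    push_cast
    ring
  have hd := one_lt_two_pow_real hn
  rw [h1, h2, typeExcess_two_mul, ht]
  generalize (2 : ℝ) ^ (2 * m) = d at hd
  have : d - 1 ≠ 0 := by linarith
  push_cast
  constructor
  · congr 1
    ring
  · field_simp
    ring

end Equivariance

/-! ### Ratios for large `n` -/

section Limits

/-- Limits as `n → ∞` of functions of `2⁻ⁿ` and a second null sequence. -/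
theorem tendsto_of_eventually_eq {u r : ℕ → ℝ} (hr : Tendsto r atTop (𝓝 0)) (F : ℝ × ℝ → ℝ)
    (hF : ContinuousAt F (0, 0)) {L : ℝ} (hL : F (0, 0) = L)
    (h : ∀ n, 1 ≤ n → u n = F (((2 : ℝ) ^ n)⁻¹, r n)) : Tendsto u atTop (𝓝 L) := by
  have he : Tendsto (fun n : ℕ => ((2 : ℝ) ^ n)⁻¹) atTop (𝓝 0) :=
    (tendsto_pow_atTop_atTop_of_one_lt (by norm_num)).inv_tendsto_atTop
  have h1 : Tendsto (fun n => F (((2 : ℝ) ^ n)⁻¹, r n)) atTop (𝓝 L) := by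
    rw [← hL]
    exact hF.tendsto.comp (he.prodMk_nhds hr)
  refine h1.congr' ?_
  filter_upwards [eventually_ge_atTop 1] with n hn
  exact (h n hn).symm

theorem tendsto_ent_ratios :
    Tendsto (fun n => expImag (entW n) / expHaar (entW n)) atTop (𝓝 (4 / 3)) ∧
    Tendsto (fun n => expReal (entW n) / expHaar (entW n)) atTop (𝓝 1) := by
  constructor
  · refine tendsto_of_eventually_eq tendsto_const_nhds
      (fun p => 4 / 3 * (1 + p.1) / (1 + 2 * p.1))
      (by fun_prop (disch := norm_num)) (by norm_num) fun n hn => ?_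
    have hd := one_lt_two_pow_real hn
    obtain ⟨h0, h1, -⟩ := entW_values hn
    rw [h0, h1]
    field_simp
  · refine tendsto_of_eventually_eq tendsto_const_nhds
      (fun p => (3 - 2 * p.1) * (1 + p.1) / (3 * (1 - p.1) * (1 + 2 * p.1)))
      (by fun_prop (disch := norm_num)) (by norm_num) fun n hn => ?_
    have hd := one_lt_two_pow_real hn
    obtain ⟨h0, -, h1⟩ := entW_values hn
    rw [h0, h1]
    have : (2 : ℝ) ^ n - 1 ≠ 0 := by linarith
    field_simp

theorem tendsto_uent_ratios :
    Tendsto (fun n => expImag (uentW n) / expHaar (uentW n)) atTop (𝓝 (4 / 3)) ∧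
    Tendsto (fun n => expReal (uentW n) / expHaar (uentW n)) atTop (𝓝 1) := by
  constructor
  · refine tendsto_of_eventually_eq tendsto_const_nhds
      (fun p => 4 / 3 * (1 + p.1) / (1 + 2 * p.1))
      (by fun_prop (disch := norm_num)) (by norm_num) fun n hn => ?_
    have hd := one_lt_two_pow_real hn
    have hn0 : (n : ℝ) ≠ 0 := by positivity
    obtain ⟨h0, h1, -⟩ := uentW_values hn
    rw [h0, h1]
    field_simp
  · refine tendsto_of_eventually_eq tendsto_const_nhds
      (fun p => (3 - 2 * p.1) * (1 + p.1) / (3 * (1 - p.1) * (1 + 2 * p.1)))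
      (by fun_prop (disch := norm_num)) (by norm_num) fun n hn => ?_
    have hd := one_lt_two_pow_real hn
    have hn0 : (n : ℝ) ≠ 0 := by positivity
    obtain ⟨h0, -, h1⟩ := uentW_values hn
    rw [h0, h1]
    have : (2 : ℝ) ^ n - 1 ≠ 0 := by linarith
    field_simp

theorem tendsto_ferm_ratios :
    Tendsto (fun n => expImag (fermW n) / expHaar (fermW n)) atTop (𝓝 1) ∧
    Tendsto (fun n => expReal (fermW n) / expHaar (fermW n)) atTop (𝓝 1) := by
  constructor
  · refine tendsto_of_eventually_eq tendsto_inv_atTop_nhds_zero_nat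
      (fun p => 2 / (2 - p.2) * (1 + p.1) / (1 + 2 * p.1))
      (by fun_prop (disch := norm_num)) (by norm_num) fun n hn => ?_
    have hd := one_lt_two_pow_real hn
    have hn1 : (1 : ℝ) ≤ n := by exact_mod_cast hn
    have hn2 : (2 * n - 1 : ℝ) ≠ 0 := by linarith
    obtain ⟨h0, h1, -⟩ := fermW_values hn
    rw [h0, h1]
    field_simp
  · refine tendsto_of_eventually_eq tendsto_inv_atTop_nhds_zero_nat
      (fun p => (1 - p.1 * (2 * p.2 / (2 - p.2))) * (1 + p.1) / ((1 - p.1) * (1 + 2 * p.1)))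
      (by fun_prop (disch := norm_num)) (by norm_num) fun n hn => ?_
    have hd := one_lt_two_pow_real hn
    have hn1 : (1 : ℝ) ≤ n := by exact_mod_cast hn
    have hn2 : (2 * n - 1 : ℝ) ≠ 0 := by linarith
    obtain ⟨h0, -, h1⟩ := fermW_values hn
    rw [h0, h1]
    have : (2 : ℝ) ^ n - 1 ≠ 0 := by linarith
    field_simp

theorem tendsto_imag_ratios :
    Tendsto (fun n => expImag (imagW n) / expHaar (imagW n)) atTop (𝓝 2) ∧
    Tendsto (fun n => expReal (imagW n) / expHaar (imagW n)) atTop (𝓝 1) := by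
  constructor
  · refine tendsto_of_eventually_eq tendsto_const_nhds
      (fun p => 2 * (1 + p.1) / (1 + 2 * p.1))
      (by fun_prop (disch := norm_num)) (by norm_num) fun n hn => ?_
    have hd := one_lt_two_pow_real hn
    obtain ⟨h0, h1, -⟩ := imagW_values hn
    rw [h0, h1, pow_succ]
    field_simp
  · refine tendsto_of_eventually_eq tendsto_const_nhds
      (fun p => (1 - 2 * p.1) * (1 + p.1) / ((1 - p.1) * (1 + 2 * p.1)))
      (by fun_prop (disch := norm_num)) (by norm_num) fun n hn => ?_
    have hd := one_lt_two_pow_real hn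
    obtain ⟨h0, -, h1⟩ := imagW_values hn
    rw [h0, h1, pow_succ]
    have : (2 : ℝ) ^ n - 1 ≠ 0 := by linarith
    field_simp

theorem tendsto_real_ratios :
    Tendsto (fun n => expImag (realW n) / expHaar (realW n)) atTop (𝓝 0) ∧
    Tendsto (fun n => expReal (realW n) / expHaar (realW n)) atTop (𝓝 1) := by
  constructor
  · refine tendsto_of_eventually_eq tendsto_const_nhds (fun _ => 0)
      (by fun_prop) (by norm_num) fun n hn => ?_
    obtain ⟨-, h1, -⟩ := realW_values hn
    rw [h1, zero_div]
  · refine tendsto_of_eventually_eq tendsto_const_nhds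
      (fun p => (1 + p.1) / (1 - p.1))
      (by fun_prop (disch := norm_num)) (by norm_num) fun n hn => ?_
    have hd := one_lt_two_pow_real hn
    obtain ⟨h0, -, h1⟩ := realW_values hn
    rw [h0, h1]
    have : (2 : ℝ) ^ n - 1 ≠ 0 := by linarith
    field_simp

theorem tendsto_coh_ratios :
    Tendsto (fun n => expImag (cohW n) / expHaar (cohW n)) atTop (𝓝 (4 / 3)) ∧
    Tendsto (fun n => expReal (cohW n) / expHaar (cohW n)) atTop (𝓝 1) := by
  constructor
  · refine tendsto_of_eventually_eq tendsto_const_nhds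
      (fun p => 4 / 3 * (1 + p.1) / (1 + 2 * p.1))
      (by fun_prop (disch := norm_num)) (by norm_num) fun n hn => ?_
    have hd := one_lt_two_pow_real hn
    obtain ⟨h0, h1, -⟩ := cohW_values hn
    rw [h0, h1]
    have : (2 : ℝ) ^ n - 1 ≠ 0 := by linarith
    field_simp
  · refine tendsto_of_eventually_eq tendsto_const_nhds
      (fun p => (3 + p.1 - 2 * p.1 ^ 2) / (3 * (1 - p.1) * (1 + 2 * p.1)))
      (by fun_prop (disch := norm_num)) (by norm_num) fun n hn => ?_
    have hd := one_lt_two_pow_real hn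
    obtain ⟨h0, -, h1⟩ := cohW_values hn
    rw [h0, h1, pow_mul']
    have : (2 : ℝ) ^ n - 1 ≠ 0 := by linarith
    field_simp

theorem tendsto_stab_ratios :
    Tendsto (fun n => expImag (stabW n) / expHaar (stabW n)) atTop (𝓝 2) ∧
    Tendsto (fun n => expReal (stabW n) / expHaar (stabW n)) atTop (𝓝 1) := by
  constructor
  · refine tendsto_of_eventually_eq tendsto_const_nhds
      (fun p => 2 * (1 + 3 * p.1) / (1 + 6 * p.1))
      (by fun_prop (disch := norm_num)) (by norm_num) fun n hn => ?_
    have hd := one_lt_two_pow_real hn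
    obtain ⟨h0, h1, -⟩ := stabW_values hn
    rw [h0, h1]
    field_simp
    ring
  · refine tendsto_of_eventually_eq tendsto_const_nhds
      (fun p => (1 + 3 * p.1 - 2 * p.1 ^ 2) * (1 + 3 * p.1) /
        ((1 - p.1) * (1 + p.1) * (1 + 6 * p.1)))
      (by fun_prop (disch := norm_num)) (by norm_num) fun n hn => ?_
    have hd := one_lt_two_pow_real hn
    obtain ⟨h0, -, h1⟩ := stabW_values hn
    rw [h0, h1, four_pow_eq]
    have : (2 : ℝ) ^ n - 1 ≠ 0 := by linarith
    field_simp
    ring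

theorem tetrahedral_sub_one (n : ℕ) :
    tetrahedral (n + 1) - 1 = n * (n ^ 2 + 6 * n + 11) / 6 := by
  rw [tetrahedral]
  push_cast
  ring

/-- Symmetric and antisymmetric types balance: their difference grows quadratically, while their
number grows cubically. -/
theorem tendsto_typeExcess_ratio :
    Tendsto (fun n : ℕ => ((typeExcess n : ℝ) - 1) / (tetrahedral (n + 1) - 1)) atTop (𝓝 0) := by
  have h6 : Tendsto (fun n : ℕ => 6 * ((n : ℝ))⁻¹) atTop (𝓝 0) := by
    simpa using tendsto_inv_atTop_nhds_zero_nat.const_mul (6 : ℝ)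
  refine squeeze_zero_norm' ?_ h6
  filter_upwards [eventually_ge_atTop 1] with n hn
  have hn1 : (1 : ℝ) ≤ n := by exact_mod_cast hn
  obtain ⟨h1, h2⟩ := typeExcess_bounds n
  have h1' : (0 : ℝ) ≤ typeExcess n := by exact_mod_cast h1
  have h2' : (typeExcess n : ℝ) ≤ (n + 1) ^ 2 := by exact_mod_cast h2
  have habs : |(typeExcess n : ℝ) - 1| ≤ (n + 1) ^ 2 := by
    rw [abs_le]
    constructor <;> nlinarith
  have hpos : 0 < tetrahedral (n + 1) - 1 := by
    rw [tetrahedral_sub_one]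
    positivity
  rw [Real.norm_eq_abs, abs_div, abs_of_pos hpos, div_le_iff₀ hpos, tetrahedral_sub_one]
  refine habs.trans ?_
  field_simp
  nlinarith

theorem tendsto_sn_ratios :
    Tendsto (fun n => expImag (snW n) / expHaar (snW n)) atTop (𝓝 1) ∧
    Tendsto (fun n => expReal (snW n) / expHaar (snW n)) atTop (𝓝 1) := by
  constructor
  · refine tendsto_of_eventually_eq tendsto_typeExcess_ratio
      (fun p => (1 + p.2) * (1 + p.1) / (1 + 2 * p.1))
      (by fun_prop (disch := norm_num)) (by norm_num) fun n hn => ?_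
    have hd := one_lt_two_pow_real hn
    have hn1 : (1 : ℝ) ≤ n := by exact_mod_cast hn
    obtain ⟨h0, h1, -⟩ := snW_values hn
    have hpos : tetrahedral (n + 1) - 1 ≠ 0 := by
      rw [tetrahedral_sub_one]
      positivity
    rw [h0, h1, pow_mul', show ((2 : ℝ) ^ n) ^ 2 - 1 = (2 ^ n - 1) * (2 ^ n + 1) by ring]
    have : (2 : ℝ) ^ n - 1 ≠ 0 := by linarith
    field_simp
    ring
  · refine tendsto_of_eventually_eq tendsto_typeExcess_ratio
      (fun p => (1 - 2 * p.2 * p.1) * (1 + p.1) / ((1 - p.1) * (1 + 2 * p.1)))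
      (by fun_prop (disch := norm_num)) (by norm_num) fun n hn => ?_
    have hd := one_lt_two_pow_real hn
    have hn1 : (1 : ℝ) ≤ n := by exact_mod_cast hn
    obtain ⟨h0, -, h1⟩ := snW_values hn
    have hpos : tetrahedral (n + 1) - 1 ≠ 0 := by
      rw [tetrahedral_sub_one]
      positivity
    rw [h0, h1, pow_mul', show ((2 : ℝ) ^ n) ^ 2 - 1 = (2 ^ n - 1) * (2 ^ n + 1) by ring]
    have : (2 : ℝ) ^ n - 1 ≠ 0 := by linarith
    field_simp
    ring

theorem integrable_witness {n : ℕ} (C : ℝ) (Ps : Finset (Op n)) (k : ℕ) :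
    Integrable (fun U => witness C Ps k (haarKet U)) (haarProb (Bits n) ℂ) ∧
    Integrable (fun U => witness C Ps k (imagKet U)) (haarProb (Bits n) ℝ) ∧
    Integrable (fun U => witness C Ps k (realKet U)) (haarProb (Bits n) ℝ) :=
  ⟨integrable_of_continuous ((continuous_witness C Ps k).comp continuous_haarKet),
    integrable_of_continuous ((continuous_witness C Ps k).comp continuous_imagKet),
    integrable_of_continuous ((continuous_witness C Ps k).comp continuous_realKet)⟩

end Limits

end QRT

end

theorem mainTheorem2 :
    (∀ n : ℕ, 1 ≤ n →
      -- all the expectations exist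
      (∀ Λ ∈ ({QRT.entW n, QRT.fermW n, QRT.imagW n, QRT.realW n, QRT.cohW n, QRT.stabW n,
            QRT.snW n, QRT.uentW n} : Set (QRT.Ket n → ℝ)),
        Integrable (fun U => Λ (QRT.haarKet U)) (QRT.haarProb (QRT.Bits n) ℂ) ∧
        Integrable (fun U => Λ (QRT.imagKet U)) (QRT.haarProb (QRT.Bits n) ℝ) ∧
        Integrable (fun U => Λ (QRT.realKet U)) (QRT.haarProb (QRT.Bits n) ℝ)) ∧
      -- entanglement
      QRT.expHaar (QRT.entW n) = 3 / (2 ^ n + 1) ∧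
      QRT.expImag (QRT.entW n) = 4 / (2 ^ n + 2) ∧
      QRT.expReal (QRT.entW n) = (3 * 2 ^ n - 2) / ((2 ^ n - 1) * (2 ^ n + 2)) ∧
      -- fermionic non-Gaussianity
      QRT.expHaar (QRT.fermW n) = (2 * n - 1) / (2 ^ n + 1) ∧
      QRT.expImag (QRT.fermW n) = 2 * n / (2 ^ n + 2) ∧
      QRT.expReal (QRT.fermW n) =
        (2 ^ n * (2 * n - 1) - 2) / ((2 ^ n - 1) * (2 ^ n + 2)) ∧
      -- imaginarity
      QRT.expHaar (QRT.imagW n) = (2 ^ n + 2) / (2 ^ (n + 1) + 2) ∧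
      QRT.expImag (QRT.imagW n) = 1 ∧
      QRT.expReal (QRT.imagW n) = (2 ^ n - 2) / (2 * (2 ^ n - 1)) ∧
      -- realness
      QRT.expHaar (QRT.realW n) = (2 ^ n - 1) / (2 ^ n + 1) ∧
      QRT.expImag (QRT.realW n) = 0 ∧
      QRT.expReal (QRT.realW n) = 1 ∧
      -- spin coherence
      QRT.expHaar (QRT.cohW n) = 1 / (2 ^ n - 1) ∧
      QRT.expImag (QRT.cohW n) = 4 / 3 * ((2 ^ n + 1) / ((2 ^ n - 1) * (2 ^ n + 2))) ∧
      QRT.expReal (QRT.cohW n) =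
        (3 * 2 ^ (2 * n) + 2 ^ n - 2) / (3 * (2 ^ n - 1) ^ 2 * (2 ^ n + 2)) ∧
      -- Clifford non-stabilizerness
      QRT.expHaar (QRT.stabW n) = 3 / (3 + 2 ^ n) ∧
      QRT.expImag (QRT.stabW n) = 6 / (6 + 2 ^ n) ∧
      QRT.expReal (QRT.stabW n) =
        3 * (3 * 2 ^ n + 4 ^ n - 2) / ((2 ^ n - 1) * (2 ^ n + 1) * (2 ^ n + 6)) ∧
      -- equivariance under qubit permutations
      QRT.expHaar (QRT.snW n) = (QRT.tetrahedral (n + 1) - 1) / (2 ^ (2 * n) - 1) ∧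
      (Even n → QRT.expImag (QRT.snW n) =
        2 * (1 / 6 * ((n : ℝ) / 2 + 1) * ((n : ℝ) / 2 + 2) * (2 * n + 3) - 1) /
          ((2 ^ n - 1) * (2 ^ n + 2))) ∧
      (Even n → QRT.expReal (QRT.snW n) =
        (2 ^ n * n * (n * (n + 6) + 11) - 3 * n * (n + 4)) /
          (6 * (2 ^ n - 1) ^ 2 * (2 ^ n + 2))) ∧
      -- non-uniform entanglement
      QRT.expHaar (QRT.uentW n) = 3 / (n * (2 ^ n + 1)) ∧
      QRT.expImag (QRT.uentW n) = 4 / (n * (2 ^ n + 2)) ∧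
      QRT.expReal (QRT.uentW n) = (3 * 2 ^ n - 2) / (n * (2 ^ n - 1) * (2 ^ n + 2))) ∧
    -- the large-`n` ratios
    Tendsto (fun n => QRT.expImag (QRT.entW n) / QRT.expHaar (QRT.entW n)) atTop (𝓝 (4 / 3)) ∧
    Tendsto (fun n => QRT.expReal (QRT.entW n) / QRT.expHaar (QRT.entW n)) atTop (𝓝 1) ∧
    Tendsto (fun n => QRT.expImag (QRT.fermW n) / QRT.expHaar (QRT.fermW n)) atTop (𝓝 1) ∧
    Tendsto (fun n => QRT.expReal (QRT.fermW n) / QRT.expHaar (QRT.fermW n)) atTop (𝓝 1) ∧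
    Tendsto (fun n => QRT.expImag (QRT.imagW n) / QRT.expHaar (QRT.imagW n)) atTop (𝓝 2) ∧
    Tendsto (fun n => QRT.expReal (QRT.imagW n) / QRT.expHaar (QRT.imagW n)) atTop (𝓝 1) ∧
    Tendsto (fun n => QRT.expImag (QRT.realW n) / QRT.expHaar (QRT.realW n)) atTop (𝓝 0) ∧
    Tendsto (fun n => QRT.expReal (QRT.realW n) / QRT.expHaar (QRT.realW n)) atTop (𝓝 1) ∧
    Tendsto (fun n => QRT.expImag (QRT.cohW n) / QRT.expHaar (QRT.cohW n)) atTop (𝓝 (4 / 3)) ∧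
    Tendsto (fun n => QRT.expReal (QRT.cohW n) / QRT.expHaar (QRT.cohW n)) atTop (𝓝 1) ∧
    Tendsto (fun n => QRT.expImag (QRT.stabW n) / QRT.expHaar (QRT.stabW n)) atTop (𝓝 2) ∧
    Tendsto (fun n => QRT.expReal (QRT.stabW n) / QRT.expHaar (QRT.stabW n)) atTop (𝓝 1) ∧
    Tendsto (fun n => QRT.expImag (QRT.snW n) / QRT.expHaar (QRT.snW n)) atTop (𝓝 1) ∧
    Tendsto (fun n => QRT.expReal (QRT.snW n) / QRT.expHaar (QRT.snW n)) atTop (𝓝 1) ∧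
    Tendsto (fun n => QRT.expImag (QRT.uentW n) / QRT.expHaar (QRT.uentW n)) atTop (𝓝 (4 / 3)) ∧
    Tendsto (fun n => QRT.expReal (QRT.uentW n) / QRT.expHaar (QRT.uentW n)) atTop (𝓝 1) := by
  refine ⟨fun n hn => ?_, QRT.tendsto_ent_ratios.1, QRT.tendsto_ent_ratios.2,
    QRT.tendsto_ferm_ratios.1, QRT.tendsto_ferm_ratios.2, QRT.tendsto_imag_ratios.1,
    QRT.tendsto_imag_ratios.2, QRT.tendsto_real_ratios.1, QRT.tendsto_real_ratios.2,
    QRT.tendsto_coh_ratios.1, QRT.tendsto_coh_ratios.2, QRT.tendsto_stab_ratios.1,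
    QRT.tendsto_stab_ratios.2, QRT.tendsto_sn_ratios.1, QRT.tendsto_sn_ratios.2,
    QRT.tendsto_uent_ratios.1, QRT.tendsto_uent_ratios.2⟩
  obtain ⟨e1, e2, e3⟩ := QRT.entW_values hn
  obtain ⟨f1, f2, f3⟩ := QRT.fermW_values hn
  obtain ⟨i1, i2, i3⟩ := QRT.imagW_values hn
  obtain ⟨r1, r2, r3⟩ := QRT.realW_values hn
  obtain ⟨c1, c2, c3⟩ := QRT.cohW_values hn
  obtain ⟨s1, s2, s3⟩ := QRT.stabW_values hn
  obtain ⟨u1, u2, u3⟩ := QRT.uentW_values hn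
  refine ⟨?_, e1, e2, e3, f1, f2, f3, i1, i2, i3, r1, r2, r3, c1, c2, c3, s1, s2, s3,
    (QRT.snW_values hn).1, fun he => (QRT.snW_values_even hn he).1,
    fun he => (QRT.snW_values_even hn he).2, u1, u2, u3⟩
  rintro Λ (rfl | rfl | rfl | rfl | rfl | rfl | rfl | rfl) <;>
    exact QRT.integrable_witness _ _ _
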